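/- All graphs are finite and simple. For an edge $e=xy$ of a graph $G$, let $G/e$ be the simple graph obtained by contracting $e$: the vertices $x,y$ are replaced by one vertex $v_e$ adjacent to every other vertex that is adjacent to $x$ or $y$ (no loops or multiple edges arise). Let $H$ be a *minor* of $G$ if it is obtained by zero or more edge contractions from a subgraph of $G$, and let $h(G)$ be the Hadwiger number, the largest $t$ such that $K^t$ is a minor of $G$. A *solid graph* is one of the following. A *pyramid*: a cycle together with one further vertex joined to at least three vertices of the cycle. A *trihedron*: the union of three internally disjoint paths, each of length at least $2$, with the same two distinct ends. A *stamp*: the union of a triangle and three paths of length at least $1$ that start at the three vertices of the triangle, end at a common vertex $x$, and are disjoint apart from $x$. A *prism*: the union of two vertex-disjoint triangles $x_1x_2x_3$, $y_1y_2y_3$ and three pairwise vertex-disjoint paths joining $x_i$ to $y_i$ ($i=1,2,3$). Let $S(G)$ be the set of *solids* in $G$, i.e. induced subgraphs of $G$ isomorphic to a solid graph, let $C(G)$ be the set of induced cycles of $G$ (of length at least $3$), and put $$\beth^3(G)=|S(G)|-|C(G)|+|E(G)|-|V(G)|.$$ **Theorem.** Let $G$ be a graph. 1. For every edge $e=xy$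 of $G$ there is an injection $\Psi:S(G/e)\to S(G)$ such that for every $S\in S(G/e)$ the vertex set of $S$ is the image of the vertex set of $\Psi(S)$ under the map $V(G)\to V(G/e)$ that sends $x,y$ to $v_e$ and fixes all other vertices; moreover $$\beth^3(G/e)\le\beth^3(G).$$ 2. If $G$ is connected and $h=h(G)$, then $\beth^3(K^{h})\le\beth^3(G)$, and $$\binom{h}{4}-\binom{h}{3}+\binom{h}{2}-h\le\beth^3(G).$$ -/

import Mathlib

namespace GraphChar

/-- The vertex set of `G / xy`: the vertices `x, y` are removed and one new vertex `none`
(the contracted vertex) is added. -/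
abbrev ContractVert {V : Type*} (x y : V) : Type _ := Option {w : V // w ≠ x ∧ w ≠ y}

/-- The simple graph `G / xy` obtained by contracting `xy` to the single vertex `none`;
no loops or multiple edges are created. -/
def contract {V : Type*} (G : SimpleGraph V) (x y : V) : SimpleGraph (ContractVert x y) where
  Adj
    | some a, some b => G.Adj a b
    | some a, none => G.Adj x a ∨ G.Adj y a
    | none, some b => G.Adj x b ∨ G.Adj y b
    | none, none => False
  symm := ⟨by
    rintro (_ | a) (_ | b) h
    · exact h
    · exact h
    · exact h
    · exact G.adj_symm h⟩
  loopless := ⟨by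
    rintro (_ | a) h
    · exact h
    · exact G.irrefl h⟩

open Classical in
/-- The contraction map on vertices: `x` and `y` go to the new vertex, all others stay. -/
noncomputable def contractMap {V : Type*} (x y : V) (v : V) : ContractVert x y :=
  if h : v ≠ x ∧ v ≠ y then some ⟨v, h⟩ else none

universe u v

/-- `ContractsTo H G`: a graph isomorphic to `H` is obtained from `G` by zero or more edge
contractions. -/
inductive ContractsTo {W : Type v} (H : SimpleGraph W) : {V : Type u} → SimpleGraph V → Prop
  | iso {V : Type u} {G : SimpleGraph V} (φ : G ≃g H) : ContractsTo H G
  | step {V : Type u} {G : SimpleGraph V} {x y : V} (hxy : G.Adj x y)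
      (h : ContractsTo H (contract G x y)) : ContractsTo H G

/-- `H` is a minor of `G`: it is obtained by zero or more edge contractions from a subgraph
of `G`. -/
def IsMinor {W V : Type*} (H : SimpleGraph W) (G : SimpleGraph V) : Prop :=
  ∃ G' : G.Subgraph, ContractsTo H G'.coe

/-- The Hadwiger number: the largest `t` such that the complete graph on `t` vertices is a
minor of `G` (for finite `G` this set of numbers contains `0` and is bounded by the number of
vertices). -/
noncomputable def hadwigerNumber {V : Type*} (G : SimpleGraph V) : ℕ :=
  sSup {t : ℕ | IsMinor (⊤ : SimpleGraph (Fin t)) G}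

/-- `G` is a cycle (of length at least three). -/
def IsCycleGraph {V : Type*} (G : SimpleGraph V) : Prop :=
  ∃ n : ℕ, 3 ≤ n ∧ Nonempty (G ≃g SimpleGraph.cycleGraph n)

/-- A pyramid: a cycle together with one further vertex `w` that is joined to at least three
vertices of the cycle. -/
def IsPyramid {V : Type*} (G : SimpleGraph V) : Prop :=
  ∃ w : V, IsCycleGraph (G.induce {v | v ≠ w}) ∧ 3 ≤ (G.neighborSet w).ncard

/-- A trihedron: the union of three internally disjoint paths of length at least two with the
same two (distinct) ends. -/
def IsTrihedron {V : Type*} (G : SimpleGraph V) : Prop :=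
  ∃ (x y : V) (P : Fin 3 → G.Walk x y), x ≠ y ∧
    (∀ i, (P i).IsPath ∧ 2 ≤ (P i).length) ∧
    (∀ i j, i ≠ j → ∀ v, v ∈ (P i).support → v ∈ (P j).support → v = x ∨ v = y) ∧
    (∀ v, ∃ i, v ∈ (P i).support) ∧
    (∀ e ∈ G.edgeSet, ∃ i, e ∈ (P i).edges)

/-- A stamp: the union of a triangle and three paths of length at least one that start at the
three vertices of the triangle, end at the same vertex `x` and are otherwise disjoint. -/
def IsStamp {V : Type*} (G : SimpleGraph V) : Prop :=
  ∃ (t : Fin 3 → V) (x : V) (P : ∀ i, G.Walk (t i) x),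
    (∀ i j, i ≠ j → G.Adj (t i) (t j)) ∧
    (∀ i, (P i).IsPath ∧ 1 ≤ (P i).length) ∧
    (∀ i j, i ≠ j → ∀ v, v ∈ (P i).support → v ∈ (P j).support → v = x) ∧
    (∀ v, ∃ i, v ∈ (P i).support) ∧
    (∀ e ∈ G.edgeSet, (∃ i j, e = s(t i, t j)) ∨ ∃ i, e ∈ (P i).edges)

/-- A prism: the union of two disjoint triangles and three disjoint paths that join the
vertices of the first to the vertices of the second. -/
def IsPrism {V : Type*} (G : SimpleGraph V) : Prop :=
  ∃ (t t' : Fin 3 → V) (P : ∀ i, G.Walk (t i) (t' i)),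
    (∀ i j, i ≠ j → G.Adj (t i) (t j)) ∧
    (∀ i j, i ≠ j → G.Adj (t' i) (t' j)) ∧
    (∀ i j, t i ≠ t' j) ∧
    (∀ i, (P i).IsPath) ∧
    (∀ i j, i ≠ j → ∀ v, v ∈ (P i).support → v ∉ (P j).support) ∧
    (∀ v, ∃ i, v ∈ (P i).support) ∧
    (∀ e ∈ G.edgeSet, (∃ i j, e = s(t i, t j)) ∨ (∃ i j, e = s(t' i, t' j)) ∨
      ∃ i, e ∈ (P i).edges)

/-- Solid graphs: pyramids, trihedra, stamps and prisms. -/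
def IsSolidGraph {V : Type*} (G : SimpleGraph V) : Prop :=
  IsPyramid G ∨ IsTrihedron G ∨ IsStamp G ∨ IsPrism G

/-- The induced cycles of `G`. An induced subgraph is recorded by its vertex set, which
determines it. -/
def inducedCycles {V : Type*} (G : SimpleGraph V) : Set (Set V) :=
  {s | IsCycleGraph (G.induce s)}

/-- The solids in `G`, i.e. the induced subgraphs that are solid graphs, recorded by their
vertex sets. -/
def solids {V : Type*} (G : SimpleGraph V) : Set (Set V) :=
  {s | IsSolidGraph (G.induce s)}

/-- The third graph characteristic `|S(G)| - |C(G)| + |E(G)| - |V(G)|`. -/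
noncomputable def beth3 {V : Type*} (G : SimpleGraph V) : ℤ :=
  ((solids G).ncard : ℤ) - (inducedCycles G).ncard + G.edgeSet.ncard - Nat.card V

end GraphChar

/-!
A solid other than `K⁴` is an induced cycle `C` together with a minimal connected set `Q` that
attaches to two nonadjacent vertices of `C`. Any prescribed vertex of the solid can be arranged to
lie in `Q`, or to be a vertex of `C` with at most one neighbour in `Q`. For a solid of `G / xy` that
contains the contracted vertex `v`, such a description with `v` in a prescribed position survives
the replacement of `v` by `x`, by `y` or by the edge `xy`, so every solid of `G / xy` lifts to `G`.

The inequality follows by comparing the fibres of the contraction map: a fibre with an additional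
induced cycle contains an additional solid, or the cycle is a triangle through `xy`, and then an
edge is lost. Contracting a connected graph onto a largest complete minor leads to `K^h`, where
every four vertices form a solid and the induced cycles are the triangles.
-/

namespace GraphChar

/-- `IndPath G a b S`: the set `S` induces a path in `G` with ends `a` and `b`. -/
inductive IndPath {V : Type*} (G : SimpleGraph V) : V → V → Set V → Prop
  | single (a : V) : IndPath G a a {a}
  | cons {a b c : V} {S : Set V} (h : G.Adj a b) (ha : a ∉ S)
      (hS : ∀ u ∈ S, G.Adj a u → u = b) (p : IndPath G b c S) : IndPath G a c (insert a S)

namespace IndPath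

variable {V W : Type*} {G : SimpleGraph V} {a b c d : V} {S T : Set V}

theorem left_mem (p : IndPath G a b S) : a ∈ S := by
  cases p <;> simp

theorem right_mem (p : IndPath G a b S) : b ∈ S := by
  induction p with
  | single a => simp
  | cons _ _ _ _ ih => exact Set.mem_insert_of_mem _ ih

theorem concat (p : IndPath G a b S) (h : G.Adj b c) (hc : c ∉ S)
    (hS : ∀ u ∈ S, G.Adj u c → u = b) : IndPath G a c (insert c S) := by
  induction p with
  | single a =>
    rw [Set.pair_comm]
    exact .cons h (by simpa using fun e => hc (by simp [e])) (by simp) (.single c)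
  | @cons a a' b S hab ha hS' p ih =>
    rw [Set.insert_comm]
    have hc' : c ≠ a ∧ c ∉ S := by simpa using hc
    refine .cons hab ?_ ?_ (ih h hc'.2 fun u hu => hS u (Set.mem_insert_of_mem _ hu))
    · simpa [ha] using hc'.1.symm
    · rintro u (rfl | hu) hau
      · have := hS a (Set.mem_insert _ _) hau
        exact absurd (this ▸ p.right_mem) ha
      · exact hS' u hu hau

theorem reverse (p : IndPath G a b S) : IndPath G b a S := by
  induction p with
  | single a => exact .single a
  | cons h ha hS _ ih => exact ih.concat h.symm ha fun u hu hua => hS u hu hua.symm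

theorem append (p : IndPath G a b S) (q : IndPath G c d T) (h : G.Adj b c) (hd : Disjoint S T)
    (hST : ∀ u ∈ S, ∀ w ∈ T, G.Adj u w → u = b ∧ w = c) : IndPath G a d (S ∪ T) := by
  induction p with
  | single a =>
    rw [Set.singleton_union]
    exact .cons h (by simpa using hd) (fun u hu hau => (hST a rfl u hu hau).2) q
  | @cons a a' b S hab ha hS p ih =>
    rw [Set.insert_union]
    rw [Set.disjoint_insert_left] at hd
    refine .cons hab ?_ ?_ (ih h hd.2 fun u hu => hST u (Set.mem_insert_of_mem _ hu))
    · simp [ha, hd.1]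
    · rintro u (hu | hu) hau
      · exact hS u hu hau
      · have := (hST a (Set.mem_insert _ _) u hu hau).1
        exact absurd (this ▸ p.right_mem) ha

theorem image {G' : SimpleGraph W} {f : V → W} (p : IndPath G a b S) (hf : Set.InjOn f S)
    (h : ∀ u ∈ S, ∀ w ∈ S, G.Adj u w ↔ G'.Adj (f u) (f w)) :
    IndPath G' (f a) (f b) (f '' S) := by
  induction p with
  | single a => rw [Set.image_singleton]; exact .single _
  | @cons a a' b S hab ha hS p ih =>
    rw [Set.image_insert_eq]
    have hm := p.left_mem
    refine .cons ((h _ (by simp) _ (by simp [hm])).1 hab) ?_ ?_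
      (ih (hf.mono (Set.subset_insert _ _)) fun u hu w hw => h u (by simp [hu]) w (by simp [hw]))
    · rintro ⟨u, hu, he⟩
      exact ha (hf (Set.mem_insert_of_mem _ hu) (Set.mem_insert _ _) he ▸ hu)
    · rintro _ ⟨u, hu, rfl⟩ hau
      rw [hS u hu ((h _ (by simp) _ (by simp [hu])).2 hau)]

theorem eq_singleton (p : IndPath G a a S) : S = {a} := by
  cases p with
  | single => rfl
  | cons h ha hS p => exact absurd p.right_mem ha

theorem trim_left (p : IndPath G a b S) (hab : a ≠ b) :
    ∃ c, IndPath G c b (S \ {a}) ∧ G.Adj a c ∧ ∀ u ∈ S, G.Adj a u → u = c := by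
  cases p with
  | single => exact absurd rfl hab
  | @cons _ c _ S h ha hS p =>
    refine ⟨c, ?_, h, ?_⟩
    · rwa [Set.insert_sdiff_self_of_notMem ha]
    · rintro u (rfl | hu) hau
      · exact absurd hau G.irrefl
      · exact hS u hu hau

theorem trim_right (p : IndPath G a b S) (hab : a ≠ b) :
    ∃ c, IndPath G a c (S \ {b}) ∧ G.Adj b c ∧ ∀ u ∈ S, G.Adj b u → u = c := by
  obtain ⟨c, hc, h⟩ := p.reverse.trim_left hab.symm
  exact ⟨c, hc.reverse, h⟩

theorem exists_forall_adj_left (p : IndPath G a b S) : ∃ c, ∀ u ∈ S, G.Adj a u → u = c := by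
  cases p with
  | single => exact ⟨a, fun u hu _ => hu⟩
  | @cons _ c _ S h ha hS p =>
    refine ⟨c, ?_⟩
    rintro u (rfl | hu) hau
    · exact absurd hau G.irrefl
    · exact hS u hu hau

theorem left_unique (p : IndPath G a b S) {u w : V} (hu : u ∈ S) (hw : w ∈ S) (hau : G.Adj a u)
    (haw : G.Adj a w) : u = w := by
  obtain ⟨c, hc⟩ := p.exists_forall_adj_left
  rw [hc u hu hau, hc w hw haw]

theorem exists_suffix (p : IndPath G a b S) (P : V → Prop) (h : ∃ u ∈ S, P u) :
    ∃ u T, T ⊆ S ∧ IndPath G u b T ∧ P u ∧ ∀ w ∈ T, P w → w = u := by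
  induction p with
  | single a =>
    obtain ⟨u, rfl, hu⟩ := h
    exact ⟨u, _, subset_rfl, .single u, hu, by simp⟩
  | @cons a a' b S hab ha hS p ih =>
    by_cases h' : ∃ u ∈ S, P u
    · obtain ⟨u, T, hT, hq⟩ := ih h'
      exact ⟨u, T, hT.trans (Set.subset_insert _ _), hq⟩
    · push Not at h'
      obtain ⟨u, rfl | hu, hPu⟩ := h
      · refine ⟨u, _, subset_rfl, .cons hab ha hS p, hPu, ?_⟩
        rintro w (rfl | hw) hPw
        · rfl
        · exact absurd hPw (h' w hw)
      · exact absurd hPu (h' u hu)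

theorem split (p : IndPath G a b S) {v : V} (hv : v ∈ S) (hva : v ≠ a) :
    ∃ u S₁ S₂, S = S₁ ∪ S₂ ∧ Disjoint S₁ S₂ ∧ IndPath G a u S₁ ∧ IndPath G v b S₂ ∧ G.Adj u v ∧
      ∀ x ∈ S₁, ∀ y ∈ S₂, G.Adj x y → x = u ∧ y = v := by
  induction p with
  | single a => exact absurd hv hva
  | @cons a a' b S hab ha hS p ih =>
    have hv' : v ∈ S := by simpa [hva] using hv
    by_cases hva' : v = a'
    · subst hva'
      refine ⟨a, {a}, S, rfl, by simpa using ha, .single a, p, hab, ?_⟩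
      rintro x rfl y hy hxy
      exact ⟨rfl, hS y hy hxy⟩
    · obtain ⟨u, S₁, S₂, rfl, hd, p₁, p₂, huv, he⟩ := ih hv' hva'
      have haS₁ : a ∉ S₁ := fun h => ha (Or.inl h)
      have haS₂ : a ∉ S₂ := fun h => ha (Or.inr h)
      refine ⟨u, insert a S₁, S₂, (Set.insert_union ..).symm, ?_,
        .cons hab haS₁ (fun u hu => hS u (Or.inl hu)) p₁, p₂, huv, ?_⟩
      · rw [Set.disjoint_insert_left]; exact ⟨haS₂, hd⟩
      · rintro x (rfl | hx) y hy hxy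
        · obtain rfl := hS y (Or.inr hy) hxy
          exact absurd hy (Set.disjoint_left.1 hd p₁.left_mem)
        · exact he x hx y hy hxy

theorem exists_two_neighbors (p : IndPath G a b S) {v : V} (hv : v ∈ S) (hva : v ≠ a)
    (hvb : v ≠ b) : ∃ u ∈ S, ∃ w ∈ S, u ≠ w ∧ G.Adj v u ∧ G.Adj v w := by
  obtain ⟨u, S₁, S₂, rfl, hd, p₁, p₂, huv, -⟩ := p.split hv hva
  obtain ⟨c, pc, hc, -⟩ := p₂.trim_left hvb
  refine ⟨u, Or.inl p₁.right_mem, c, Or.inr pc.left_mem.1, ?_, huv.symm, hc⟩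
  rintro rfl
  exact Set.disjoint_left.1 hd p₁.right_mem pc.left_mem.1

theorem exists_neighbors_subset_pair (p : IndPath G a b S) {v : V} (hv : v ∈ S) :
    ∃ u w, ∀ x ∈ S, G.Adj v x → x = u ∨ x = w := by
  by_cases hva : v = a
  · obtain ⟨c, hc⟩ := p.exists_forall_adj_left
    exact ⟨c, c, fun x hx hvx => Or.inl (hc x hx (hva ▸ hvx))⟩
  · obtain ⟨u, S₁, S₂, rfl, -, -, q, -, he⟩ := p.split hv hva
    obtain ⟨c, hc⟩ := q.exists_forall_adj_left
    refine ⟨u, c, ?_⟩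
    rintro x (hx | hx) hvx
    · exact Or.inl (he x hx v q.left_mem hvx.symm).1
    · exact Or.inr (hc x hx hvx)

theorem no_three_neighbors (p : IndPath G a b S) {v x y z : V} (hv : v ∈ S) (hx : x ∈ S)
    (hy : y ∈ S) (hz : z ∈ S) (hxy : x ≠ y) (hxz : x ≠ z) (hyz : y ≠ z) (hvx : G.Adj v x)
    (hvy : G.Adj v y) (hvz : G.Adj v z) : False := by
  obtain ⟨u, w, h⟩ := p.exists_neighbors_subset_pair hv
  have := h x hx hvx
  have := h y hy hvy
  have := h z hz hvz
  grind

theorem not_two_le_degree_on (p : IndPath G a b S) (hT : T ⊆ S) (hne : T.Nonempty)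
    (h : ∀ v ∈ T, ∃ u ∈ T, ∃ w ∈ T, u ≠ w ∧ G.Adj v u ∧ G.Adj v w) : False := by
  induction p with
  | single a =>
    obtain ⟨v, hv⟩ := hne
    obtain ⟨u, hu, w, hw, huw, -⟩ := h v hv
    exact huw ((hT hu).trans (hT hw).symm)
  | @cons a a' b S hab ha hS p ih =>
    have q := IndPath.cons hab ha hS p
    by_cases haT : a ∈ T
    · obtain ⟨u, hu, w, hw, huw, hau, haw⟩ := h a haT
      exact huw (q.left_unique (hT hu) (hT hw) hau haw)
    · exact ih fun t ht => (hT ht).resolve_left fun e => haT (e ▸ ht)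

theorem eq_of_subset (p : IndPath G a b S) (q : IndPath G a b T) (h : T ⊆ S) : T = S := by
  induction p generalizing T with
  | single a => exact q.eq_singleton
  | @cons a a' b S hab ha hS p ih =>
    cases q with
    | single => exact absurd p.right_mem ha
    | @cons _ a'' _ T hab' ha' hS' q =>
      have hTS : T ⊆ S := fun t ht =>
        (h (Set.mem_insert_of_mem _ ht)).resolve_left fun e => ha' (e ▸ ht)
      obtain rfl := hS _ (hTS q.left_mem) hab'
      rw [ih q hTS]

theorem finite (p : IndPath G a b S) : S.Finite := by
  induction p with
  | single a => exact Set.finite_singleton a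
  | cons _ _ _ _ ih => exact ih.insert _

end IndPath

/-- Connectedness of the subgraph induced by a vertex set `T`, which may be empty. -/
def Conn {V : Type*} (G : SimpleGraph V) (T : Set V) : Prop :=
  (G.induce T).Preconnected

section Conn

variable {V W : Type*} {G : SimpleGraph V} {H : SimpleGraph W} {a b : V} {S T : Set V}

theorem reachable_map_of_adj {f : V → W} (h : G.Reachable a b)
    (hf : ∀ u w, G.Adj u w → H.Reachable (f u) (f w)) : H.Reachable (f a) (f b) := by
  obtain ⟨p⟩ := h
  induction p with
  | nil => exact .refl _
  | cons hadj _ ih => exact (hf _ _ hadj).trans ih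

theorem Conn.image {f : V → W} (h : Conn G T)
    (hf : ∀ u ∈ T, ∀ w ∈ T, G.Adj u w → f u = f w ∨ H.Adj (f u) (f w)) : Conn H (f '' T) := by
  rintro ⟨_, u, hu, rfl⟩ ⟨_, w, hw, rfl⟩
  refine reachable_map_of_adj (f := fun t : T => (⟨f t, t, t.2, rfl⟩ : f '' T))
    (h ⟨u, hu⟩ ⟨w, hw⟩) fun s t hst => ?_
  rcases hf s s.2 t t.2 hst with e | e
  · simp only [e, SimpleGraph.Reachable.refl]
  · exact SimpleGraph.Adj.reachable (SimpleGraph.comap_adj.2 e)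

theorem Conn.of_fibers {f : V → W} {T' : Set W} (h : Conn H T') (hT : Set.MapsTo f T T')
    (hadj : ∀ u ∈ T', ∀ w ∈ T', H.Adj u w → ∃ u' ∈ T, ∃ w' ∈ T, f u' = u ∧ f w' = w ∧ G.Adj u' w')
    (hfib : ∀ u w : T, f u = f w → (G.induce T).Reachable u w) : Conn G T := by
  have reachable_of_walk : ∀ {c d : T'}, (H.induce T').Walk c d → ∀ a b : T, f a = c → f b = d →
      (G.induce T).Reachable a b := by
    intro c d p
    induction p with
    | nil => exact fun a b ha hb => hfib a b (ha.trans hb.symm)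
    | @cons c d _ hcd _ ih =>
      intro a b ha hb
      obtain ⟨u, hu, w, hw, huc, hwd, huw⟩ := hadj c c.2 d d.2 hcd
      have hadj' : (G.induce T).Adj ⟨u, hu⟩ ⟨w, hw⟩ := huw
      exact ((hfib a ⟨u, hu⟩ (ha.trans huc.symm)).trans hadj'.reachable).trans (ih _ b hwd hb)
  intro a b
  obtain ⟨p⟩ := h ⟨f a, hT a.2⟩ ⟨f b, hT b.2⟩
  exact reachable_of_walk p a b rfl rfl

theorem conn_singleton (a : V) : Conn G {a} := by
  rintro ⟨_, rfl⟩ ⟨_, rfl⟩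
  exact .refl _

theorem Conn.insert_adj (h : Conn G T) (hb : b ∈ T) (hab : G.Adj a b) :
    Conn G (insert a T) := by
  have hreach : ∀ u : ↥(insert a T),
      (G.induce (insert a T)).Reachable u ⟨b, Set.mem_insert_of_mem _ hb⟩ := by
    rintro ⟨u, rfl | hu⟩
    · exact SimpleGraph.Adj.reachable (SimpleGraph.comap_adj.2 hab)
    · exact (h ⟨u, hu⟩ ⟨b, hb⟩).map
        (SimpleGraph.induceHomOfLE G (Set.subset_insert a T)).toHom
  exact fun u w => (hreach u).trans (hreach w).symm

theorem IndPath.conn (p : IndPath G a b S) : Conn G S := by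
  induction p with
  | single a => exact conn_singleton a
  | cons h _ _ p ih => exact ih.insert_adj p.left_mem h

theorem exists_indPath_of_walk {a b : T} (p : (G.induce T).Walk a b) :
    ∃ S ⊆ T, IndPath G a b S := by
  induction p with
  | @nil a => exact ⟨{a.1}, by simp, .single a.1⟩
  | @cons a c b hac _ ih =>
    obtain ⟨S, hS, q⟩ := ih
    by_cases haS : a.1 ∈ S
    · obtain ⟨_, S', hS', q', rfl, -⟩ := q.exists_suffix (· = a.1) ⟨a, haS, rfl⟩
      exact ⟨S', hS'.trans hS, q'⟩
    · obtain ⟨u, S', hS', q', hau, hu⟩ := q.exists_suffix (G.Adj a) ⟨c, q.left_mem, hac⟩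
      exact ⟨_, Set.insert_subset a.2 (hS'.trans hS), .cons hau (fun h => haS (hS' h)) hu q'⟩

theorem Conn.exists_indPath (h : Conn G T) (ha : a ∈ T) (hb : b ∈ T) :
    ∃ S ⊆ T, IndPath G a b S := by
  obtain ⟨p⟩ := h ⟨a, ha⟩ ⟨b, hb⟩
  exact exists_indPath_of_walk p

theorem IndPath.eq_of_conn (p : IndPath G a b S) (hT : T ⊆ S) (hc : Conn G T) (ha : a ∈ T)
    (hb : b ∈ T) : T = S := by
  obtain ⟨S', hS', p'⟩ := hc.exists_indPath ha hb
  exact hT.antisymm (p.eq_of_subset p' (hS'.trans hT) ▸ hS')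

theorem Conn.exists_adj (h : Conn G T) (ha : a ∈ T) (hb : b ∈ T) (hab : a ≠ b) :
    ∃ c ∈ T, G.Adj a c := by
  obtain ⟨S, hS, p⟩ := h.exists_indPath ha hb
  obtain ⟨c, q, hc, -⟩ := p.trim_left hab
  exact ⟨c, hS q.left_mem.1, hc⟩

theorem Conn.sdiff_of_forall_adj_eq (h : Conn G T) (hb : b ∈ T) (hba : b ≠ a)
    (ha : ∀ t ∈ T, G.Adj t a → t = b) : Conn G (T \ {a}) := by
  classical
  have himg : Function.update id a b '' T = T \ {a} := by
    ext t
    constructor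
    · rintro ⟨s, hs, rfl⟩
      by_cases hsa : s = a
      · simp [hsa, hb, hba]
      · simp [hsa, hs]
    · rintro ⟨ht, hta : t ≠ a⟩
      exact ⟨t, ht, Function.update_of_ne hta _ _⟩
  rw [← himg]
  refine h.image fun s hs t ht hst => ?_
  by_cases hsa : s = a
  · subst hsa
    left
    rw [Function.update_self, Function.update_of_ne hst.ne', id, ha t ht hst.symm]
  by_cases hta : t = a
  · subst hta
    left
    rw [Function.update_self, Function.update_of_ne hst.ne, id, ha s hs hst]
  · right
    rwa [Function.update_of_ne hsa, Function.update_of_ne hta]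

end Conn

/-- An induced cycle with vertex set `insert v S`, opened at `v` into the induced path `S` between
the neighbors `a` and `b` of `v`. -/
structure IndCycleAt {V : Type*} (G : SimpleGraph V) (v a b : V) (S : Set V) : Prop where
  path : IndPath G a b S
  ne : a ≠ b
  notMem : v ∉ S
  left : G.Adj v a
  right : G.Adj v b
  adj : ∀ u ∈ S, G.Adj v u → u = a ∨ u = b

/-- The set `C` induces a cycle of length at least three. -/
def IndCycle {V : Type*} (G : SimpleGraph V) (C : Set V) : Prop :=
  ∃ v a b S, C = insert v S ∧ IndCycleAt G v a b S

section IndCycle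

variable {V W : Type*} {G : SimpleGraph V} {H : SimpleGraph W} {a b c d u v w : V}
  {A B C S T : Set V}

theorem IndCycleAt.symm (h : IndCycleAt G v a b S) : IndCycleAt G v b a S :=
  ⟨h.path.reverse, h.ne.symm, h.notMem, h.right, h.left, fun u hu hvu => (h.adj u hu hvu).symm⟩

theorem IndCycleAt.indCycle (h : IndCycleAt G v a b S) : IndCycle G (insert v S) :=
  ⟨v, a, b, S, rfl, h⟩

theorem indCycleAt_of_paths (p : IndPath G a b A) (q : IndPath G c d B) (hd : Disjoint A B)
    (hab : a ≠ b) (hac : G.Adj a c) (hbd : G.Adj b d)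
    (h : ∀ u ∈ A, ∀ w ∈ B, G.Adj u w → u = a ∧ w = c ∨ u = b ∧ w = d) :
    ∃ e f, IndCycleAt G a e f (A \ {a} ∪ B) := by
  obtain ⟨e, pe, hae, he⟩ := p.trim_left hab
  refine ⟨e, c, pe.append q.reverse hbd (hd.mono_left Set.sdiff_subset) ?_, ?_, ?_, hae, hac, ?_⟩
  · rintro u ⟨hu, hua⟩ w hw huw
    rcases h u hu w hw huw with ⟨rfl, -⟩ | h
    · exact absurd rfl hua
    · exact h
  · rintro rfl
    exact Set.disjoint_left.1 hd pe.left_mem.1 q.left_mem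
  · rintro (hmem | hmem)
    · exact hmem.2 rfl
    · exact Set.disjoint_left.1 hd p.left_mem hmem
  · rintro u (hu | hu) hau
    · exact Or.inl (he u hu.1 hau)
    · rcases h a p.left_mem u hu hau with ⟨-, h⟩ | ⟨h, -⟩
      · exact Or.inr h
      · exact absurd h hab

theorem indCycle_of_paths (p : IndPath G a b A) (q : IndPath G c d B) (hd : Disjoint A B)
    (hab : a ≠ b) (hac : G.Adj a c) (hbd : G.Adj b d)
    (h : ∀ u ∈ A, ∀ w ∈ B, G.Adj u w → u = a ∧ w = c ∨ u = b ∧ w = d) :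
    IndCycle G (A ∪ B) := by
  obtain ⟨e, f, h⟩ := indCycleAt_of_paths p q hd hab hac hbd h
  have := h.indCycle
  rwa [← Set.insert_union, Set.insert_sdiff_singleton, Set.insert_eq_of_mem p.left_mem] at this

theorem IndCycleAt.rotate_left (h : IndCycleAt G v a b S) :
    ∃ e f, IndCycleAt G a e f (insert v S \ {a}) := by
  obtain ⟨e, f, h'⟩ := indCycleAt_of_paths h.path (.single v)
    (by simpa using h.notMem) h.ne h.left.symm h.right.symm (by
      rintro u hu w rfl huw
      simpa using h.adj u hu huw.symm)
  refine ⟨e, f, ?_⟩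
  rwa [Set.union_singleton, ← Set.insert_sdiff_of_notMem] at h'
  simpa using h.left.ne

theorem IndCycleAt.rotate (h : IndCycleAt G v a b S) (hw : w ∈ S) (hwa : w ≠ a) (hwb : w ≠ b) :
    ∃ e f, IndCycleAt G w e f (insert v S \ {w}) := by
  obtain ⟨u, S₁, S₂, rfl, hd, p₁, p₂, huw, he⟩ := h.path.split hw hwa
  have hv : v ∉ S₁ ∧ v ∉ S₂ := by simpa using h.notMem
  have q : IndPath G u v (insert v S₁) := by
    refine p₁.reverse.concat h.left.symm hv.1 fun x hx hxv => ?_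
    refine (h.adj x (Or.inl hx) hxv.symm).resolve_right ?_
    rintro rfl
    exact Set.disjoint_left.1 hd hx p₂.right_mem
  have hadj : ∀ x ∈ S₂, ∀ y ∈ insert v S₁, G.Adj x y → x = w ∧ y = u ∨ x = b ∧ y = v := by
    rintro x hx y (rfl | hy) hxy
    · rcases h.adj x (Or.inr hx) hxy.symm with rfl | rfl
      · exact absurd hx (Set.disjoint_left.1 hd p₁.left_mem)
      · exact Or.inr ⟨rfl, rfl⟩
    · exact Or.inl (he y hy x hx hxy.symm).symm
  obtain ⟨e, f, hef⟩ :=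
    indCycleAt_of_paths p₂ q (by simp [hv.2, hd.symm]) hwb huw.symm h.right.symm hadj
  refine ⟨e, f, ?_⟩
  convert hef using 1
  have hwS₁ : w ∉ S₁ := fun h => Set.disjoint_left.1 hd h p₂.left_mem
  ext x
  simp only [Set.mem_sdiff, Set.mem_insert_iff, Set.mem_union, Set.mem_singleton_iff]
  grind

theorem IndCycle.indCycleAt (h : IndCycle G C) (hv : v ∈ C) :
    ∃ a b, IndCycleAt G v a b (C \ {v}) := by
  obtain ⟨u, a, b, S, rfl, h⟩ := h
  rcases eq_or_ne v u with rfl | hvu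
  · rw [Set.insert_sdiff_self_of_notMem h.notMem]
    exact ⟨a, b, h⟩
  rcases eq_or_ne v a with rfl | hva
  · exact h.rotate_left
  rcases eq_or_ne v b with rfl | hvb
  · exact h.symm.rotate_left
  exact h.rotate (hv.resolve_left hvu) hva hvb

theorem IndCycle.exists_two_neighbors (h : IndCycle G C) (hv : v ∈ C) :
    ∃ u ∈ C, ∃ w ∈ C, u ≠ w ∧ G.Adj v u ∧ G.Adj v w := by
  obtain ⟨a, b, h⟩ := h.indCycleAt hv
  exact ⟨a, h.path.left_mem.1, b, h.path.right_mem.1, h.ne, h.left, h.right⟩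

theorem IndCycle.no_three_neighbors (h : IndCycle G C) (hv : v ∈ C) {x y z : V} (hx : x ∈ C)
    (hy : y ∈ C) (hz : z ∈ C) (hxy : x ≠ y) (hxz : x ≠ z) (hyz : y ≠ z) (hvx : G.Adj v x)
    (hvy : G.Adj v y) (hvz : G.Adj v z) : False := by
  obtain ⟨a, b, h⟩ := h.indCycleAt hv
  have hxab := h.adj x ⟨hx, hvx.ne'⟩ hvx
  have hyab := h.adj y ⟨hy, hvy.ne'⟩ hvy
  have hzab := h.adj z ⟨hz, hvz.ne'⟩ hvz
  grind

theorem IndCycle.not_subset_path (h : IndCycle G C) (p : IndPath G a b S) (hCS : C ⊆ S) :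
    False := by
  refine p.not_two_le_degree_on hCS ?_ fun v hv => h.exists_two_neighbors hv
  obtain ⟨v, -, -, S, rfl, -⟩ := h
  exact ⟨v, by simp⟩

theorem IndPath.eq_pair (p : IndPath G a b S) (h : G.Adj a b) : S = {a, b} := by
  obtain ⟨c, q, hc, huniq⟩ := p.trim_left h.ne
  obtain rfl := huniq b p.right_mem h
  rw [← Set.insert_sdiff_self_of_mem p.left_mem, q.eq_singleton]

theorem IndCycle.eq_triangle (h : IndCycle G C) (ha : a ∈ C) (hb : b ∈ C) (hc : c ∈ C)
    (hab : G.Adj a b) (hac : G.Adj a c) (hbc : G.Adj b c) : C = {a, b, c} := by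
  obtain ⟨x, y, h⟩ := h.indCycleAt ha
  have hb_end := h.adj b ⟨hb, hab.ne'⟩ hab
  have hc_end := h.adj c ⟨hc, hac.ne'⟩ hac
  have hne := hbc.ne
  rw [← Set.insert_sdiff_self_of_mem ha]
  rcases hb_end with rfl | rfl <;> rcases hc_end with rfl | rfl
  · exact absurd rfl hne
  · rw [h.path.eq_pair hbc]
  · rw [h.path.reverse.eq_pair hbc]
  · exact absurd rfl hne

theorem indCycle_triangle (hab : G.Adj a b) (hac : G.Adj a c) (hbc : G.Adj b c) :
    IndCycle G {a, b, c} := by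
  refine ⟨a, b, c, {b, c}, rfl, .cons hbc (by simpa using hbc.ne) (by simp) (.single c), hbc.ne,
    by simp [hab.ne, hac.ne], hab, hac, by simp⟩

/-- The two arcs `A`, `B` of an induced cycle `A ∪ B` between two nonadjacent vertices `u`, `w`;
both contain `u` and `w`. -/
structure Arcs {V : Type*} (G : SimpleGraph V) (u w : V) (A B : Set V) : Prop where
  pathA : IndPath G u w A
  pathB : IndPath G u w B
  inter : ∀ x ∈ A, x ∈ B → x = u ∨ x = w
  adj : ∀ x ∈ A, ∀ y ∈ B, G.Adj x y → x = u ∨ x = w ∨ y = u ∨ y = w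
  ne : u ≠ w
  not_adj : ¬G.Adj u w

theorem Arcs.swap (h : Arcs G u w A B) : Arcs G u w B A where
  pathA := h.pathB
  pathB := h.pathA
  inter x hB hA := h.inter x hA hB
  adj x hx y hy hxy := by
    have := h.adj y hy x hx hxy.symm
    tauto
  ne := h.ne
  not_adj := h.not_adj

theorem Arcs.reverse (h : Arcs G u w A B) : Arcs G w u A B where
  pathA := h.pathA.reverse
  pathB := h.pathB.reverse
  inter x hA hB := (h.inter x hA hB).symm
  adj x hx y hy hxy := by
    have := h.adj x hx y hy hxy
    tauto
  ne := h.ne.symm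
  not_adj hwu := h.not_adj hwu.symm

theorem IndCycle.exists_arcs (h : IndCycle G C) (hu : u ∈ C) (hw : w ∈ C) (hne : u ≠ w)
    (huw : ¬G.Adj u w) : ∃ A B, Arcs G u w A B ∧ C = A ∪ B := by
  obtain ⟨a, b, h⟩ := h.indCycleAt hu
  have hwa : w ≠ a := fun e => huw (e ▸ h.left)
  obtain ⟨x, S₁, S₂, hS, hd, p₁, p₂, hxw, he⟩ := h.path.split (v := w) ⟨hw, hne.symm⟩ hwa
  have hu' : u ∉ S₁ ∪ S₂ := hS ▸ h.notMem
  have hadj := h.adj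
  rw [hS] at hadj
  have hb₁ : b ∉ S₁ := fun h' => Set.disjoint_left.1 hd h' p₂.right_mem
  have ha₂ : a ∉ S₂ := fun h' => Set.disjoint_left.1 hd p₁.left_mem h'
  have hw₁ : w ∉ S₁ := fun h' => Set.disjoint_left.1 hd h' p₂.left_mem
  have p₁' := p₁.concat hxw hw₁ fun y hy hyw => (he y hy w p₂.left_mem hyw).1
  have pA : IndPath G u w (insert u (insert w S₁)) := by
    refine .cons h.left (by simpa [hne] using fun h => hu' (Or.inl h)) ?_ p₁'
    rintro y (rfl | hy) huy
    · exact absurd huy huw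
    · exact (hadj y (Or.inl hy) huy).resolve_right fun e => hb₁ (e ▸ hy)
  have pB : IndPath G u w (insert u S₂) :=
    .cons h.right (fun h => hu' (Or.inr h)) (fun y hy huy =>
      (hadj y (Or.inr hy) huy).resolve_left fun e => ha₂ (e ▸ hy)) p₂.reverse
  have hC : C = insert u (insert w S₁) ∪ insert u S₂ := by
    rw [← Set.insert_sdiff_self_of_mem hu, hS]
    have := p₂.left_mem
    ext y
    simp only [Set.mem_insert_iff, Set.mem_union]
    grind
  refine ⟨_, _, ⟨pA, pB, ?_, ?_, hne, huw⟩, hC⟩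
  · have := Set.disjoint_left.1 hd
    grind
  · grind

theorem IndCycleAt.image {f : V → W} (h : IndCycleAt G v a b S) (hf : Set.InjOn f (insert v S))
    (hG : ∀ u ∈ insert v S, ∀ w ∈ insert v S, G.Adj u w ↔ H.Adj (f u) (f w)) :
    IndCycleAt H (f v) (f a) (f b) (f '' S) where
  path := h.path.image (hf.mono (Set.subset_insert _ _))
    fun u hu w hw => hG u (Or.inr hu) w (Or.inr hw)
  ne e := h.ne (hf (Or.inr h.path.left_mem) (Or.inr h.path.right_mem) e)
  notMem := by
    rintro ⟨u, hu, e⟩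
    exact h.notMem (hf (Or.inr hu) (Or.inl rfl) e ▸ hu)
  left := (hG _ (Or.inl rfl) _ (Or.inr h.path.left_mem)).1 h.left
  right := (hG _ (Or.inl rfl) _ (Or.inr h.path.right_mem)).1 h.right
  adj := by
    rintro _ ⟨u, hu, rfl⟩ hvu
    rcases h.adj u hu ((hG _ (Or.inl rfl) _ (Or.inr hu)).2 hvu) with rfl | rfl
    · exact Or.inl rfl
    · exact Or.inr rfl

theorem IndCycle.image {f : V → W} (h : IndCycle G C) (hf : Set.InjOn f C)
    (hG : ∀ u ∈ C, ∀ w ∈ C, G.Adj u w ↔ H.Adj (f u) (f w)) : IndCycle H (f '' C) := by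
  obtain ⟨v, a, b, S, rfl, h⟩ := h
  rw [Set.image_insert_eq]
  exact (h.image hf hG).indCycle

theorem indPath_range_pathGraph {n : ℕ} (φ : SimpleGraph.pathGraph (n + 1) ↪g G) :
    IndPath G (φ 0) (φ (Fin.last n)) (Set.range φ) := by
  induction n with
  | zero =>
    have hrange : Set.range φ = {φ 0} := by
      ext v
      simp [Fin.exists_fin_one, eq_comm]
    rw [hrange]
    exact .single _
  | succ n ih =>
    let ψ : SimpleGraph.pathGraph (n + 1) ↪g SimpleGraph.pathGraph (n + 2) :=
      ⟨Fin.succEmb _, by simp [SimpleGraph.pathGraph_adj]⟩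
    have hrange : Set.range φ = insert (φ 0) (Set.range (φ.comp ψ)) := by
      ext v
      simp [Fin.exists_fin_succ, ψ, eq_comm]
    rw [hrange]
    refine .cons (b := φ (Fin.succ 0)) (φ.map_adj_iff.2 (by simp [SimpleGraph.pathGraph_adj]))
      ?_ ?_ (ih (φ.comp ψ))
    · rintro ⟨i, hi⟩
      exact Fin.succ_ne_zero i (φ.injective hi)
    · rintro _ ⟨i, rfl⟩ hi
      have hval : 0 + 1 = i.val + 1 ∨ i.val + 1 + 1 = 0 :=
        SimpleGraph.pathGraph_adj.1 (φ.map_adj_iff.1 hi)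
      obtain rfl : i = 0 := Fin.ext (by grind)
      rfl

/-- Prepends the vertex `a` to the vertex enumeration of an induced subgraph. -/
def consEmbedding {n : ℕ} {P : SimpleGraph (Fin n)} {Q : SimpleGraph (Fin (n + 1))}
    (φ : P ↪g G) (ha : a ∉ Set.range φ) (hzero : ∀ i, G.Adj a (φ i) ↔ Q.Adj 0 i.succ)
    (hsucc : ∀ i j, Q.Adj i.succ j.succ ↔ P.Adj i j) : Q ↪g G where
  toFun := Fin.cons a φ
  inj' := Fin.cons_injective_iff.2 ⟨ha, φ.injective⟩
  map_rel_iff' := by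
    intro i j
    refine Fin.cases ?_ (fun i => ?_) i <;> refine Fin.cases ?_ (fun j => ?_) j
    · simp
    · simpa using hzero j
    · simpa [SimpleGraph.adj_comm] using hzero i
    · simp [hsucc]

theorem range_consEmbedding {n : ℕ} {P : SimpleGraph (Fin n)} {Q : SimpleGraph (Fin (n + 1))}
    (φ : P ↪g G) (ha : a ∉ Set.range φ) (hzero : ∀ i, G.Adj a (φ i) ↔ Q.Adj 0 i.succ)
    (hsucc : ∀ i j, Q.Adj i.succ j.succ ↔ P.Adj i j) :
    Set.range (consEmbedding φ ha hzero hsucc) = insert a (Set.range φ) :=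
  Fin.range_cons a φ

theorem IndPath.exists_pathGraph_embedding (p : IndPath G a b S) :
    ∃ (n : ℕ) (φ : SimpleGraph.pathGraph (n + 1) ↪g G),
      φ 0 = a ∧ φ (Fin.last n) = b ∧ Set.range φ = S := by
  induction p with
  | single a =>
    let φ : SimpleGraph.pathGraph (0 + 1) ↪g G :=
      ⟨⟨fun _ => a, fun i j _ => Fin.ext (by omega)⟩, by simp [SimpleGraph.pathGraph_adj]⟩
    exact ⟨0, φ, rfl, rfl, Set.range_const⟩
  | @cons a c b S hac ha hS _ ih =>
    obtain ⟨n, φ, rfl, rfl, rfl⟩ := ih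
    have hzero : ∀ i, G.Adj a (φ i) ↔ (SimpleGraph.pathGraph (n + 2)).Adj 0 i.succ := by
      intro i
      have hi : G.Adj a (φ i) ↔ i = 0 :=
        ⟨fun h => φ.injective (hS _ ⟨i, rfl⟩ h), fun h => h ▸ hac⟩
      rw [hi, SimpleGraph.pathGraph_adj, Fin.ext_iff]
      simp [eq_comm]
    have hsucc : ∀ i j : Fin (n + 1), (SimpleGraph.pathGraph (n + 2)).Adj i.succ j.succ ↔
        (SimpleGraph.pathGraph (n + 1)).Adj i j := by simp [SimpleGraph.pathGraph_adj]
    exact ⟨n + 1, consEmbedding φ ha hzero hsucc, rfl, rfl, range_consEmbedding φ ha hzero hsucc⟩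

theorem cycleGraph_adj_zero_succ {n : ℕ} (i : Fin (n + 1)) :
    (SimpleGraph.cycleGraph (n + 2)).Adj 0 i.succ ↔ i = 0 ∨ i = Fin.last n := by
  rw [SimpleGraph.cycleGraph_adj', sub_zero, zero_sub, Fin.val_neg', Fin.ext_iff, Fin.ext_iff]
  have := i.isLt
  simp only [Fin.val_succ, Fin.val_zero, Fin.val_last]
  rw [Nat.mod_eq_of_lt (by omega)]
  omega

theorem cycleGraph_adj_succ_succ {n : ℕ} (i j : Fin (n + 1)) :
    (SimpleGraph.cycleGraph (n + 2)).Adj i.succ j.succ ↔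
      (SimpleGraph.pathGraph (n + 1)).Adj i j := by
  have hsub : ∀ k l : Fin (n + 1), (k.succ - l.succ).val = 1 ↔ l.val + 1 = k.val := by
    intro k l
    rcases le_or_gt l k with h | h
    · rw [Fin.sub_val_of_le (Fin.succ_le_succ_iff.2 h)]
      simp only [Fin.val_succ]
      omega
    · have := k.isLt
      have := l.isLt
      rw [Fin.lt_def] at h
      rw [Fin.coe_sub_iff_lt.2 (Fin.succ_lt_succ_iff.2 h)]
      simp only [Fin.val_succ]
      omega
  rw [SimpleGraph.cycleGraph_adj', SimpleGraph.pathGraph_adj, hsub, hsub, or_comm]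

theorem IndCycle.isCycleGraph (h : IndCycle G S) : IsCycleGraph (G.induce S) := by
  obtain ⟨v, a, b, S, rfl, h⟩ := h
  obtain ⟨n, φ, rfl, rfl, rfl⟩ := h.path.exists_pathGraph_embedding
  have hn : n ≠ 0 := by
    rintro rfl
    exact h.ne rfl
  have hzero : ∀ i, G.Adj v (φ i) ↔ (SimpleGraph.cycleGraph (n + 2)).Adj 0 i.succ := by
    intro i
    rw [cycleGraph_adj_zero_succ]
    constructor
    · exact fun hvi => (h.adj _ ⟨i, rfl⟩ hvi).imp (fun e => φ.injective e) fun e => φ.injective e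
    · rintro (rfl | rfl)
      exacts [h.left, h.right]
  rw [← range_consEmbedding φ h.notMem hzero cycleGraph_adj_succ_succ]
  exact ⟨n + 2, by omega, ⟨(SimpleGraph.Embedding.isoInduceRange _).symm⟩⟩

theorem indCycle_univ_cycleGraph {n : ℕ} (hn : 3 ≤ n) :
    IndCycle (SimpleGraph.cycleGraph n) Set.univ := by
  obtain ⟨m, rfl⟩ := Nat.exists_eq_add_of_le' hn
  let φ : SimpleGraph.pathGraph (m + 2) ↪g SimpleGraph.cycleGraph (m + 3) :=
    ⟨Fin.succEmb _, by simp [cycleGraph_adj_succ_succ]⟩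
  refine ⟨0, _, _, Set.range φ, ?_, indPath_range_pathGraph φ, ?_, ?_, ?_, ?_, ?_⟩
  · ext i
    refine Fin.cases ?_ (fun i => ?_) i
    · simp
    · simp [φ]
  · simp [φ, Fin.ext_iff]
  · rintro ⟨i, hi⟩
    exact Fin.succ_ne_zero i hi
  · exact (cycleGraph_adj_zero_succ _).2 (Or.inl rfl)
  · exact (cycleGraph_adj_zero_succ _).2 (Or.inr rfl)
  · rintro _ ⟨i, rfl⟩ hi
    exact ((cycleGraph_adj_zero_succ i).1 hi).imp (congrArg φ) (congrArg φ)

theorem indCycle_of_isCycleGraph (h : IsCycleGraph (G.induce S)) : IndCycle G S := by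
  obtain ⟨n, hn, ⟨φ⟩⟩ := h
  let ψ := (SimpleGraph.Embedding.induce S).comp φ.symm.toEmbedding
  have hψ : ψ '' Set.univ = S := by
    ext v
    constructor
    · rintro ⟨i, -, rfl⟩
      exact (φ.symm i).2
    · exact fun hv => ⟨φ ⟨v, hv⟩, trivial, congrArg Subtype.val (φ.symm_apply_apply ⟨v, hv⟩)⟩
  rw [← hψ]
  exact (indCycle_univ_cycleGraph hn).image ψ.injective.injOn fun _ _ _ _ => ψ.map_adj_iff.symm

theorem isCycleGraph_induce_iff : IsCycleGraph (G.induce S) ↔ IndCycle G S :=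
  ⟨indCycle_of_isCycleGraph, IndCycle.isCycleGraph⟩

end IndCycle

/-- The set `s` induces a pyramid: an induced cycle `C` and a vertex `w` with three neighbours
on it. -/
def IndPyramid {V : Type*} (G : SimpleGraph V) (s : Set V) : Prop :=
  ∃ C w, IndCycle G C ∧ w ∉ C ∧ s = insert w C ∧ ∃ x ∈ C, ∃ y ∈ C, ∃ z ∈ C,
    x ≠ y ∧ x ≠ z ∧ y ≠ z ∧ G.Adj w x ∧ G.Adj w y ∧ G.Adj w z

/-- Three disjoint induced paths `A`, `B`, `Q` that form a trihedron, a stamp or a prism: `A ∪ B` is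
an induced cycle, and `Q` is attached to it at its ends.
The ends `c, e` of `B, Q` are joined to the end `a` of `A`, and are joined to each other iff `l`
holds; likewise for the ends `d, f`, `b` and `r`. So `a` is an apex if `l` fails. -/
structure CyclePath {V : Type*} (G : SimpleGraph V) (l r : Prop) (a b : V) (A : Set V) (c d : V)
    (B : Set V) (e f : V) (Q : Set V) : Prop where
  pathA : IndPath G a b A
  pathB : IndPath G c d B
  pathQ : IndPath G e f Q
  disjAB : Disjoint A B
  disjAQ : Disjoint A Q
  disjBQ : Disjoint B Q
  ne : a ≠ b
  ac : G.Adj a c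
  bd : G.Adj b d
  ae : G.Adj a e
  bf : G.Adj b f
  adjAB : ∀ u ∈ A, ∀ w ∈ B, G.Adj u w → u = a ∧ w = c ∨ u = b ∧ w = d
  adjAQ : ∀ u ∈ A, ∀ w ∈ Q, G.Adj u w → u = a ∧ w = e ∨ u = b ∧ w = f
  adjBQ : ∀ u ∈ B, ∀ w ∈ Q, G.Adj u w ↔ l ∧ u = c ∧ w = e ∨ r ∧ u = d ∧ w = f
  shape : ¬l ∧ ¬r ∧ ¬G.Adj a b ∨ l ∧ ¬r ∨ l ∧ r ∧ c ≠ d ∧ e ≠ f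

section FormsOfWalks

variable {V W : Type*} {G : SimpleGraph V} {H : SimpleGraph W} {l r : Prop}
  {a b c d e f v : V} {A B Q s : Set V}

theorem CyclePath.reverse (h : CyclePath G l r a b A c d B e f Q) (hl : ¬l) (hr : ¬r) :
    CyclePath G r l b a A d c B f e Q where
  pathA := h.pathA.reverse
  pathB := h.pathB.reverse
  pathQ := h.pathQ.reverse
  disjAB := h.disjAB
  disjAQ := h.disjAQ
  disjBQ := h.disjBQ
  ne := h.ne.symm
  ac := h.bd
  bd := h.ac
  ae := h.bf
  bf := h.ae
  adjAB u hu w hw huw := (h.adjAB u hu w hw huw).symm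
  adjAQ u hu w hw huw := (h.adjAQ u hu w hw huw).symm
  adjBQ u hu w hw := by rw [h.adjBQ u hu w hw, or_comm]
  shape := Or.inl ⟨hr, hl, fun hba => (h.shape.resolve_right (by simp [hl])).2.2 hba.symm⟩

theorem IndPyramid.image {g : V → W} (h : IndPyramid G s) (hg : Set.InjOn g s)
    (hG : ∀ u ∈ s, ∀ w ∈ s, G.Adj u w ↔ H.Adj (g u) (g w)) : IndPyramid H (g '' s) := by
  obtain ⟨C, w, hC, hw, rfl, x, hx, y, hy, z, hz, hxy, hxz, hyz, hwx, hwy, hwz⟩ := h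
  have hsub : ∀ u ∈ C, u ∈ insert w C := fun u hu => Or.inr hu
  have hwC : w ∈ insert w C := Or.inl rfl
  refine ⟨g '' C, g w, hC.image (hg.mono hsub) fun u hu w hw => hG u (hsub u hu) w (hsub w hw), ?_,
    Set.image_insert_eq, g x, ⟨x, hx, rfl⟩, g y, ⟨y, hy, rfl⟩, g z, ⟨z, hz, rfl⟩,
    fun e => hxy (hg (hsub x hx) (hsub y hy) e), fun e => hxz (hg (hsub x hx) (hsub z hz) e),
    fun e => hyz (hg (hsub y hy) (hsub z hz) e), (hG _ hwC _ (hsub x hx)).1 hwx,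
    (hG _ hwC _ (hsub y hy)).1 hwy, (hG _ hwC _ (hsub z hz)).1 hwz⟩
  rintro ⟨u, hu, e⟩
  exact hw (hg (hsub u hu) hwC e ▸ hu)

theorem CyclePath.image {g : V → W} (h : CyclePath G l r a b A c d B e f Q) (hs : s = A ∪ B ∪ Q)
    (hg : Set.InjOn g s)
    (hG : ∀ u ∈ s, ∀ w ∈ s, G.Adj u w ↔ H.Adj (g u) (g w)) :
    CyclePath H l r (g a) (g b) (g '' A) (g c) (g d) (g '' B) (g e) (g f) (g '' Q) := by
  have hA : A ⊆ s := by rw [hs]; intro u hu; simp [hu]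
  have hB : B ⊆ s := by rw [hs]; intro u hu; simp [hu]
  have hQ : Q ⊆ s := by rw [hs]; intro u hu; simp [hu]
  have ha := hA h.pathA.left_mem
  have hb := hA h.pathA.right_mem
  have hc := hB h.pathB.left_mem
  have hd := hB h.pathB.right_mem
  have he := hQ h.pathQ.left_mem
  have hf := hQ h.pathQ.right_mem
  have hdis : ∀ {S T : Set V}, S ⊆ s → T ⊆ s → Disjoint S T → Disjoint (g '' S) (g '' T) := by
    intro S T hS hT hd
    rw [Set.disjoint_left]
    rintro _ ⟨u, hu, rfl⟩ ⟨w, hw, e⟩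
    exact Set.disjoint_left.1 hd hu (hg (hT hw) (hS hu) e ▸ hw)
  have hp : ∀ {x y : V} {S : Set V}, S ⊆ s → IndPath G x y S → IndPath H (g x) (g y) (g '' S) :=
    fun hS p => p.image (hg.mono hS) fun u hu w hw => hG u (hS hu) w (hS hw)
  refine ⟨hp hA h.pathA, hp hB h.pathB, hp hQ h.pathQ, hdis hA hB h.disjAB, hdis hA hQ h.disjAQ,
    hdis hB hQ h.disjBQ, fun e => h.ne (hg ha hb e), (hG _ ha _ hc).1 h.ac, (hG _ hb _ hd).1 h.bd,
    (hG _ ha _ he).1 h.ae, (hG _ hb _ hf).1 h.bf, ?_, ?_, ?_, ?_⟩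
  · rintro _ ⟨u, hu, rfl⟩ _ ⟨w, hw, rfl⟩ huw
    rcases h.adjAB u hu w hw ((hG _ (hA hu) _ (hB hw)).2 huw) with ⟨rfl, rfl⟩ | ⟨rfl, rfl⟩ <;> simp
  · rintro _ ⟨u, hu, rfl⟩ _ ⟨w, hw, rfl⟩ huw
    rcases h.adjAQ u hu w hw ((hG _ (hA hu) _ (hQ hw)).2 huw) with ⟨rfl, rfl⟩ | ⟨rfl, rfl⟩ <;> simp
  · rintro _ ⟨u, hu, rfl⟩ _ ⟨w, hw, rfl⟩
    rw [← hG _ (hB hu) _ (hQ hw), h.adjBQ u hu w hw, hg.eq_iff (hB hu) hc, hg.eq_iff (hQ hw) he,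
      hg.eq_iff (hB hu) hd, hg.eq_iff (hQ hw) hf]
  · rw [← hG _ ha _ hb, Ne, hg.eq_iff hc hd, Ne, hg.eq_iff he hf]
    exact h.shape

/-- The set `s` induces a solid graph, in terms of induced paths and cycles of the ambient graph;
see `isSolidGraph_induce_iff`. -/
def IndSolid {V : Type*} (G : SimpleGraph V) (s : Set V) : Prop :=
  IndPyramid G s ∨ ∃ l r a b A c d B e f Q, s = A ∪ B ∪ Q ∧ CyclePath G l r a b A c d B e f Q

theorem IndSolid.image {g : V → W} (h : IndSolid G s) (hg : Set.InjOn g s)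
    (hG : ∀ u ∈ s, ∀ w ∈ s, G.Adj u w ↔ H.Adj (g u) (g w)) : IndSolid H (g '' s) := by
  rcases h with h | ⟨l, r, a, b, A, c, d, B, e, f, Q, hs, h⟩
  · exact Or.inl (h.image hg hG)
  · refine Or.inr ⟨l, r, _, _, _, _, _, _, _, _, _, ?_, h.image hs hg hG⟩
    rw [hs, Set.image_union, Set.image_union]

theorem IsPyramid.indPyramid (h : IsPyramid G) : IndPyramid G Set.univ := by
  obtain ⟨w, hC, hdeg⟩ := h
  refine ⟨_, w, indCycle_of_isCycleGraph hC, by simp, by ext u; simp [em], ?_⟩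
  have hfin : (G.neighborSet w).Finite := Set.finite_of_ncard_pos (by omega)
  obtain ⟨x, y, z, hx, hy, hz, hxy, hxz, hyz⟩ := (Set.two_lt_ncard_iff hfin).1 hdeg
  exact ⟨x, hx.ne', y, hy.ne', z, hz.ne', hxy, hxz, hyz, hx, hy, hz⟩

theorem IndPyramid.isPyramid (h : IndPyramid G Set.univ) : IsPyramid G := by
  obtain ⟨C, w, hC, hw, hs, x, hx, y, hy, z, hz, hxy, hxz, hyz, hwx, hwy, hwz⟩ := h
  have hCw : C = {v | v ≠ w} := by
    ext u
    constructor
    · rintro hu rfl; exact hw hu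
    · intro hu
      exact (hs ▸ Set.mem_univ u : u ∈ insert w C).resolve_left hu
  refine ⟨w, hCw ▸ hC.isCycleGraph, ?_⟩
  obtain ⟨v, a, b, S, rfl, hS⟩ := hC
  have hfin : (G.neighborSet w).Finite :=
    ((hS.path.finite.insert v).insert w).subset (hs ▸ Set.subset_univ _)
  exact (Set.two_lt_ncard_iff hfin).2 ⟨x, y, z, hwx, hwy, hwz, hxy, hxz, hyz⟩

theorem indPath_of_walk {u v : V} (p : G.Walk u v) (hp : p.IsPath)
    (h : ∀ x ∈ p.support, ∀ y ∈ p.support, G.Adj x y → s(x, y) ∈ p.edges) :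
    IndPath G u v {x | x ∈ p.support} := by
  induction p with
  | nil =>
    convert IndPath.single (G := G) _ using 1
    ext; simp
  | @cons u v' w huv p ih =>
    rw [SimpleGraph.Walk.cons_isPath_iff] at hp
    simp only [SimpleGraph.Walk.support_cons, SimpleGraph.Walk.edges_cons, List.mem_cons] at h
    have hset : {x | x ∈ (SimpleGraph.Walk.cons huv p).support} = insert u {x | x ∈ p.support} := by
      ext; simp
    rw [hset]
    refine .cons huv hp.2 ?_ (ih hp.1 ?_)
    · intro x hx hux
      rcases h u (Or.inl rfl) x (Or.inr hx) hux with e | e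
      · rcases Sym2.eq_iff.1 e with ⟨-, e⟩ | ⟨e, -⟩
        · exact e
        · exact absurd e huv.ne
      · exact absurd (p.fst_mem_support_of_mem_edges e) hp.2
    · intro x hx y hy hxy
      rcases h x (Or.inr hx) y (Or.inr hy) hxy with e | e
      · rcases Sym2.eq_iff.1 e with ⟨rfl, -⟩ | ⟨-, rfl⟩
        · exact absurd hx hp.2
        · exact absurd hy hp.2
      · exact e

theorem IndPath.exists_walk {S : Set V} (p : IndPath G a b S) : ∃ q : G.Walk a b, q.IsPath ∧
    (∀ x, x ∈ q.support ↔ x ∈ S) ∧ ∀ x ∈ S, ∀ y ∈ S, G.Adj x y → s(x, y) ∈ q.edges := by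
  induction p with
  | single a =>
    refine ⟨.nil, by simp, by simp, ?_⟩
    rintro x rfl y rfl h
    exact absurd h G.irrefl
  | @cons a a' b S hab ha hS _ ih =>
    obtain ⟨q, hq, hsupp, hedges⟩ := ih
    refine ⟨.cons hab q, ?_, ?_, ?_⟩
    · rw [SimpleGraph.Walk.cons_isPath_iff, hsupp]; exact ⟨hq, ha⟩
    · intro x; simp [hsupp]
    · simp only [SimpleGraph.Walk.edges_cons, List.mem_cons]
      rintro x (rfl | hx) y (rfl | hy) h
      · exact absurd h G.irrefl
      · left; rw [hS y hy h]
      · left; rw [hS x hx h.symm, Sym2.eq_swap]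
      · exact Or.inr (hedges x hx y hy h)

theorem length_eq_one_of_mem_edges {u v : V} (p : G.Walk u v) (hp : p.IsPath)
    (h : s(u, v) ∈ p.edges) : p.length = 1 := by
  cases p with
  | nil => simp at h
  | cons huv p =>
    rw [SimpleGraph.Walk.cons_isPath_iff] at hp
    rw [SimpleGraph.Walk.edges_cons, List.mem_cons] at h
    rcases h with e | e
    · rcases Sym2.eq_iff.1 e with ⟨-, rfl⟩ | ⟨e, -⟩
      · rw [SimpleGraph.Walk.length_cons,
          SimpleGraph.Walk.length_eq_zero_iff.2 (SimpleGraph.Walk.isPath_iff_nil.1 hp.1)]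
      · exact absurd e huv.ne
    · exact absurd (p.fst_mem_support_of_mem_edges e) hp.2

/-- The ends of a path from `a` to `b` that it shares with the other two paths of a trihedron,
stamp or prism: `l` and `r` say that the left and the right ends of the paths form a triangle, and
otherwise they coincide. -/
def sharedEnds {V : Type*} (l r : Prop) (a b : V) : Set V :=
  {u | ¬l ∧ u = a ∨ ¬r ∧ u = b}

theorem sharedEnds_comm : sharedEnds l r a b = sharedEnds r l b a :=
  Set.ext fun _ => or_comm

theorem sharedEnds_subset (ha : a ∈ A) (hb : b ∈ A) : sharedEnds l r a b ⊆ A := by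
  rintro u (⟨-, rfl⟩ | ⟨-, rfl⟩)
  exacts [ha, hb]

/-- `G` is a trihedron, a stamp or a prism, in terms of three induced paths `A i` from `a i` to
`b i`; the ends `a i` form a triangle if `l` holds and coincide otherwise, likewise `b i` and `r`.
By symmetry a stamp has its triangle on the left. -/
structure ThreePaths {V : Type*} (G : SimpleGraph V) (l r : Prop) (a b : Fin 3 → V)
    (A : Fin 3 → Set V) : Prop where
  path : ∀ i, IndPath G (a i) (b i) (A i)
  left : l → ∀ i j, i ≠ j → G.Adj (a i) (a j)
  left_eq : ¬l → ∀ i j, a i = a j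
  right : r → ∀ i j, i ≠ j → G.Adj (b i) (b j)
  right_eq : ¬r → ∀ i j, b i = b j
  inter : ∀ i j, i ≠ j → ∀ u ∈ A i, u ∈ A j → u ∈ sharedEnds l r (a i) (b i)
  edges : ∀ u w, G.Adj u w → (∃ i, u ∈ A i ∧ w ∈ A i) ∨ (l ∧ ∃ i j, u = a i ∧ w = a j) ∨
    (r ∧ ∃ i j, u = b i ∧ w = b j)
  ne : ∀ i j, a i ≠ b j
  cover : ∀ u, ∃ i, u ∈ A i
  not_adj : ¬l → ¬r → ∀ i, ¬G.Adj (a i) (b i)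
  shape : l ∨ ¬r

section Walks

variable {a b : Fin 3 → V} {i j : Fin 3}

theorem eq_of_left_mem {A : Fin 3 → Set V} (ha : ∀ i, a i ∈ A i) (ne : ∀ i j, a i ≠ b j)
    (inter : ∀ i j, i ≠ j → ∀ u ∈ A i, u ∈ A j → u ∈ sharedEnds l r (a i) (b i)) (hl : l)
    (hij : a i ∈ A j) : i = j := by
  by_contra hne
  rcases inter i j hne _ (ha i) hij with h | h
  · exact h.1 hl
  · exact ne _ _ h.2

theorem eq_of_right_mem {A : Fin 3 → Set V} (hb : ∀ i, b i ∈ A i) (ne : ∀ i j, a i ≠ b j)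
    (inter : ∀ i j, i ≠ j → ∀ u ∈ A i, u ∈ A j → u ∈ sharedEnds l r (a i) (b i)) (hr : r)
    (hij : b i ∈ A j) : i = j :=
  eq_of_left_mem hb (fun i j => (ne j i).symm)
    (fun i j hne u hi hj => sharedEnds_comm (l := l) ▸ inter i j hne u hi hj) hr hij

theorem not_mem_edges_of_two_le_length {P : ∀ i, G.Walk (a i) (b i)} (hP : ∀ i, (P i).IsPath)
    (hlen : ∀ i, 2 ≤ (P i).length) (ha : ∀ i j, a i = a j) (hb : ∀ i j, b i = b j) :
    s(a i, b i) ∉ (P j).edges := by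
  intro h
  rw [ha i j, hb i j] at h
  have := length_eq_one_of_mem_edges _ (hP j) h
  have := hlen j
  omega

theorem mem_edges_of_mem_support {P : ∀ i, G.Walk (a i) (b i)}
    (inter : ∀ i j, i ≠ j → ∀ u ∈ (P i).support, u ∈ (P j).support →
      u ∈ sharedEnds l r (a i) (b i))
    (long : ¬l → ¬r → ∀ i j, s(a i, b i) ∉ (P j).edges) {x y : V} (hxy : x ≠ y)
    (hx : x ∈ (P i).support) (hy : y ∈ (P i).support) (he : s(x, y) ∈ (P j).edges) :
    s(x, y) ∈ (P i).edges := by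
  by_cases hij : i = j
  · rwa [hij]
  exfalso
  rcases inter i j hij x hx ((P j).fst_mem_support_of_mem_edges he) with ⟨nx, rfl⟩ | ⟨nx, rfl⟩ <;>
    rcases inter i j hij y hy ((P j).snd_mem_support_of_mem_edges he) with ⟨ny, rfl⟩ | ⟨ny, rfl⟩
  · exact hxy rfl
  · exact long nx ny i j he
  · exact long ny nx i j (Sym2.eq_swap ▸ he)
  · exact hxy rfl

theorem threePaths_of_walks (P : ∀ i, G.Walk (a i) (b i))
    (hP : ∀ i, (P i).IsPath) (left : l → ∀ i j, i ≠ j → G.Adj (a i) (a j))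
    (left_eq : ¬l → ∀ i j, a i = a j) (right : r → ∀ i j, i ≠ j → G.Adj (b i) (b j))
    (right_eq : ¬r → ∀ i j, b i = b j)
    (inter : ∀ i j, i ≠ j → ∀ u ∈ (P i).support, u ∈ (P j).support →
      u ∈ sharedEnds l r (a i) (b i))
    (edges : ∀ u w, G.Adj u w → (∃ i, s(u, w) ∈ (P i).edges) ∨
      (l ∧ ∃ i j, s(u, w) = s(a i, a j)) ∨ (r ∧ ∃ i j, s(u, w) = s(b i, b j)))
    (ne : ∀ i j, a i ≠ b j) (cover : ∀ u, ∃ i, u ∈ (P i).support)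
    (len : ¬l → ¬r → ∀ i, 2 ≤ (P i).length) (shape : l ∨ ¬r) :
    ThreePaths G l r a b fun i => {x | x ∈ (P i).support} := by
  have hl : ∀ {i j}, l → a i ∈ (P j).support → i = j :=
    eq_of_left_mem (A := fun i => {x | x ∈ (P i).support}) (fun i => (P i).start_mem_support) ne
      inter
  have hr : ∀ {i j}, r → b i ∈ (P j).support → i = j :=
    eq_of_right_mem (A := fun i => {x | x ∈ (P i).support}) (fun i => (P i).end_mem_support) ne
      inter
  have long : ¬l → ¬r → ∀ i j, s(a i, b i) ∉ (P j).edges := fun nl nr _ _ =>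
    not_mem_edges_of_two_le_length hP (len nl nr) (left_eq nl) (right_eq nr)
  refine ⟨fun i => indPath_of_walk _ (hP i) fun x hx y hy hxy => ?_, left, left_eq, right,
    right_eq, inter, fun u w huw => ?_, ne, cover, fun nl nr i h => ?_, shape⟩
  · rcases edges x y hxy with ⟨j, h⟩ | ⟨hl', j, k, h⟩ | ⟨hr', j, k, h⟩
    · exact mem_edges_of_mem_support inter long hxy.ne hx hy h
    · rcases Sym2.eq_iff.1 h with ⟨rfl, rfl⟩ | ⟨rfl, rfl⟩ <;>
        exact absurd (by rw [hl hl' hx, hl hl' hy]) hxy.ne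
    · rcases Sym2.eq_iff.1 h with ⟨rfl, rfl⟩ | ⟨rfl, rfl⟩ <;>
        exact absurd (by rw [hr hr' hx, hr hr' hy]) hxy.ne
  · rcases edges u w huw with ⟨j, h⟩ | ⟨hl', j, k, h⟩ | ⟨hr', j, k, h⟩
    · exact Or.inl ⟨j, (P j).fst_mem_support_of_mem_edges h, (P j).snd_mem_support_of_mem_edges h⟩
    · refine Or.inr (Or.inl ⟨hl', ?_⟩)
      rcases Sym2.eq_iff.1 h with ⟨rfl, rfl⟩ | ⟨rfl, rfl⟩ <;> exact ⟨_, _, rfl, rfl⟩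
    · refine Or.inr (Or.inr ⟨hr', ?_⟩)
      rcases Sym2.eq_iff.1 h with ⟨rfl, rfl⟩ | ⟨rfl, rfl⟩ <;> exact ⟨_, _, rfl, rfl⟩
  · rcases edges _ _ h with ⟨j, h⟩ | ⟨hl', -⟩ | ⟨hr', -⟩
    exacts [long nl nr i j h, nl hl', nr hr']

end Walks

theorem IsTrihedron.threePaths (h : IsTrihedron G) :
    ∃ a b A, ThreePaths G False False a b A := by
  obtain ⟨x, y, P, hxy, hP, hint, hcov, hedge⟩ := h
  refine ⟨fun _ => x, fun _ => y, _, threePaths_of_walks P (fun i => (hP i).1) (fun h => h.elim)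
    (fun _ _ _ => rfl) (fun h => h.elim) (fun _ _ _ => rfl) ?_ ?_ (fun _ _ => hxy) hcov
    (fun _ _ i => (hP i).2) (Or.inr id)⟩
  · intro i j hij u hi hj
    simpa [sharedEnds] using hint i j hij u hi hj
  · intro u w huw
    exact Or.inl (hedge s(u, w) huw)

theorem IsStamp.threePaths (h : IsStamp G) :
    ∃ a b A, ThreePaths G True False a b A := by
  obtain ⟨t, x, P, ht, hP, hint, hcov, hedge⟩ := h
  refine ⟨t, fun _ => x, _, threePaths_of_walks P (fun i => (hP i).1) (fun _ => ht)
    (fun h => absurd trivial h) (fun h => h.elim) (fun _ _ _ => rfl) ?_ ?_ ?_ hcov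
    (fun h => absurd trivial h) (Or.inr id)⟩
  · intro i j hij u hi hj
    simpa [sharedEnds] using hint i j hij u hi hj
  · intro u w huw
    rcases hedge s(u, w) huw with h | h
    · exact Or.inr (Or.inl ⟨trivial, h⟩)
    · exact Or.inl h
  · intro i _ e
    have hnil := SimpleGraph.Walk.length_eq_zero_iff.2 ((hP i).1.nil_iff_eq.2 e)
    have hlen := (hP i).2
    omega

theorem IsPrism.threePaths (h : IsPrism G) :
    ∃ a b A, ThreePaths G True True a b A := by
  obtain ⟨t, t', P, ht, ht', hne, hP, hint, hcov, hedge⟩ := h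
  refine ⟨t, t', _, threePaths_of_walks P hP (fun _ => ht)
    (fun h => absurd trivial h) (fun _ => ht') (fun h => absurd trivial h) ?_ ?_ hne hcov
    (fun h => absurd trivial h) (Or.inl trivial)⟩
  · intro i j hij u hi hj
    exact absurd hj (hint i j hij u hi)
  · intro u w huw
    rcases hedge s(u, w) huw with h | h | h
    · exact Or.inr (Or.inl ⟨trivial, h⟩)
    · exact Or.inr (Or.inr ⟨trivial, h⟩)
    · exact Or.inl h

end FormsOfWalks

section Forms

variable {V W : Type*} {G : SimpleGraph V} {H : SimpleGraph W} {l r : Prop}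
  {a b c d e f v : V} {A B Q s : Set V}

theorem IndPath.exists_sdiff_sharedEnds (p : IndPath G a b A) (l r : Prop) (hab : a ≠ b)
    (h : ¬l → ¬r → ¬G.Adj a b) :
    ∃ c d, IndPath G c d (A \ sharedEnds l r a b) ∧ (l → c = a) ∧
      (¬l → G.Adj a c ∧ ∀ u ∈ A, G.Adj a u → u = c) ∧ (r → d = b) ∧
      (¬r → G.Adj b d ∧ ∀ u ∈ A, G.Adj b u → u = d) := by
  by_cases hl : l <;> by_cases hr : r
  · exact ⟨a, b, by simpa [sharedEnds, hl, hr] using p, by simp [hl, hr]⟩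
  · obtain ⟨d, q, had, hd⟩ := p.trim_right hab
    exact ⟨a, d, by simpa [sharedEnds, hl, hr] using q, by simpa [hl, hr] using ⟨had, hd⟩⟩
  · obtain ⟨c, q, hac, hc⟩ := p.trim_left hab
    exact ⟨c, b, by simpa [sharedEnds, hl, hr] using q, by simpa [hl, hr] using ⟨hac, hc⟩⟩
  · obtain ⟨c, q, hac, hc⟩ := p.trim_left hab
    have hcb : c ≠ b := fun e => h hl hr (e ▸ hac)
    obtain ⟨d, q', hbd, hd⟩ := q.trim_right hcb
    refine ⟨c, d, ?_, by simp [hl], fun _ => ⟨hac, hc⟩, by simp [hr],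
      fun _ => ⟨hbd, fun u hu hbu => hd u ⟨hu, ?_⟩ hbu⟩⟩
    · convert q' using 1
      ext u
      simp [sharedEnds, hl, hr, and_assoc]
    · rintro rfl
      exact h hl hr hbu.symm

open Classical in
theorem IndPath.union_sharedEnds (p : IndPath G c d B) (l r : Prop) (hab : a ≠ b) (ha : a ∉ B)
    (hb : b ∉ B) (hac : G.Adj a c) (hbd : G.Adj b d) (hac' : ∀ u ∈ B, G.Adj a u → u = c)
    (hbd' : ∀ u ∈ B, G.Adj b u → u = d) (h : ¬l → ¬r → ¬G.Adj a b) :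
    IndPath G (if l then c else a) (if r then d else b) (B ∪ sharedEnds l r a b) := by
  have hconcat := p.concat hbd.symm hb fun u hu hub => hbd' u hu hub.symm
  by_cases hl : l <;> by_cases hr : r
  · simpa [sharedEnds, hl, hr] using p
  · simpa [sharedEnds, hl, hr] using hconcat
  · simpa [sharedEnds, hl, hr] using p.cons hac ha hac'
  · have hset : B ∪ sharedEnds l r a b = insert a (insert b B) := by
      ext u
      simp only [sharedEnds, hl, hr, Set.mem_union, Set.mem_ofPred_eq, Set.mem_insert_iff]
      tauto
    rw [hset, if_neg hl, if_neg hr]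
    refine .cons hac (by simpa [hab] using ha) ?_ hconcat
    rintro u (rfl | hu) hau
    exacts [absurd hau (h hl hr), hac' u hu hau]

namespace ThreePaths

variable {a b : Fin 3 → V} {A : Fin 3 → Set V} {i j k : Fin 3} {u w : V}

theorem eq_of_left_mem (h : ThreePaths G l r a b A) (hl : l) (hij : a i ∈ A j) : i = j :=
  GraphChar.eq_of_left_mem (fun i => (h.path i).left_mem) h.ne h.inter hl hij

theorem eq_of_right_mem (h : ThreePaths G l r a b A) (hr : r) (hij : b i ∈ A j) : i = j :=
  GraphChar.eq_of_right_mem (fun i => (h.path i).right_mem) h.ne h.inter hr hij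

theorem eq_of_mem (h : ThreePaths G l r a b A) (hi : u ∈ A i \ sharedEnds l r (a i) (b i))
    (hj : u ∈ A j) : i = j := by
  by_contra hij
  exact hi.2 (h.inter i j hij u hi.1 hj)

theorem sharedEnds_eq (h : ThreePaths G l r a b A) (i j : Fin 3) :
    sharedEnds l r (a i) (b i) = sharedEnds l r (a j) (b j) :=
  Set.ext fun _ => or_congr (and_congr_right fun hl => h.left_eq hl i j ▸ Iff.rfl)
    (and_congr_right fun hr => h.right_eq hr i j ▸ Iff.rfl)

theorem disjoint_sdiff (h : ThreePaths G l r a b A) (hij : i ≠ j) :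
    Disjoint (A i) (A j \ sharedEnds l r (a j) (b j)) :=
  Set.disjoint_left.2 fun _ hi hj => hij (h.eq_of_mem hj hi).symm

theorem univ_eq (h : ThreePaths G l r a b A) (hall : ∀ m, m = i ∨ m = j ∨ m = k) :
    Set.univ = A i ∪ A j \ sharedEnds l r (a j) (b j) ∪ A k \ sharedEnds l r (a k) (b k) := by
  symm
  rw [Set.eq_univ_iff_forall]
  intro u
  have hshared : sharedEnds l r (a i) (b i) ⊆ A i :=
    sharedEnds_subset (h.path i).left_mem (h.path i).right_mem
  rw [h.sharedEnds_eq j i, h.sharedEnds_eq k i]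
  by_cases hu : u ∈ sharedEnds l r (a i) (b i)
  · exact Or.inl (Or.inl (hshared hu))
  · obtain ⟨m, hm⟩ := h.cover u
    rcases hall m with rfl | rfl | rfl
    exacts [Or.inl (Or.inl hm), Or.inl (Or.inr ⟨hm, hu⟩), Or.inr ⟨hm, hu⟩]

theorem exists_sdiff_indPath (h : ThreePaths G l r a b A) (k : Fin 3) :
    ∃ c d, IndPath G c d (A k \ sharedEnds l r (a k) (b k)) ∧ (l → c = a k) ∧ (r → d = b k) ∧
      ∀ i, i ≠ k → G.Adj (a i) c ∧ G.Adj (b i) d ∧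
        ∀ u ∈ A i, ∀ w ∈ A k \ sharedEnds l r (a k) (b k), G.Adj u w →
          u = a i ∧ w = c ∨ u = b i ∧ w = d := by
  obtain ⟨c, d, p, hcl, hcl', hdr, hdr'⟩ := (h.path k).exists_sdiff_sharedEnds l r (h.ne k k)
    fun nl nr => h.not_adj nl nr k
  refine ⟨c, d, p, hcl, hdr, fun i hik => ⟨?_, ?_, fun u hu w hw huw => ?_⟩⟩
  · by_cases hl : l
    · exact hcl hl ▸ h.left hl _ _ hik
    · exact h.left_eq hl k i ▸ (hcl' hl).1
  · by_cases hr : r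
    · exact hdr hr ▸ h.right hr _ _ hik
    · exact h.right_eq hr k i ▸ (hdr' hr).1
  · rcases h.edges u w huw with ⟨m, hum, hwm⟩ | ⟨hl, m, m', rfl, rfl⟩ | ⟨hr, m, m', rfl, rfl⟩
    · obtain rfl := h.eq_of_mem hw hwm
      rcases h.inter i k hik u hu hum with ⟨hl, rfl⟩ | ⟨hr, rfl⟩
      · exact Or.inl ⟨rfl, (hcl' hl).2 w hw.1 (h.left_eq hl i k ▸ huw)⟩
      · exact Or.inr ⟨rfl, (hdr' hr).2 w hw.1 (h.right_eq hr i k ▸ huw)⟩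
    · rw [hcl hl, h.eq_of_left_mem hl hu, h.eq_of_left_mem hl hw.1]
      exact Or.inl ⟨rfl, rfl⟩
    · rw [hdr hr, h.eq_of_right_mem hr hu, h.eq_of_right_mem hr hw.1]
      exact Or.inr ⟨rfl, rfl⟩

theorem adj_iff (h : ThreePaths G l r a b A) (hjk : j ≠ k)
    (hu : u ∈ A j \ sharedEnds l r (a j) (b j)) (hw : w ∈ A k \ sharedEnds l r (a k) (b k)) :
    G.Adj u w ↔ l ∧ u = a j ∧ w = a k ∨ r ∧ u = b j ∧ w = b k := by
  constructor
  · intro huw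
    rcases h.edges u w huw with ⟨m, hum, hwm⟩ | ⟨hl, m, m', rfl, rfl⟩ | ⟨hr, m, m', rfl, rfl⟩
    · exact absurd ((h.eq_of_mem hu hum).trans (h.eq_of_mem hw hwm).symm) hjk
    · rw [h.eq_of_left_mem hl hu.1, h.eq_of_left_mem hl hw.1]
      exact Or.inl ⟨hl, rfl, rfl⟩
    · rw [h.eq_of_right_mem hr hu.1, h.eq_of_right_mem hr hw.1]
      exact Or.inr ⟨hr, rfl, rfl⟩
  · rintro (⟨hl, rfl, rfl⟩ | ⟨hr, rfl, rfl⟩)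
    exacts [h.left hl _ _ hjk, h.right hr _ _ hjk]

theorem exists_cyclePath (h : ThreePaths G l r a b A) (hij : i ≠ j) (hik : i ≠ k) (hjk : j ≠ k) :
    ∃ c d e f, CyclePath G l r (a i) (b i) (A i) c d (A j \ sharedEnds l r (a j) (b j)) e f
      (A k \ sharedEnds l r (a k) (b k)) := by
  obtain ⟨c, d, pB, hcl, hdr, hB⟩ := h.exists_sdiff_indPath j
  obtain ⟨e, f, pQ, hel, hfr, hQ⟩ := h.exists_sdiff_indPath k
  obtain ⟨hac, hbd, hAB⟩ := hB i hij
  obtain ⟨hae, hbf, hAQ⟩ := hQ i hik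
  refine ⟨c, d, e, f, h.path i, pB, pQ, h.disjoint_sdiff hij, h.disjoint_sdiff hik,
    (h.disjoint_sdiff hjk).mono_left Set.sdiff_subset, h.ne i i, hac, hbd, hae, hbf, hAB, hAQ,
    fun u hu w hw => ?_, ?_⟩
  · rw [h.adj_iff hjk hu hw]
    exact or_congr (and_congr_right fun hl => by rw [hcl hl, hel hl])
      (and_congr_right fun hr => by rw [hdr hr, hfr hr])
  · by_cases hl : l
    · by_cases hr : r
      · exact Or.inr (Or.inr ⟨hl, hr, hcl hl ▸ hdr hr ▸ h.ne j j, hel hl ▸ hfr hr ▸ h.ne k k⟩)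
      · exact Or.inr (Or.inl ⟨hl, hr⟩)
    · have hr := h.shape.resolve_left hl
      exact Or.inl ⟨hl, hr, h.not_adj hl hr i⟩

theorem exists_cyclePath_mem (h : ThreePaths G l r a b A) (v : V) :
    ∃ l r a b A c d B e f Q, Set.univ = A ∪ B ∪ Q ∧ CyclePath G l r a b A c d B e f Q ∧
      (v ∈ Q ∨ ¬r ∧ v = b) := by
  obtain ⟨k, hk⟩ := h.cover v
  obtain ⟨i, j, hij, hik, hjk, hall⟩ :
      ∃ i j, i ≠ j ∧ i ≠ k ∧ j ≠ k ∧ ∀ m, m = i ∨ m = j ∨ m = k := by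
    clear hk
    revert k
    decide
  have hcov := h.univ_eq hall
  obtain ⟨c, d, e, f, ht⟩ := h.exists_cyclePath hij hik hjk
  by_cases hv : v ∈ sharedEnds l r (a k) (b k)
  · rcases hv with ⟨hl, rfl⟩ | ⟨hr, rfl⟩
    · have hr := h.shape.resolve_left hl
      exact ⟨_, _, _, _, _, _, _, _, _, _, _, hcov, ht.reverse hl hr,
        Or.inr ⟨hl, h.left_eq hl _ _⟩⟩
    · exact ⟨_, _, _, _, _, _, _, _, _, _, _, hcov, ht, Or.inr ⟨hr, h.right_eq hr _ _⟩⟩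
  · exact ⟨_, _, _, _, _, _, _, _, _, _, _, hcov, ht, Or.inl ⟨hk, hv⟩⟩

theorem exists_walks (h : ThreePaths G l r a b A) : ∃ P : ∀ i, G.Walk (a i) (b i),
    (∀ i, (P i).IsPath) ∧ (∀ i x, x ∈ (P i).support ↔ x ∈ A i) ∧
      ∀ i, ∀ x ∈ A i, ∀ y ∈ A i, G.Adj x y → s(x, y) ∈ (P i).edges := by
  choose P hP using fun i => (h.path i).exists_walk
  exact ⟨P, fun i => (hP i).1, fun i => (hP i).2.1, fun i => (hP i).2.2⟩

theorem one_le_length (h : ThreePaths G l r a b A) (p : G.Walk (a i) (b i)) : 1 ≤ p.length :=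
  Nat.one_le_iff_ne_zero.2 fun hp => h.ne i i (SimpleGraph.Walk.eq_of_length_eq_zero hp)

theorem isTrihedron (h : ThreePaths G l r a b A) (hl : ¬l) (hr : ¬r) : IsTrihedron G := by
  obtain ⟨P, hP, hsupp, hedges⟩ := h.exists_walks
  have hlen : ∀ i, 2 ≤ (P i).length := fun i =>
    (h.one_le_length (P i)).lt_of_ne' fun hlen =>
      h.not_adj hl hr i (SimpleGraph.Walk.adj_of_length_eq_one hlen)
  obtain ⟨x, rfl⟩ : ∃ x, a = fun _ => x := ⟨a 0, funext fun i => h.left_eq hl i 0⟩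
  obtain ⟨y, rfl⟩ : ∃ y, b = fun _ => y := ⟨b 0, funext fun i => h.right_eq hr i 0⟩
  refine ⟨x, y, P, h.ne 0 0, fun i => ⟨hP i, hlen i⟩, ?_, ?_, Sym2.ind fun u w huw => ?_⟩
  · intro i j hij u hi hj
    exact (h.inter i j hij u ((hsupp i u).1 hi) ((hsupp j u).1 hj)).imp And.right And.right
  · simpa only [hsupp] using h.cover
  · rcases h.edges u w huw with ⟨i, hu, hw⟩ | ⟨hl', -⟩ | ⟨hr', -⟩
    exacts [⟨i, hedges i u hu w hw huw⟩, absurd hl' hl, absurd hr' hr]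

theorem isStamp (h : ThreePaths G l r a b A) (hl : l) (hr : ¬r) : IsStamp G := by
  obtain ⟨P, hP, hsupp, hedges⟩ := h.exists_walks
  have hlen : ∀ i, 1 ≤ (P i).length := fun i => h.one_le_length (P i)
  obtain ⟨x, rfl⟩ : ∃ x, b = fun _ => x := ⟨b 0, funext fun i => h.right_eq hr i 0⟩
  refine ⟨a, x, P, h.left hl, fun i => ⟨hP i, hlen i⟩, ?_, ?_, Sym2.ind fun u w huw => ?_⟩
  · intro i j hij u hi hj
    rcases h.inter i j hij u ((hsupp i u).1 hi) ((hsupp j u).1 hj) with ⟨hl', -⟩ | ⟨-, hu⟩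
    exacts [absurd hl hl', hu]
  · simpa only [hsupp] using h.cover
  · rcases h.edges u w huw with ⟨i, hu, hw⟩ | ⟨-, i, j, rfl, rfl⟩ | ⟨hr', -⟩
    exacts [Or.inr ⟨i, hedges i u hu w hw huw⟩, Or.inl ⟨i, j, rfl⟩, absurd hr' hr]

theorem isPrism (h : ThreePaths G l r a b A) (hl : l) (hr : r) : IsPrism G := by
  obtain ⟨P, hP, hsupp, hedges⟩ := h.exists_walks
  refine ⟨a, b, P, h.left hl, h.right hr, h.ne, hP, ?_, ?_, Sym2.ind fun u w huw => ?_⟩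
  · intro i j hij u hi hj
    rcases h.inter i j hij u ((hsupp i u).1 hi) ((hsupp j u).1 hj) with ⟨hl', -⟩ | ⟨hr', -⟩
    exacts [hl' hl, hr' hr]
  · simpa only [hsupp] using h.cover
  · rcases h.edges u w huw with ⟨i, hu, hw⟩ | ⟨-, i, j, rfl, rfl⟩ | ⟨-, i, j, rfl, rfl⟩
    exacts [Or.inr (Or.inr ⟨i, hedges i u hu w hw huw⟩), Or.inl ⟨i, j, rfl⟩,
      Or.inr (Or.inl ⟨i, j, rfl⟩)]

theorem isSolidGraph (h : ThreePaths G l r a b A) : IsSolidGraph G := by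
  by_cases hr : r
  · exact Or.inr (Or.inr (Or.inr (h.isPrism (h.shape.resolve_right (not_not.2 hr)) hr)))
  · by_cases hl : l
    · exact Or.inr (Or.inr (Or.inl (h.isStamp hl hr)))
    · exact Or.inr (Or.inl (h.isTrihedron hl hr))

end ThreePaths

theorem IsSolidGraph.indPyramid_or_cyclePath (h : IsSolidGraph (G.induce s)) (hv : v ∈ s) :
    IndPyramid G s ∨ ∃ l r a b A c d B e f Q, s = A ∪ B ∪ Q ∧
      CyclePath G l r a b A c d B e f Q ∧ (v ∈ Q ∨ ¬r ∧ v = b) := by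
  have hval : Set.InjOn (Subtype.val : s → V) Set.univ := Subtype.val_injective.injOn
  have himg : (Subtype.val : s → V) '' Set.univ = s := by simp
  have hG : ∀ u ∈ (Set.univ : Set s), ∀ w ∈ (Set.univ : Set s),
    (G.induce s).Adj u w ↔ G.Adj u.1 w.1 := fun _ _ _ _ => Iff.rfl
  have solid_of_threePaths : (∃ l r a b A, ThreePaths (G.induce s) l r a b A) →
      ∃ l r a b A c d B e f Q, s = A ∪ B ∪ Q ∧ CyclePath G l r a b A c d B e f Q ∧
      (v ∈ Q ∨ ¬r ∧ v = b) := by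
    rintro ⟨l, r, a, b, A, h⟩
    obtain ⟨l, r, a, b, A, c, d, B, e, f, Q, hs, ht, hQ⟩ := h.exists_cyclePath_mem ⟨v, hv⟩
    refine ⟨l, r, _, _, _, _, _, _, _, _, _, ?_, ht.image hs hval hG, ?_⟩
    · rw [← Set.image_union, ← Set.image_union, ← hs, himg]
    · rcases hQ with hQ | ⟨hr, rfl⟩
      · exact Or.inl ⟨_, hQ, rfl⟩
      · exact Or.inr ⟨hr, rfl⟩
  rcases h with h | h | h | h
  · exact Or.inl (himg ▸ h.indPyramid.image hval hG)
  · exact Or.inr (solid_of_threePaths ⟨_, _, h.threePaths⟩)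
  · exact Or.inr (solid_of_threePaths ⟨_, _, h.threePaths⟩)
  · exact Or.inr (solid_of_threePaths ⟨_, _, h.threePaths⟩)

theorem triangle_adj (hab : G.Adj a b) (hac : G.Adj a c) (hbc : G.Adj b c)
    (i j : Fin 3) (hij : i ≠ j) : G.Adj (![a, b, c] i) (![a, b, c] j) := by
  fin_cases i <;> fin_cases j <;> first
    | exact absurd rfl hij
    | exact hab
    | exact hab.symm
    | exact hac
    | exact hac.symm
    | exact hbc
    | exact hbc.symm

theorem disjoint_cons_of_disjoint (hAB : Disjoint A B) (hAQ : Disjoint A Q) (hBQ : Disjoint B Q)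
    (i j : Fin 3) (hij : i ≠ j) : Disjoint (![A, B, Q] i) (![A, B, Q] j) := by
  fin_cases i <;> fin_cases j <;> first
    | exact absurd rfl hij
    | exact hAB
    | exact hAB.symm
    | exact hAQ
    | exact hAQ.symm
    | exact hBQ
    | exact hBQ.symm

namespace CyclePath

variable {u w : V}

theorem cons_ne_cons (h : CyclePath G l r a b A c d B e f Q) (hcd : c ≠ d) (hef : e ≠ f)
    (i j : Fin 3) : ![a, c, e] i ≠ ![b, d, f] j := by
  have hab := h.ne
  have had := h.disjAB.ne_of_mem h.pathA.left_mem h.pathB.right_mem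
  have haf := h.disjAQ.ne_of_mem h.pathA.left_mem h.pathQ.right_mem
  have hcb := (h.disjAB.ne_of_mem h.pathA.right_mem h.pathB.left_mem).symm
  have hcf := h.disjBQ.ne_of_mem h.pathB.left_mem h.pathQ.right_mem
  have heb := (h.disjAQ.ne_of_mem h.pathA.right_mem h.pathQ.left_mem).symm
  have hed := (h.disjBQ.ne_of_mem h.pathB.right_mem h.pathQ.left_mem).symm
  fin_cases i <;> fin_cases j <;> assumption

theorem exists_mem_or_of_adj (h : CyclePath G l r a b A c d B e f Q) (hs : Set.univ = A ∪ B ∪ Q)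
    (huw : G.Adj u w) : (∃ i, u ∈ ![A, B, Q] i ∧ w ∈ ![A, B, Q] i) ∨
      (∃ i j, (l ∨ i = 0 ∨ j = 0) ∧ u = ![a, c, e] i ∧ w = ![a, c, e] j) ∨
      ∃ i j, (r ∨ i = 0 ∨ j = 0) ∧ u = ![b, d, f] i ∧ w = ![b, d, f] j := by
  have hcov : ∀ x, x ∈ A ∪ B ∪ Q := fun x => hs ▸ Set.mem_univ x
  rcases hcov u with (hu | hu) | hu <;> rcases hcov w with (hw | hw) | hw
  · exact Or.inl ⟨0, hu, hw⟩
  · rcases h.adjAB u hu w hw huw with ⟨rfl, rfl⟩ | ⟨rfl, rfl⟩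
    exacts [Or.inr (Or.inl ⟨0, 1, by simp⟩), Or.inr (Or.inr ⟨0, 1, by simp⟩)]
  · rcases h.adjAQ u hu w hw huw with ⟨rfl, rfl⟩ | ⟨rfl, rfl⟩
    exacts [Or.inr (Or.inl ⟨0, 2, by simp⟩), Or.inr (Or.inr ⟨0, 2, by simp⟩)]
  · rcases h.adjAB w hw u hu huw.symm with ⟨rfl, rfl⟩ | ⟨rfl, rfl⟩
    exacts [Or.inr (Or.inl ⟨1, 0, by simp⟩), Or.inr (Or.inr ⟨1, 0, by simp⟩)]
  · exact Or.inl ⟨1, hu, hw⟩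
  · rcases (h.adjBQ u hu w hw).1 huw with ⟨hl, rfl, rfl⟩ | ⟨hr, rfl, rfl⟩
    exacts [Or.inr (Or.inl ⟨1, 2, by simp [hl]⟩), Or.inr (Or.inr ⟨1, 2, by simp [hr]⟩)]
  · rcases h.adjAQ w hw u hu huw.symm with ⟨rfl, rfl⟩ | ⟨rfl, rfl⟩
    exacts [Or.inr (Or.inl ⟨2, 0, by simp⟩), Or.inr (Or.inr ⟨2, 0, by simp⟩)]
  · rcases (h.adjBQ w hw u hu).1 huw.symm with ⟨hl, rfl, rfl⟩ | ⟨hr, rfl, rfl⟩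
    exacts [Or.inr (Or.inl ⟨2, 1, by simp [hl]⟩), Or.inr (Or.inr ⟨2, 1, by simp [hr]⟩)]
  · exact Or.inl ⟨2, hu, hw⟩

open Classical in
theorem indPath_union_sharedEnds (h : CyclePath G l r a b A c d B e f Q) (i : Fin 3) :
    IndPath G (if l then ![a, c, e] i else a) (if r then ![b, d, f] i else b)
      (![A, B, Q] i ∪ sharedEnds l r a b) := by
  have haA := h.pathA.left_mem
  have hbA := h.pathA.right_mem
  have hnab : ¬l → ¬r → ¬G.Adj a b := fun hl _ =>
    (h.shape.resolve_right (by simp [hl])).2.2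
  match i with
  | 0 =>
    simpa [Set.union_eq_self_of_subset_right (sharedEnds_subset haA hbA)] using h.pathA
  | 1 =>
    exact h.pathB.union_sharedEnds l r h.ne (Set.disjoint_left.1 h.disjAB haA)
      (Set.disjoint_left.1 h.disjAB hbA) h.ac h.bd
      (fun u hu hau => ((h.adjAB a haA u hu hau).resolve_right fun e => h.ne e.1).2)
      (fun u hu hbu => ((h.adjAB b hbA u hu hbu).resolve_left fun e => h.ne e.1.symm).2) hnab
  | 2 =>
    exact h.pathQ.union_sharedEnds l r h.ne (Set.disjoint_left.1 h.disjAQ haA)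
      (Set.disjoint_left.1 h.disjAQ hbA) h.ae h.bf
      (fun u hu hau => ((h.adjAQ a haA u hu hau).resolve_right fun e => h.ne e.1).2)
      (fun u hu hbu => ((h.adjAQ b hbA u hu hbu).resolve_left fun e => h.ne e.1.symm).2) hnab

open Classical in
theorem ite_ne_ite (h : CyclePath G l r a b A c d B e f Q) (i j : Fin 3) :
    (if l then ![a, c, e] i else a) ≠ if r then ![b, d, f] j else b := by
  rcases h.shape with ⟨hl, hr, -⟩ | ⟨hl, hr⟩ | ⟨hl, hr, hcd, hef⟩
  · simpa [hl, hr] using h.ne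
  · have hcb := (h.disjAB.ne_of_mem h.pathA.right_mem h.pathB.left_mem).symm
    have heb := (h.disjAQ.ne_of_mem h.pathA.right_mem h.pathQ.left_mem).symm
    simp only [hl, hr, if_true, if_false]
    fin_cases i
    exacts [h.ne, hcb, heb]
  · simpa [hl, hr] using h.cons_ne_cons hcd hef i j

theorem ends_mem (h : CyclePath G l r a b A c d B e f Q) (i : Fin 3) :
    ![a, c, e] i ∈ ![A, B, Q] i ∧ ![b, d, f] i ∈ ![A, B, Q] i := by
  fin_cases i
  exacts [⟨h.pathA.left_mem, h.pathA.right_mem⟩, ⟨h.pathB.left_mem, h.pathB.right_mem⟩,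
    ⟨h.pathQ.left_mem, h.pathQ.right_mem⟩]

open Classical in
theorem threePaths (h : CyclePath G l r a b A c d B e f Q) (hs : Set.univ = A ∪ B ∪ Q) :
    ThreePaths G l r (fun i => if l then ![a, c, e] i else a)
      (fun i => if r then ![b, d, f] i else b) fun i => ![A, B, Q] i ∪ sharedEnds l r a b where
  path := h.indPath_union_sharedEnds
  left hl i j hij := by
    have hce := (h.adjBQ c h.pathB.left_mem e h.pathQ.left_mem).2 (Or.inl ⟨hl, rfl, rfl⟩)
    simpa [hl] using triangle_adj h.ac h.ae hce i j hij
  left_eq hl i j := by simp [hl]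
  right hr i j hij := by
    have hdf := (h.adjBQ d h.pathB.right_mem f h.pathQ.right_mem).2 (Or.inr ⟨hr, rfl, rfl⟩)
    simpa [hr] using triangle_adj h.bd h.bf hdf i j hij
  right_eq hr i j := by simp [hr]
  inter i j hij u hi hj := by
    have hu : u ∈ sharedEnds l r a b := by
      rcases hi with hi | hi
      · exact hj.resolve_left (Set.disjoint_left.1
          (disjoint_cons_of_disjoint h.disjAB h.disjAQ h.disjBQ i j hij) hi)
      · exact hi
    exact hu.imp (fun hl => by simpa [hl.1] using hl.2) fun hr => by simpa [hr.1] using hr.2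
  edges u w huw := by
    rcases h.exists_mem_or_of_adj hs huw with ⟨i, hu, hw⟩ | ⟨i, j, hij, rfl, rfl⟩ |
      ⟨i, j, hij, rfl, rfl⟩
    · exact Or.inl ⟨i, Or.inl hu, Or.inl hw⟩
    · by_cases hl : l
      · exact Or.inr (Or.inl ⟨hl, i, j, by simp [hl], by simp [hl]⟩)
      · rcases hij.resolve_left hl with rfl | rfl
        exacts [Or.inl ⟨j, Or.inr (Or.inl ⟨hl, rfl⟩), Or.inl (h.ends_mem j).1⟩,
          Or.inl ⟨i, Or.inl (h.ends_mem i).1, Or.inr (Or.inl ⟨hl, rfl⟩)⟩]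
    · by_cases hr : r
      · exact Or.inr (Or.inr ⟨hr, i, j, by simp [hr], by simp [hr]⟩)
      · rcases hij.resolve_left hr with rfl | rfl
        exacts [Or.inl ⟨j, Or.inr (Or.inr ⟨hr, rfl⟩), Or.inl (h.ends_mem j).2⟩,
          Or.inl ⟨i, Or.inl (h.ends_mem i).2, Or.inr (Or.inr ⟨hr, rfl⟩)⟩]
  ne := h.ite_ne_ite
  cover u := by
    rcases (hs ▸ Set.mem_univ u : u ∈ A ∪ B ∪ Q) with (hu | hu) | hu
    exacts [⟨0, Or.inl hu⟩, ⟨1, Or.inl hu⟩, ⟨2, Or.inl hu⟩]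
  not_adj hl hr i := by
    simpa [hl, hr] using (h.shape.resolve_right (by simp [hl])).2.2
  shape := by
    rcases h.shape with hs | hs | hs
    exacts [Or.inr hs.2.1, Or.inl hs.1, Or.inl hs.1]

theorem isSolidGraph (h : CyclePath G l r a b A c d B e f Q) (hs : Set.univ = A ∪ B ∪ Q) :
    IsSolidGraph G :=
  (h.threePaths hs).isSolidGraph

end CyclePath

theorem IndSolid.nonempty (h : IndSolid G s) : s.Nonempty := by
  rcases h with ⟨C, w, -, -, rfl, -⟩ | ⟨l, r, a, b, A, c, d, B, e, f, Q, rfl, h⟩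
  · exact ⟨w, Or.inl rfl⟩
  · exact ⟨a, Or.inl (Or.inl h.pathA.left_mem)⟩

theorem IndSolid.isSolidGraph (h : IndSolid G s) : IsSolidGraph (G.induce s) := by
  have : Nonempty s := h.nonempty.to_subtype
  have hval : ∀ u ∈ s, (Function.invFun (Subtype.val : s → V) u).1 = u :=
    fun u hu => Function.invFun_eq ⟨⟨u, hu⟩, rfl⟩
  have h' : IndSolid (G.induce s) Set.univ := by
    have himg : Function.invFun (Subtype.val : s → V) '' s = Set.univ :=
      Set.eq_univ_of_forall fun u => ⟨u, u.2, Subtype.ext (hval u u.2)⟩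
    rw [← himg]
    refine h.image (fun u hu w hw e => ?_) fun u hu w hw => ?_
    · rw [← hval u hu, e, hval w hw]
    · rw [SimpleGraph.induce_adj, hval u hu, hval w hw]
  rcases h' with h' | ⟨l, r, a, b, A, c, d, B, e, f, Q, hs, h'⟩
  · exact Or.inl h'.isPyramid
  · exact h'.isSolidGraph hs

theorem isSolidGraph_induce_iff : IsSolidGraph (G.induce s) ↔ IndSolid G s := by
  refine ⟨fun h => ?_, IndSolid.isSolidGraph⟩
  by_cases hs : s.Nonempty
  · obtain ⟨v, hv⟩ := hs
    rcases h.indPyramid_or_cyclePath hv with h | ⟨l, r, a, b, A, c, d, B, e, f, Q, hs, h, -⟩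
    · exact Or.inl h
    · exact Or.inr ⟨l, r, a, b, A, c, d, B, e, f, Q, hs, h⟩
  · have : IsEmpty s := Set.isEmpty_coe_sort.2 (Set.not_nonempty_iff_eq_empty.1 hs)
    rcases h with ⟨w, -⟩ | ⟨w, -⟩ | ⟨t, -⟩ | ⟨t, -⟩
    exacts [isEmptyElim w, isEmptyElim w, isEmptyElim (t 0), isEmptyElim (t 0)]

end Forms

/-- The vertex `u` has a neighbour in `Q`. -/
def Attaches {V : Type*} (G : SimpleGraph V) (Q : Set V) (u : V) : Prop := ∃ q ∈ Q, G.Adj q u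

/-- Two distinct nonadjacent vertices of `C` have neighbours in `Q`. -/
def Spread {V : Type*} (G : SimpleGraph V) (C Q : Set V) : Prop :=
  ∃ u ∈ C, ∃ w ∈ C, u ≠ w ∧ ¬G.Adj u w ∧ Attaches G Q u ∧ Attaches G Q w

/-- An induced cycle `C` and a minimal connected set `Q` that attaches to two nonadjacent
vertices of `C`. -/
structure MinSpread {V : Type*} (G : SimpleGraph V) (C Q : Set V) : Prop where
  cyc : IndCycle G C
  disj : Disjoint C Q
  conn : Conn G Q
  spread : Spread G C Q
  min : ∀ Q₀ ⊆ Q, Conn G Q₀ → Spread G C Q₀ → Q₀ = Q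

/-- The vertex `v` of `C` has at most one neighbour in `Q`, and a proper connected subset of `Q`
that contains it attaches to `C` in `v` only. -/
structure CleanAt {V : Type*} (G : SimpleGraph V) (C Q : Set V) (v : V) : Prop where
  mem : v ∈ C
  unique : ∀ c ∈ Q, ∀ c' ∈ Q, G.Adj v c → G.Adj v c' → c = c'
  att : ∀ Q₀ ⊆ Q, Q₀ ≠ Q → Conn G Q₀ → Attaches G Q₀ v → ∀ u ∈ C, Attaches G Q₀ u → u = v

/-- The set `s` induces a `K⁴`, the only solid graph that is not an induced cycle together with a
set as in `MinSpread`. -/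
def IndK4 {V : Type*} (G : SimpleGraph V) (s : Set V) : Prop := G.IsClique s ∧ s.ncard = 4

section Spread

variable {V : Type*} {G : SimpleGraph V} {l r : Prop}
  {a b c d e f u w v u' w' x y q q' : V} {A B C Q s : Set V}

theorem Attaches.mono {Q' : Set V} (h : Attaches G Q u) (hQ : Q ⊆ Q') : Attaches G Q' u := by
  obtain ⟨q, hq, h⟩ := h
  exact ⟨q, hQ hq, h⟩

theorem Spread.exists_min [Finite V] (hC : IndCycle G C) (hd : Disjoint C Q) (hQ : Conn G Q)
    (h : Spread G C Q) : ∃ Q' ⊆ Q, MinSpread G C Q' := by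
  obtain ⟨Q', hle, hmin⟩ := exists_minimal_le_of_wellFoundedLT
    (fun T : Set V => Conn G T ∧ Spread G C T) Q ⟨hQ, h⟩
  exact ⟨Q', hle, hC, hd.mono_right hle, hmin.1.1, hmin.1.2, fun Q₀ hle₀ hconn hspread =>
    hle₀.antisymm (hmin.2 ⟨hconn, hspread⟩ hle₀)⟩

theorem Spread.nonempty (h : Spread G C Q) : Q.Nonempty := by
  obtain ⟨u, -, w, -, -, -, ⟨q, hq, -⟩, -⟩ := h
  exact ⟨q, hq⟩

theorem minSpread_singleton (hC : IndCycle G C) (hq : q ∉ C) (h : Spread G C {q}) :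
    MinSpread G C {q} :=
  ⟨hC, by simpa using hq, conn_singleton q, h, fun _ hsub _ hspread =>
    hspread.nonempty.subset_singleton_iff.1 hsub⟩

theorem cleanAt_singleton (hv : v ∈ C) : CleanAt G C {q} v := by
  refine ⟨hv, by simp +contextual, fun Q₀ hsub hne _ ⟨x, hx, _⟩ => ?_⟩
  exact absurd ((Set.Nonempty.subset_singleton_iff ⟨x, hx⟩).1 hsub) hne

theorem IndPyramid.minSpread (h : IndPyramid G s) (hv : v ∈ s) :
    IndK4 G s ∨ ∃ C Q, s = C ∪ Q ∧ MinSpread G C Q ∧ (v ∈ Q ∨ CleanAt G C Q v) := by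
  obtain ⟨C, w, hC, hw, rfl, x, hx, y, hy, z, hz, hxy, hxz, hyz, hwx, hwy, hwz⟩ := h
  by_cases hsp : Spread G C {w}
  · refine Or.inr ⟨C, {w}, by simp, minSpread_singleton hC hw hsp, ?_⟩
    rcases hv with rfl | hv
    · exact Or.inl rfl
    · exact Or.inr (cleanAt_singleton hv)
  · left
    have hclique : ∀ u ∈ C, ∀ u' ∈ C, u ≠ u' → G.Adj w u → G.Adj w u' → G.Adj u u' := by
      intro u hu u' hu' hne hwu hwu'
      by_contra hadj
      exact hsp ⟨u, hu, u', hu', hne, hadj, ⟨w, rfl, hwu⟩, ⟨w, rfl, hwu'⟩⟩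
    have hadjxy := hclique x hx y hy hxy hwx hwy
    have hadjxz := hclique x hx z hz hxz hwx hwz
    have hadjyz := hclique y hy z hz hyz hwy hwz
    obtain rfl := hC.eq_triangle hx hy hz hadjxy hadjxz hadjyz
    refine ⟨?_, ?_⟩
    · simp [SimpleGraph.isClique_insert, hwx, hwy, hwz, hadjxy, hadjxz, hadjyz]
    · rw [Set.ncard_insert_of_notMem hw (Set.toFinite _),
        Set.ncard_eq_three.2 ⟨x, y, z, hxy, hxz, hyz, rfl⟩]

theorem CyclePath.indCycle (h : CyclePath G l r a b A c d B e f Q) : IndCycle G (A ∪ B) :=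
  indCycle_of_paths h.pathA h.pathB h.disjAB h.ne h.ac h.bd h.adjAB

theorem CyclePath.attach_cases (h : CyclePath G l r a b A c d B e f Q) (hu : u ∈ A ∪ B)
    (hq : q ∈ Q) (hqu : G.Adj q u) : q = e ∧ (u = a ∨ l ∧ u = c) ∨ q = f ∧ (u = b ∨ r ∧ u = d) := by
  rcases hu with hu | hu
  · rcases h.adjAQ u hu q hq hqu.symm with ⟨rfl, rfl⟩ | ⟨rfl, rfl⟩ <;> simp
  · rcases (h.adjBQ u hu q hq).1 hqu.symm with ⟨hl, rfl, rfl⟩ | ⟨hr, rfl, rfl⟩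
    · simp [hl]
    · simp [hr]

theorem CyclePath.minSpread (h : CyclePath G l r a b A c d B e f Q)
    (hlong : ¬G.Adj a b ∨ l ∧ c ≠ d) : MinSpread G (A ∪ B) Q := by
  refine ⟨h.indCycle, Set.disjoint_union_left.2 ⟨h.disjAQ, h.disjBQ⟩, h.pathQ.conn, ?_, ?_⟩
  · rcases hlong with hab | ⟨hl, hcd⟩
    · exact ⟨a, Or.inl h.pathA.left_mem, b, Or.inl h.pathA.right_mem, h.ne, hab,
        ⟨e, h.pathQ.left_mem, h.ae.symm⟩, ⟨f, h.pathQ.right_mem, h.bf.symm⟩⟩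
    · refine ⟨b, Or.inl h.pathA.right_mem, c, Or.inr h.pathB.left_mem,
        h.disjAB.ne_of_mem h.pathA.right_mem h.pathB.left_mem, ?_,
        ⟨f, h.pathQ.right_mem, h.bf.symm⟩, ⟨e, h.pathQ.left_mem,
          ((h.adjBQ c h.pathB.left_mem e h.pathQ.left_mem).2 (Or.inl ⟨hl, rfl, rfl⟩)).symm⟩⟩
      intro hbc
      rcases h.adjAB b h.pathA.right_mem c h.pathB.left_mem hbc with ⟨e, -⟩ | ⟨-, e⟩
      · exact h.ne e.symm
      · exact hcd e
  · rintro Q₀ hQ₀ hconn ⟨u, hu, w, hw, huw, hadj, ⟨q, hq, hqu⟩, ⟨q', hq', hqw⟩⟩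
    by_contra hne
    have hef : ¬(e ∈ Q₀ ∧ f ∈ Q₀) := fun h' => hne (h.pathQ.eq_of_conn hQ₀ hconn h'.1 h'.2)
    rcases h.attach_cases hu (hQ₀ hq) hqu with ⟨rfl, hu'⟩ | ⟨rfl, hu'⟩ <;>
      rcases h.attach_cases hw (hQ₀ hq') hqw with ⟨rfl, hw'⟩ | ⟨rfl, hw'⟩
    · rcases hu' with rfl | ⟨-, rfl⟩ <;> rcases hw' with rfl | ⟨-, rfl⟩
      exacts [huw rfl, hadj h.ac, hadj h.ac.symm, huw rfl]
    · exact hef ⟨hq, hq'⟩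
    · exact hef ⟨hq', hq⟩
    · rcases hu' with rfl | ⟨-, rfl⟩ <;> rcases hw' with rfl | ⟨-, rfl⟩
      exacts [huw rfl, hadj h.bd, hadj h.bd.symm, huw rfl]

theorem CyclePath.cleanAt (h : CyclePath G l r a b A c d B e f Q) (hr : ¬r) :
    CleanAt G (A ∪ B) Q b := by
  have hb : ∀ q ∈ Q, G.Adj q b → q = f := by
    intro q hq hqb
    rcases h.adjAQ b h.pathA.right_mem q hq hqb.symm with ⟨e, -⟩ | ⟨-, e⟩
    · exact absurd e.symm h.ne
    · exact e
  refine ⟨Or.inl h.pathA.right_mem, fun q hq q' hq' hbq hbq' => ?_, ?_⟩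
  · rw [hb q hq hbq.symm, hb q' hq' hbq'.symm]
  · rintro Q₀ hQ₀ hne hconn ⟨q, hq, hqb⟩ u hu ⟨q', hq', hqu⟩
    obtain rfl := hb q (hQ₀ hq) hqb
    rcases h.attach_cases hu (hQ₀ hq') hqu with ⟨rfl, -⟩ | ⟨rfl, hub⟩
    · exact absurd (h.pathQ.eq_of_conn hQ₀ hconn hq' hq) hne
    · exact hub.resolve_right fun h' => hr h'.1

theorem CyclePath.indPyramid (h : CyclePath G l r a b A c d B e f Q) (hl : l) (hcd : c = d) :
    IndPyramid G (A ∪ B ∪ Q) := by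
  subst hcd
  have hB := h.pathB.eq_singleton
  have hce := (h.adjBQ c h.pathB.left_mem e h.pathQ.left_mem).2 (Or.inl ⟨hl, rfl, rfl⟩)
  refine ⟨A ∪ Q, c, indCycle_of_paths h.pathA h.pathQ h.disjAQ h.ne h.ae h.bf h.adjAQ, ?_, ?_, a,
    Or.inl h.pathA.left_mem, b, Or.inl h.pathA.right_mem, e, Or.inr h.pathQ.left_mem, h.ne,
    h.disjAQ.ne_of_mem h.pathA.left_mem h.pathQ.left_mem,
    h.disjAQ.ne_of_mem h.pathA.right_mem h.pathQ.left_mem, h.ac.symm, h.bd.symm, hce⟩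
  · rintro (h' | h')
    · exact Set.disjoint_left.1 h.disjAB h' h.pathB.left_mem
    · exact Set.disjoint_left.1 h.disjBQ h.pathB.left_mem h'
  · rw [hB, Set.union_singleton, Set.insert_union]

theorem IsSolidGraph.exists_minSpread (h : IsSolidGraph (G.induce s)) (hv : v ∈ s) :
    IndK4 G s ∨ ∃ C Q, s = C ∪ Q ∧ MinSpread G C Q ∧ (v ∈ Q ∨ CleanAt G C Q v) := by
  rcases h.indPyramid_or_cyclePath hv with h | ⟨l, r, a, b, A, c, d, B, e, f, Q, rfl, h, hvQ⟩
  · exact h.minSpread hv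
  · by_cases hlong : ¬G.Adj a b ∨ l ∧ c ≠ d
    · refine Or.inr ⟨_, _, rfl, h.minSpread hlong, hvQ.imp_right ?_⟩
      rintro ⟨hr, rfl⟩
      exact h.cleanAt hr
    · push Not at hlong
      have hl : l := by
        rcases h.shape with h' | h' | h'
        exacts [absurd hlong.1 h'.2.2, h'.1, h'.1]
      exact (h.indPyramid hl (hlong.2 hl)).minSpread hv

theorem IndPath.ends_unique (p : IndPath G a b A) (q : IndPath G x y A) :
    x = a ∧ y = b ∨ x = b ∧ y = a := by
  have end_eq : ∀ {x y}, IndPath G x y A → x = a ∨ x = b := by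
    intro x y q
    by_contra hx
    push Not at hx
    obtain ⟨u, hu, w, hw, huw, hxu, hxw⟩ := p.exists_two_neighbors q.left_mem hx.1 hx.2
    exact huw (q.left_unique hu hw hxu hxw)
  by_cases hxy : x = y
  · subst hxy
    have h := q.eq_singleton
    have ha : a = x := by simpa [h] using p.left_mem
    have hb : b = x := by simpa [h] using p.right_mem
    simp [ha, hb]
  · rcases end_eq q with rfl | rfl <;> rcases end_eq q.reverse with rfl | rfl <;> simp at hxy ⊢

/-- The path `Q` from `q` to `q'` is attached to `C` by its ends only: `q` is joined to `u` and
`u'`, and `q'` is joined to `w` and `w'`. -/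
structure Attachment {V : Type*} (G : SimpleGraph V) (C Q : Set V) (q u u' q' w w' : V) :
    Prop where
  path : IndPath G q q' Q
  disj : Disjoint C Q
  adj_iff : ∀ z ∈ C, ∀ x ∈ Q, G.Adj z x ↔ x = q ∧ (z = u ∨ z = u') ∨ x = q' ∧ (z = w ∨ z = w')

theorem Attachment.symm (h : Attachment G C Q q u u' q' w w') : Attachment G C Q q' w w' q u u' :=
  ⟨h.path.reverse, h.disj, fun z hz x hx => by rw [h.adj_iff z hz x hx, or_comm]⟩

theorem Attachment.adj_left (h : Attachment G C Q q u u' q' w w') (hu : u ∈ C) : G.Adj u q :=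
  (h.adj_iff u hu q h.path.left_mem).2 (Or.inl ⟨rfl, Or.inl rfl⟩)

namespace Arcs

theorem ne_right (h : Arcs G u w A B) (hu' : u' = u ∨ u' ∈ B ∧ G.Adj u u') : u' ≠ w := by
  rintro rfl
  rcases hu' with e | ⟨-, e⟩
  exacts [h.ne e.symm, h.not_adj e]

theorem eq_left_of_mem (h : Arcs G u w A B) (hu' : u' = u ∨ u' ∈ B ∧ G.Adj u u') (hA : u' ∈ A) :
    u' = u := by
  rcases hu' with e | ⟨hB, hadj⟩
  · exact e
  · exact (h.inter u' hA hB).resolve_right (h.ne_right (Or.inr ⟨hB, hadj⟩))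

theorem adj_of_attachment (h : Arcs G u w A B) (hQ : Attachment G (A ∪ B) Q q u u' q' w w')
    (hu' : u' = u ∨ u' ∈ B ∧ G.Adj u u') (hw' : w' = w ∨ w' ∈ B ∧ G.Adj w w') :
    ∀ z ∈ A, ∀ x ∈ Q, G.Adj z x → z = u ∧ x = q ∨ z = w ∧ x = q' := by
  intro z hz x hx hzx
  rcases (hQ.adj_iff z (Or.inl hz) x hx).1 hzx with ⟨rfl, rfl | rfl⟩ | ⟨rfl, rfl | rfl⟩
  exacts [Or.inl ⟨rfl, rfl⟩, Or.inl ⟨h.eq_left_of_mem hu' hz, rfl⟩, Or.inr ⟨rfl, rfl⟩,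
    Or.inr ⟨h.reverse.eq_left_of_mem hw' hz, rfl⟩]

theorem indSolid (h : Arcs G u w A B) (hQ : Attachment G (A ∪ B) Q q u u' q' w w')
    (hu' : u' = u ∨ u' ∈ B ∧ G.Adj u u') (hw' : w' = w ∨ w' ∈ B ∧ G.Adj w w')
    (hshape : w' = w ∨ u' ≠ u ∧ q ≠ q' ∧ u' ≠ w') : IndSolid G (A ∪ B ∪ Q) := by
  obtain ⟨c, d, pB, -, hc, -, hd⟩ :=
    h.pathB.exists_sdiff_sharedEnds False False h.ne fun _ _ => h.not_adj
  obtain ⟨huc, hc⟩ := hc id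
  obtain ⟨hwd, hd⟩ := hd id
  have hB : ∀ z ∈ B \ sharedEnds False False u w, z ∈ A ∪ B ∧ z ≠ u ∧ z ≠ w := fun z hz =>
    ⟨Or.inr hz.1, fun e => hz.2 (Or.inl ⟨id, e⟩), fun e => hz.2 (Or.inr ⟨id, e⟩)⟩
  have hcu' : u' ≠ u → u' = c := fun hne => hc _ (hu'.resolve_left hne).1 (hu'.resolve_left hne).2
  have hdw' : w' ≠ w → w' = d := fun hne => hd _ (hw'.resolve_left hne).1 (hw'.resolve_left hne).2
  have hset : A ∪ B ∪ Q = A ∪ B \ sharedEnds False False u w ∪ Q := by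
    have hends : sharedEnds False False u w ⊆ A :=
      sharedEnds_subset h.pathA.left_mem h.pathA.right_mem
    ext z
    have := @hends z
    simp only [Set.mem_union, Set.mem_sdiff]
    tauto
  refine Or.inr ⟨u' ≠ u, w' ≠ w, u, w, A, c, d, _, q, q', Q, hset, h.pathA, pB, hQ.path, ?_,
    hQ.disj.mono_left Set.subset_union_left, hQ.disj.mono_left fun z hz => (hB z hz).1, h.ne,
    huc, hwd, hQ.adj_left (Or.inl h.pathA.left_mem),
    hQ.symm.adj_left (Or.inl h.pathA.right_mem), ?_, h.adj_of_attachment hQ hu' hw', ?_, ?_⟩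
  · exact Set.disjoint_left.2 fun z hzA hz =>
      (h.inter z hzA hz.1).elim (hB z hz).2.1 (hB z hz).2.2
  · intro x hx y hy hxy
    rcases h.adj x hx y hy.1 hxy with rfl | rfl | rfl | rfl
    exacts [Or.inl ⟨rfl, hc y hy.1 hxy⟩, Or.inr ⟨rfl, hd y hy.1 hxy⟩,
      absurd rfl (hB y hy).2.1, absurd rfl (hB y hy).2.2]
  · intro z hz x hx
    obtain ⟨hzAB, hzu, hzw⟩ := hB z hz
    rw [hQ.adj_iff z hzAB x hx]
    grind
  · by_cases hr : w' = w
    · by_cases hl : u' = u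
      · exact Or.inl ⟨not_not.2 hl, not_not.2 hr, h.not_adj⟩
      · exact Or.inr (Or.inl ⟨hl, not_not.2 hr⟩)
    · obtain ⟨hl, hqq', huw'⟩ := hshape.resolve_left hr
      exact Or.inr (Or.inr ⟨hl, hr, hcu' hl ▸ hdw' hr ▸ huw', hqq'⟩)

/-- The edges `u u'` and `w w'` of the prism separate the cycle `A ∪ B` into the arcs `A - w` and
`B - u`. -/
theorem indSolid_of_crossing (h : Arcs G u w A B) (hQ : Attachment G (A ∪ B) Q q u u' q' w w')
    (hu' : u' ∈ B) (huu' : G.Adj u u') (hw' : w' ∈ A) (hww' : G.Adj w w') (hqq' : q ≠ q') :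
    IndSolid G (A ∪ B ∪ Q) := by
  obtain ⟨c, pB', huc, hc⟩ := h.pathB.trim_left h.ne
  obtain ⟨d, pA', hwd, hd⟩ := h.pathA.trim_right h.ne
  obtain rfl := hc u' hu' huu'
  obtain rfl := hd w' hw' hww'
  have huw' : w' ≠ u := h.swap.reverse.ne_right (Or.inr ⟨hw', hww'⟩)
  have hu'w : u' ≠ w := h.ne_right (Or.inr ⟨hu', huu'⟩)
  have hu'A : u' ∉ A := fun h' => (h.inter _ h' hu').elim huu'.ne' hu'w
  have hw'B : w' ∉ B := fun h' => (h.inter _ hw' h').elim huw' hww'.ne'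
  have hset : A ∪ B ∪ Q = A \ {w} ∪ B \ {u} ∪ Q := by
    have huA := h.pathA.left_mem
    have hwB := h.pathB.right_mem
    have hne := h.ne
    ext z
    simp only [Set.mem_union, Set.mem_sdiff, Set.mem_singleton_iff]
    grind
  refine Or.inr ⟨True, True, u, w', _, u', w, _, q, q', Q, hset, pA', pB', hQ.path, ?_,
    hQ.disj.mono_left fun z hz => Or.inl hz.1, hQ.disj.mono_left fun z hz => Or.inr hz.1,
    huw'.symm, huu', hww'.symm, hQ.adj_left (Or.inl h.pathA.left_mem),
    (hQ.adj_iff w' (Or.inl hw') q' hQ.path.right_mem).2 (by simp), ?_, ?_, ?_,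
    Or.inr (Or.inr ⟨trivial, trivial, hu'w, hqq'⟩)⟩
  · rw [Set.disjoint_left]
    rintro z ⟨hzA, hzw⟩ ⟨hzB, hzu⟩
    exact (h.inter z hzA hzB).elim hzu hzw
  · rintro x ⟨hx, hxw⟩ y ⟨hy, hyu⟩ hxy
    rcases h.adj x hx y hy hxy with rfl | rfl | rfl | rfl
    exacts [Or.inl ⟨rfl, hc y hy hxy⟩, absurd rfl hxw, absurd rfl hyu,
      Or.inr ⟨hd x hx hxy.symm, rfl⟩]
  · rintro z ⟨hz, hzw : z ≠ w⟩ x hx hzx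
    have := (hQ.adj_iff z (Or.inl hz) x hx).1 hzx
    grind
  · rintro z ⟨hz, hzu : z ≠ u⟩ x hx
    rw [hQ.adj_iff z (Or.inr hz) x hx]
    grind

end Arcs

theorem Attachment.indSolid (hQ : Attachment G C Q q u u' q' w w') (hC : IndCycle G C)
    (hu : u ∈ C) (hw : w ∈ C) (hne : u ≠ w) (huw : ¬G.Adj u w)
    (hu' : u' = u ∨ u' ∈ C ∧ G.Adj u u') (hw' : w' = w ∨ w' ∈ C ∧ G.Adj w w')
    (hqq' : u' ≠ u → w' ≠ w → q ≠ q' ∧ u' ≠ w') : IndSolid G (C ∪ Q) := by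
  obtain ⟨A, B, hAB, rfl⟩ := hC.exists_arcs hu hw hne huw
  have hcomm := Set.union_comm A B
  by_cases hw_eq : w' = w
  · rcases hu' with e | ⟨huA | huB, huu'⟩
    · exact hAB.indSolid hQ (Or.inl e) (Or.inl hw_eq) (Or.inl hw_eq)
    · rw [hcomm] at hQ ⊢
      exact hAB.swap.indSolid hQ (Or.inr ⟨huA, huu'⟩) (Or.inl hw_eq) (Or.inl hw_eq)
    · exact hAB.indSolid hQ (Or.inr ⟨huB, huu'⟩) (Or.inl hw_eq) (Or.inl hw_eq)
  obtain ⟨hwm, hww'⟩ := hw'.resolve_left hw_eq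
  by_cases hu_eq : u' = u
  · rcases hwm with hwA | hwB
    · rw [hcomm] at hQ ⊢
      exact hAB.swap.reverse.indSolid hQ.symm (Or.inr ⟨hwA, hww'⟩) (Or.inl hu_eq) (Or.inl hu_eq)
    · exact hAB.reverse.indSolid hQ.symm (Or.inr ⟨hwB, hww'⟩) (Or.inl hu_eq) (Or.inl hu_eq)
  obtain ⟨hum, huu'⟩ := hu'.resolve_left hu_eq
  have hshape := hqq' hu_eq hw_eq
  rcases hwm with hwA | hwB <;> rcases hum with huA | huB
  · rw [hcomm] at hQ ⊢
    exact hAB.swap.indSolid hQ (Or.inr ⟨huA, huu'⟩) (Or.inr ⟨hwA, hww'⟩) (Or.inr ⟨hu_eq, hshape⟩)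
  · exact hAB.indSolid_of_crossing hQ huB huu' hwA hww' hshape.1
  · rw [hcomm] at hQ ⊢
    exact hAB.swap.indSolid_of_crossing hQ huA huu' hwB hww' hshape.1
  · exact hAB.indSolid hQ (Or.inr ⟨huB, huu'⟩) (Or.inr ⟨hwB, hww'⟩) (Or.inr ⟨hu_eq, hshape⟩)

/-- A `MinSpread` pair with a choice of two nonadjacent vertices `u`, `w` of the cycle and of
neighbours `q`, `q'` of them in `Q`, which are then the ends of the induced path `Q`; here
`q ≠ q'`. -/
structure SpreadPath {V : Type*} (G : SimpleGraph V) (C Q : Set V) (u w q q' : V) : Prop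
    extends MinSpread G C Q where
  left_mem : u ∈ C
  right_mem : w ∈ C
  ne : u ≠ w
  not_adj : ¬G.Adj u w
  path : IndPath G q q' Q
  adj_left : G.Adj q u
  adj_right : G.Adj q' w
  ends_ne : q ≠ q'

namespace MinSpread

theorem indPath (h : MinSpread G C Q) (hu : u ∈ C) (hw : w ∈ C) (hne : u ≠ w) (huw : ¬G.Adj u w)
    (hq : q ∈ Q) (hq' : q' ∈ Q) (hqu : G.Adj q u) (hqw : G.Adj q' w) : IndPath G q q' Q := by
  obtain ⟨S, hS, p⟩ := h.conn.exists_indPath hq hq'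
  rwa [h.min S hS p.conn ⟨u, hu, w, hw, hne, huw, ⟨q, p.left_mem, hqu⟩,
    ⟨q', p.right_mem, hqw⟩⟩] at p

theorem eq_or_adj_or_ends (h : MinSpread G C Q) (p : IndPath G q q' Q) (hu : u ∈ C) (hw : w ∈ C)
    (hx : x ∈ Q) (hy : y ∈ Q) (hxu : G.Adj x u) (hyw : G.Adj y w) :
    (u = w ∨ G.Adj u w) ∨ x = q ∧ y = q' ∨ x = q' ∧ y = q := by
  by_contra! hcon
  obtain ⟨⟨hne, huw⟩, hends⟩ := hcon
  rcases p.ends_unique (h.indPath hu hw hne huw hx hy hxu hyw) with ⟨hxq, hyq⟩ | ⟨hxq, hyq⟩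
  exacts [hends.1 hxq hyq, hends.2 hxq hyq]

theorem indSolid_of_singleton (h : MinSpread G C {q}) : IndSolid G (C ∪ {q}) := by
  obtain ⟨u, hu, w, hw, hne, huw, ⟨x, hx, hqu⟩, ⟨y, hy, hqw⟩⟩ := h.spread
  rw [Set.mem_singleton_iff.1 hx] at hqu
  rw [Set.mem_singleton_iff.1 hy] at hqw
  have hqC : q ∉ C := fun hq => Set.disjoint_left.1 h.disj hq rfl
  by_cases hthird : ∃ z ∈ C, z ≠ u ∧ z ≠ w ∧ G.Adj q z
  · obtain ⟨z, hz, hzu, hzw, hqz⟩ := hthird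
    exact Or.inl ⟨C, q, h.cyc, hqC, Set.union_singleton, u, hu, w, hw, z, hz, hne, hzu.symm,
      hzw.symm, hqu, hqw, hqz⟩
  · have hQ : Attachment G C {q} q u u q w w := by
      refine ⟨.single q, h.disj, ?_⟩
      rintro z hz _ rfl
      simp only [true_and, or_self]
      refine ⟨fun hzq => ?_, ?_⟩
      · by_contra! hcon
        exact hthird ⟨z, hz, hcon.1, hcon.2, hzq.symm⟩
      · rintro (rfl | rfl)
        exacts [hqu.symm, hqw.symm]
    exact hQ.indSolid h.cyc hu hw hne huw (Or.inl rfl) (Or.inl rfl) fun hu' => absurd rfl hu'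

end MinSpread

namespace SpreadPath

theorem symm (h : SpreadPath G C Q u w q q') : SpreadPath G C Q w u q' q where
  toMinSpread := h.toMinSpread
  left_mem := h.right_mem
  right_mem := h.left_mem
  ne := h.ne.symm
  not_adj hwu := h.not_adj hwu.symm
  path := h.path.reverse
  adj_left := h.adj_right
  adj_right := h.adj_left
  ends_ne := h.ends_ne.symm

theorem eq_or_adj_left (h : SpreadPath G C Q u w q q') {z : V} (hz : z ∈ C) (hx : x ∈ Q)
    (hxz : G.Adj x z) (hxq : x ≠ q') : z = u ∨ G.Adj z u := by
  rcases h.eq_or_adj_or_ends h.path hz h.left_mem hx h.path.left_mem hxz h.adj_left with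
    h' | h' | h'
  exacts [h', absurd h'.2 h.ends_ne, absurd h'.1 hxq]

theorem adj_ends (h : SpreadPath G C Q u w q q') {z : V} (hz : z ∈ C) (hx : x ∈ Q) (hy : y ∈ Q)
    (hxz : G.Adj x z) (hyz : G.Adj y z) (hxq : x ≠ q') (hyq : y ≠ q) :
    G.Adj z u ∧ G.Adj z w := by
  have hl := h.eq_or_adj_left hz hx hxz hxq
  have hr := h.symm.eq_or_adj_left hz hy hyz hyq
  have hzu : G.Adj z u := hl.resolve_left fun e => (e ▸ hr).elim h.ne h.not_adj
  exact ⟨hzu, hr.resolve_left fun e => h.not_adj (e ▸ hzu).symm⟩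

theorem indPyramid_of_common_neighbor (h : SpreadPath G C Q u w q q') (hc : c ∈ C)
    (hcu : G.Adj c u) (hcw : G.Adj c w) (hatt : Attaches G Q c)
    (hall : ∀ z ∈ C, Attaches G Q z → z = u ∨ z = c ∨ z = w) : IndPyramid G (C ∪ Q) := by
  obtain ⟨x, hx, hxc⟩ := hatt
  obtain ⟨e, f, hce⟩ := h.cyc.indCycleAt hc
  have p : IndPath G u w (C \ {c}) := by
    rcases hce.adj u ⟨h.left_mem, hcu.ne'⟩ hcu with rfl | rfl <;>
      rcases hce.adj w ⟨h.right_mem, hcw.ne'⟩ hcw with rfl | rfl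
    exacts [absurd rfl h.ne, hce.path, hce.path.reverse, absurd rfl h.ne]
  have hcQ : c ∉ Q := Set.disjoint_left.1 h.disj hc
  refine ⟨C \ {c} ∪ Q, c, indCycle_of_paths p h.path (h.disj.mono_left Set.sdiff_subset) h.ne
    h.adj_left.symm h.adj_right.symm ?_, fun hcon => hcon.elim (fun hcC => hcC.2 rfl) hcQ, ?_, u,
    Or.inl p.left_mem, w, Or.inl p.right_mem, x, Or.inr hx, h.ne, h.disj.ne_of_mem h.left_mem hx,
    h.disj.ne_of_mem h.right_mem hx, hcu, hcw, hxc.symm⟩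
  · rintro z ⟨hz, hzc⟩ y hy hzy
    rcases hall z hz ⟨y, hy, hzy.symm⟩ with rfl | rfl | rfl
    · refine Or.inl ⟨rfl, ?_⟩
      by_contra hyq
      exact (h.symm.eq_or_adj_left hz hy hzy.symm hyq).elim h.ne h.not_adj
    · exact absurd rfl hzc
    · refine Or.inr ⟨rfl, ?_⟩
      by_contra hyq
      exact (h.eq_or_adj_left hz hy hzy.symm hyq).elim h.ne.symm fun hwu => h.not_adj hwu.symm
  · rw [← Set.insert_union, Set.insert_sdiff_self_of_mem hc]

theorem indPyramid_of_dominating (h : SpreadPath G C Q u w q q') (hc : c ∈ C)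
    (hcu : G.Adj c u) (hcw : G.Adj c w) (hatt : Attaches G Q c)
    (hall : ∀ z ∈ C, Attaches G Q z → c = z ∨ G.Adj c z) : IndPyramid G (C ∪ Q) := by
  refine h.indPyramid_of_common_neighbor hc hcu hcw hatt fun z hz hzQ => ?_
  by_contra! hcon
  exact h.cyc.no_three_neighbors hc h.left_mem h.right_mem hz h.ne hcon.1.symm hcon.2.2.symm hcu
    hcw ((hall z hz hzQ).resolve_left hcon.2.1.symm)

theorem eq_left_or_eq_right (h : SpreadPath G C Q u w q q') (hpyr : ¬IndPyramid G (C ∪ Q)) {z : V}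
    (hz : z ∈ C) (hx : x ∈ Q) (hxz : G.Adj x z) : x = q ∨ x = q' := by
  by_contra! hcon
  obtain ⟨hzu, hzw⟩ := h.adj_ends hz hx hx hxz hxz hcon.2 hcon.1
  refine hpyr (h.indPyramid_of_dominating hz hzu hzw ⟨x, hx, hxz⟩ ?_)
  rintro z' hz' ⟨y, hy, hyz'⟩
  rcases h.eq_or_adj_or_ends h.path hz hz' hx hy hxz hyz' with h' | h' | h'
  exacts [h', absurd h'.1 hcon.1, absurd h'.1 hcon.2]

theorem not_adj_both_ends (h : SpreadPath G C Q u w q q') (hpyr : ¬IndPyramid G (C ∪ Q)) {z : V}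
    (hz : z ∈ C) (hqz : G.Adj q z) : ¬G.Adj q' z := by
  intro hqz'
  have hq := h.path.left_mem
  have hq' := h.path.right_mem
  obtain ⟨hzu, hzw⟩ := h.adj_ends hz hq hq' hqz hqz' h.ends_ne h.ends_ne.symm
  refine hpyr (h.indPyramid_of_dominating hz hzu hzw ⟨q, hq, hqz⟩ ?_)
  rintro z' hz' ⟨y, hy, hyz'⟩
  rcases h.eq_left_or_eq_right hpyr hz' hy hyz' with rfl | rfl
  · rcases h.eq_or_adj_or_ends h.path hz hz' hq hq hqz hyz' with h' | h' | h'
    exacts [h', absurd h'.2 h.ends_ne, absurd h'.1 h.ends_ne]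
  · rcases h.eq_or_adj_or_ends h.path hz hz' hq' hq' hqz' hyz' with h' | h' | h'
    exacts [h', absurd h'.1.symm h.ends_ne, absurd h'.2.symm h.ends_ne]

theorem exists_adj_left_iff (h : SpreadPath G C Q u w q q') :
    ∃ u', (u' = u ∨ u' ∈ C ∧ G.Adj u u') ∧ ∀ z ∈ C, G.Adj q z ↔ z = u ∨ z = u' := by
  have hq := h.path.left_mem
  by_cases hsecond : ∃ u' ∈ C, u' ≠ u ∧ G.Adj q u'
  · obtain ⟨u', hu', hne, hqu'⟩ := hsecond
    have huu' := ((h.eq_or_adj_left hu' hq hqu' h.ends_ne).resolve_left hne).symm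
    refine ⟨u', Or.inr ⟨hu', huu'⟩, fun z hz => ⟨fun hqz => ?_, ?_⟩⟩
    · by_contra! hcon
      have huz := ((h.eq_or_adj_left hz hq hqz h.ends_ne).resolve_left hcon.1).symm
      have hzu' : G.Adj u' z := by
        rcases h.eq_or_adj_or_ends h.path hu' hz hq hq hqu' hqz with h' | h' | h'
        exacts [h'.resolve_left hcon.2.symm, absurd h'.2 h.ends_ne, absurd h'.1 h.ends_ne]
      -- then `C` would be the triangle `u u' z`, but `u` and `w` are not adjacent
      have hw := h.right_mem
      rw [h.cyc.eq_triangle h.left_mem hu' hz huu' huz hzu'] at hw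
      rcases hw with rfl | rfl | rfl
      exacts [h.ne rfl, h.not_adj huu', h.not_adj huz]
    · rintro (rfl | rfl)
      exacts [h.adj_left, hqu']
  · push Not at hsecond
    refine ⟨u, Or.inl rfl, fun z hz => ⟨fun hqz => ?_, ?_⟩⟩
    · by_contra hcon
      exact hsecond z hz (fun e => hcon (Or.inl e)) hqz
    · rintro (rfl | rfl) <;> exact h.adj_left

theorem indSolid (h : SpreadPath G C Q u w q q') : IndSolid G (C ∪ Q) := by
  by_cases hpyr : IndPyramid G (C ∪ Q)
  · exact Or.inl hpyr
  obtain ⟨u', hu', hqu'⟩ := h.exists_adj_left_iff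
  obtain ⟨w', hw', hqw'⟩ := h.symm.exists_adj_left_iff
  have hQ : Attachment G C Q q u u' q' w w' := by
    refine ⟨h.path, h.disj, fun z hz x hx => ⟨fun hzx => ?_, ?_⟩⟩
    · rcases h.eq_left_or_eq_right hpyr hz hx hzx.symm with rfl | rfl
      exacts [Or.inl ⟨rfl, (hqu' z hz).1 hzx.symm⟩, Or.inr ⟨rfl, (hqw' z hz).1 hzx.symm⟩]
    · rintro (⟨rfl, h'⟩ | ⟨rfl, h'⟩)
      exacts [((hqu' z hz).2 h').symm, ((hqw' z hz).2 h').symm]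
  refine hQ.indSolid h.cyc h.left_mem h.right_mem h.ne h.not_adj hu' hw' fun hne _ =>
    ⟨h.ends_ne, ?_⟩
  rintro rfl
  have huC := (hu'.resolve_left hne).1
  exact h.not_adj_both_ends hpyr huC ((hqu' u' huC).2 (Or.inr rfl)) ((hqw' u' huC).2 (Or.inr rfl))

end SpreadPath

theorem MinSpread.indSolid (h : MinSpread G C Q) : IndSolid G (C ∪ Q) := by
  obtain ⟨u, hu, w, hw, hne, huw, ⟨q, hq, hqu⟩, ⟨q', hq', hqw⟩⟩ := h.spread
  have p := h.indPath hu hw hne huw hq hq' hqu hqw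
  by_cases hqq : q = q'
  · subst hqq
    obtain rfl := p.eq_singleton
    exact h.indSolid_of_singleton
  · exact SpreadPath.indSolid ⟨h, hu, hw, hne, huw, p, hqu, hqw, hqq⟩

end Spread

/-- The neighbourhood of `v` is the union of those of the adjacent vertices `x` and `y`, so that
`v` arises from contracting `xy`. -/
structure Merges {V : Type*} (G : SimpleGraph V) (v x y : V) : Prop where
  adj_left_right : G.Adj x y
  ne_left : v ≠ x
  ne_right : v ≠ y
  adj_iff : ∀ b, b ≠ x → b ≠ y → (G.Adj v b ↔ G.Adj x b ∨ G.Adj y b)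

/-- The sets that become `insert v A` when `x` and `y` are merged to `v`, for `A` containing neither
of them. -/
def splits {V : Type*} (x y : V) (A : Set V) : Set (Set V) :=
  {insert x A, insert y A, insert x (insert y A)}

section Merges

variable {V : Type*} {G : SimpleGraph V} {a b c p q r u v w x y : V} {A C C' Q Q' S T : Set V}

theorem Merges.symm (h : Merges G v x y) : Merges G v y x :=
  ⟨h.adj_left_right.symm, h.ne_right, h.ne_left,
    fun b hby hbx => (h.adj_iff b hbx hby).trans or_comm⟩

theorem splits_comm : splits x y A = splits y x A := by
  rw [splits, splits, Set.insert_comm x y A, Set.insert_comm]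

theorem mem_splits (hx : x ∉ A) (hy : y ∉ A) (hxy : x ∈ T ∨ y ∈ T)
    (hT : ∀ u, u ≠ x → u ≠ y → (u ∈ T ↔ u ∈ A)) : T ∈ splits x y A := by
  have heq : ∀ {B : Set V}, (x ∈ T ↔ x ∈ B) → (y ∈ T ↔ y ∈ B) →
      (∀ u, u ≠ x → u ≠ y → (u ∈ A ↔ u ∈ B)) → T = B := by
    intro B hxB hyB hAB
    ext u
    by_cases hux : u = x
    · rwa [hux]
    by_cases huy : u = y
    · rwa [huy]
    exact (hT u hux huy).trans (hAB u hux huy)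
  by_cases hxT : x ∈ T <;> by_cases hyT : y ∈ T
  · exact Or.inr (Or.inr (heq (by simp [hxT]) (by simp [hyT]) (by grind)))
  · have hyx : y ≠ x := fun e => hyT (e ▸ hxT)
    exact Or.inl (heq (by simp [hxT]) (by simp [hyT, hyx, hy]) (by grind))
  · have hxy : x ≠ y := fun e => hxT (e ▸ hyT)
    exact Or.inr (Or.inl (heq (by simp [hxT, hxy, hx]) (by simp [hyT]) (by grind)))
  · exact absurd hxy (not_or.2 ⟨hxT, hyT⟩)

theorem Spread.mono (h : Spread G C Q) (hC : C ⊆ C') (hQ : Q ⊆ Q') : Spread G C' Q' := by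
  obtain ⟨u, hu, w, hw, huw, hadj, huQ, hwQ⟩ := h
  exact ⟨u, hC hu, w, hC hw, huw, hadj, huQ.mono hQ, hwQ.mono hQ⟩

theorem Spread.of_forall_attaches (h : Spread G C Q)
    (hatt : ∀ u ∈ C, Attaches G Q u → u ∈ C' ∧ Attaches G Q' u) : Spread G C' Q' := by
  obtain ⟨u, hu, w, hw, huw, hadj, huQ, hwQ⟩ := h
  obtain ⟨hu', huQ'⟩ := hatt u hu huQ
  obtain ⟨hw', hwQ'⟩ := hatt w hw hwQ
  exact ⟨u, hu', w, hw', huw, hadj, huQ', hwQ'⟩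

theorem Spread.sdiff_singleton_or (h : Spread G C Q) (v : V) :
    Spread G (C \ {v}) Q ∨
      Attaches G Q v ∧ ∃ w ∈ C, w ≠ v ∧ ¬G.Adj v w ∧ Attaches G Q w := by
  obtain ⟨u, hu, w, hw, huw, hadj, huQ, hwQ⟩ := h
  by_cases huv : u = v
  · subst huv
    exact Or.inr ⟨huQ, w, hw, huw.symm, hadj, hwQ⟩
  by_cases hwv : w = v
  · subst hwv
    exact Or.inr ⟨hwQ, u, hu, huw, fun hwu => hadj hwu.symm, huQ⟩
  · exact Or.inl ⟨u, ⟨hu, huv⟩, w, ⟨hw, hwv⟩, huw, hadj, huQ, hwQ⟩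

theorem IndSolid.replace (h : IndSolid G S) (hv : v ∈ S) (hx : x ∉ S)
    (hadj : ∀ b ∈ S, b ≠ v → (G.Adj v b ↔ G.Adj x b)) : IndSolid G (insert x (S \ {v})) := by
  classical
  have hswap : ∀ u ∈ S, u ≠ v → Equiv.swap v x u = u := fun u hu huv =>
    Equiv.swap_apply_of_ne_of_ne huv fun e => hx (e ▸ hu)
  have himg : Equiv.swap v x '' S = insert x (S \ {v}) := by
    rw [← Set.insert_sdiff_self_of_mem hv, Set.image_insert_eq, Equiv.swap_apply_left,
      Set.insert_sdiff_self_of_mem hv,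
      Set.image_congr (g := id) fun u hu => hswap u hu.1 hu.2, Set.image_id]
  rw [← himg]
  refine h.image (Equiv.swap v x).injective.injOn fun u hu w hw => ?_
  by_cases huv : u = v <;> by_cases hwv : w = v
  · simp [huv, hwv]
  · rw [hswap w hw hwv, huv, Equiv.swap_apply_left, hadj w hw hwv]
  · rw [hswap u hu huv, hwv, Equiv.swap_apply_left, G.adj_comm, hadj u hu huv, G.adj_comm]
  · rw [hswap u hu huv, hswap w hw hwv]

theorem Merges.indSolid_insert_left (h : Merges G v x y) (hS : IndSolid G S) (hv : v ∈ S)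
    (hx : x ∉ S) (hy : y ∉ S) (hdom : ∀ b ∈ S, G.Adj v b → G.Adj x b) :
    IndSolid G (insert x (S \ {v})) :=
  hS.replace hv hx fun b hb _ => ⟨hdom b hb, fun hxb =>
    (h.adj_iff b (fun e => hx (e ▸ hb)) fun e => hy (e ▸ hb)).2 (Or.inl hxb)⟩

theorem indPath_pair (h : G.Adj a b) : IndPath G a b {a, b} :=
  .cons h (by simpa using h.ne) (by simp) (.single b)

theorem Merges.indSolid_of_triangle (h : Merges G v x y) (hpq : G.Adj p q) (hpr : G.Adj p r)
    (hqr : G.Adj q r) (hv : ∀ u ∈ ({p, q, r} : Set V), G.Adj v u) (hx : x ∉ ({p, q, r} : Set V))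
    (hy : y ∉ ({p, q, r} : Set V)) (hxp : ¬G.Adj x p) (hyq : ¬G.Adj y q) :
    IndSolid G (insert x (insert y {p, q, r})) := by
  have hadj : ∀ u ∈ ({p, q, r} : Set V), G.Adj x u ∨ G.Adj y u := fun u hu =>
    (h.adj_iff u (fun e => hx (e ▸ hu)) fun e => hy (e ▸ hu)).1 (hv u hu)
  have hyp : G.Adj y p := (hadj p (by simp)).resolve_left hxp
  have hxq : G.Adj x q := (hadj q (by simp)).resolve_right hyq
  simp only [Set.mem_insert_iff, Set.mem_singleton_iff, not_or] at hx hy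
  have hC : IndCycle G ({q, p} ∪ {x, y}) := by
    refine indCycle_of_paths (indPath_pair hpq.symm) (indPath_pair h.adj_left_right) ?_ hpq.ne'
      hxq.symm hyp.symm ?_
    · simp [hx, hy]
    · have hqy : ¬G.Adj q y := fun hqy => hyq hqy.symm
      have hpx : ¬G.Adj p x := fun hpx => hxp hpx.symm
      rintro u (rfl | rfl) w (rfl | rfl) huw <;> simp_all
  refine Or.inl ⟨_, r, hC, ?_, ?_, ?_⟩
  · simp [hpr.ne', hqr.ne', Ne.symm hx.2.2, Ne.symm hy.2.2]
  · ext u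
    simp only [Set.mem_insert_iff, Set.mem_union, Set.mem_singleton_iff]
    tauto
  · rcases hadj r (by simp) with hxr | hyr
    · exact ⟨p, by simp, q, by simp, x, by simp, hpq.ne, Ne.symm hx.1, Ne.symm hx.2.1, hpr.symm,
        hqr.symm, hxr.symm⟩
    · exact ⟨p, by simp, q, by simp, y, by simp, hpq.ne, Ne.symm hy.1, Ne.symm hy.2.1, hpr.symm,
        hqr.symm, hyr.symm⟩

theorem Merges.indSolid_of_indK4 (h : Merges G v x y) (hS : IndK4 G S) (hv : v ∈ S) (hx : x ∉ S)
    (hy : y ∉ S) (hp : p ∈ S) (hvp : G.Adj v p) (hxp : ¬G.Adj x p) (hq : q ∈ S) (hvq : G.Adj v q)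
    (hyq : ¬G.Adj y q) : IndSolid G (insert x (insert y (S \ {v}))) := by
  obtain ⟨hclique, hcard⟩ := hS
  have hxq : G.Adj x q :=
    ((h.adj_iff q (fun e => hx (e ▸ hq)) fun e => hy (e ▸ hq)).1 hvq).resolve_right hyq
  have hpq : p ≠ q := fun e => hxp (e ▸ hxq)
  have hsub : {v, p, q} ⊆ S := by
    rintro u (rfl | rfl | rfl) <;> assumption
  obtain ⟨r, hr⟩ : ∃ r, S \ {v, p, q} = {r} := by
    rw [← Set.ncard_eq_one, Set.ncard_sdiff hsub, hcard,
      Set.ncard_eq_three.2 ⟨v, p, q, hvp.ne, hvq.ne, hpq, rfl⟩]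
  have hrS : r ∈ S \ {v, p, q} := hr ▸ rfl
  simp only [Set.mem_sdiff, Set.mem_insert_iff, Set.mem_singleton_iff, not_or] at hrS
  obtain ⟨hrS, -, hrp, hrq⟩ := hrS
  have hset : S \ {v} = {p, q, r} := by
    ext u
    have := Set.ext_iff.1 hr u
    simp only [Set.mem_sdiff, Set.mem_insert_iff, Set.mem_singleton_iff] at this ⊢
    grind [hvp.ne, hvq.ne]
  have hmem : ∀ u ∈ ({p, q, r} : Set V), u ∈ S ∧ u ≠ v := fun u hu => hset.symm.subset hu
  rw [hset]
  exact h.indSolid_of_triangle (hclique hp hq hpq) (hclique hp hrS (Ne.symm hrp))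
    (hclique hq hrS (Ne.symm hrq)) (fun u hu => hclique hv (hmem u hu).1 (hmem u hu).2.symm)
    (fun hx' => hx (hmem x hx').1) (fun hy' => hy (hmem y hy').1) hxp hyq

open Classical in
/-- The map that merges `x` and `y` to `v`. -/
noncomputable def mergeMap (v x y u : V) : V := if u = x ∨ u = y then v else u

theorem mergeMap_left : mergeMap v x y x = v := if_pos (Or.inl rfl)

theorem mergeMap_right : mergeMap v x y y = v := if_pos (Or.inr rfl)

theorem mergeMap_of_ne (hx : u ≠ x) (hy : u ≠ y) : mergeMap v x y u = u := if_neg (by tauto)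

theorem eq_or_of_mergeMap_eq (hu : u ≠ v) (hw : w ≠ v)
    (h : mergeMap v x y u = mergeMap v x y w) : u = w ∨ (u = x ∨ u = y) ∧ (w = x ∨ w = y) := by
  unfold mergeMap at h
  split_ifs at h with hu' hw' hw'
  exacts [Or.inr ⟨hu', hw'⟩, absurd h.symm hw, absurd h hu, Or.inl h]

theorem mem_of_mem_image_mergeMap (hu : u ∈ mergeMap v x y '' T) (huv : u ≠ v) : u ∈ T := by
  obtain ⟨w, hw, rfl⟩ := hu
  by_cases hwxy : w = x ∨ w = y
  · exact absurd (if_pos hwxy) huv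
  · rwa [mergeMap, if_neg hwxy]

theorem left_mem_or_right_mem_of_mem_image_mergeMap (hT : v ∉ T) (hv : v ∈ mergeMap v x y '' T) :
    x ∈ T ∨ y ∈ T := by
  obtain ⟨w, hw, e⟩ := hv
  by_cases hwxy : w = x ∨ w = y
  · exact hwxy.imp (fun e : w = x => e ▸ hw) fun e : w = y => e ▸ hw
  · rw [mergeMap, if_neg hwxy] at e
    exact absurd (e ▸ hw) hT

theorem mapsTo_mergeMap (hv : v ∈ Q) (hx : x ∉ Q) (hy : y ∉ Q) :
    Set.MapsTo (mergeMap v x y) (insert x (insert y (Q \ {v}))) Q := by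
  rintro u (rfl | rfl | ⟨hu, -⟩)
  · rwa [mergeMap_left]
  · rwa [mergeMap_right]
  · rwa [mergeMap_of_ne (fun e : u = x => hx (e ▸ hu)) fun e : u = y => hy (e ▸ hu)]

theorem Merges.adj_mergeMap (h : Merges G v x y) (hab : G.Adj a b) :
    mergeMap v x y a = mergeMap v x y b ∨ G.Adj (mergeMap v x y a) (mergeMap v x y b) := by
  by_cases ha' : a = x ∨ a = y
  · by_cases hb' : b = x ∨ b = y
    · exact Or.inl (by simp only [mergeMap, ha', hb', if_true])
    · right
      push Not at hb'
      rw [mergeMap_of_ne hb'.1 hb'.2, mergeMap, if_pos ha', h.adj_iff b hb'.1 hb'.2]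
      rcases ha' with rfl | rfl
      exacts [Or.inl hab, Or.inr hab]
  · push Not at ha'
    rw [mergeMap_of_ne ha'.1 ha'.2]
    by_cases hb' : b = x ∨ b = y
    · right
      rw [mergeMap, if_pos hb', G.adj_comm, h.adj_iff a ha'.1 ha'.2]
      rcases hb' with rfl | rfl
      exacts [Or.inl hab.symm, Or.inr hab.symm]
    · push Not at hb'
      rw [mergeMap_of_ne hb'.1 hb'.2]
      exact Or.inr hab

theorem Merges.exists_adj_of_adj (h : Merges G v x y) (hwx : w ≠ x) (hwy : w ≠ y)
    (hvw : G.Adj v w) (T : Set V) :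
    ∃ u ∈ insert x (insert y T), mergeMap v x y u = v ∧ G.Adj u w := by
  rcases (h.adj_iff w hwx hwy).1 hvw with hxw | hyw
  · exact ⟨x, Or.inl rfl, mergeMap_left, hxw⟩
  · exact ⟨y, Or.inr (Or.inl rfl), mergeMap_right, hyw⟩

theorem Merges.conn_split (h : Merges G v x y) (hQ : Conn G Q) (hv : v ∈ Q) (hx : x ∉ Q)
    (hy : y ∉ Q) : Conn G (insert x (insert y (Q \ {v}))) := by
  set Q' : Set V := insert x (insert y (Q \ {v})) with hQ'
  have hne : ∀ u ∈ Q, u ≠ x ∧ u ≠ y := fun u hu => ⟨fun e => hx (e ▸ hu), fun e => hy (e ▸ hu)⟩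
  have hnv : ∀ u ∈ Q', u ≠ v := by
    rintro u (rfl | rfl | hu)
    exacts [h.ne_left.symm, h.ne_right.symm, hu.2]
  refine hQ.of_fibers (mapsTo_mergeMap hv hx hy) ?_ ?_
  · intro u hu w hw huw
    obtain ⟨hux, huy⟩ := hne u hu
    obtain ⟨hwx, hwy⟩ := hne w hw
    by_cases huv : u = v
    · subst huv
      obtain ⟨u', hu', hmap, hadj⟩ := h.exists_adj_of_adj hwx hwy huw (Q \ {u})
      exact ⟨u', hu', w, Or.inr (Or.inr ⟨hw, huw.ne'⟩), hmap, mergeMap_of_ne hwx hwy, hadj⟩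
    by_cases hwv : w = v
    · subst hwv
      obtain ⟨w', hw', hmap, hadj⟩ := h.exists_adj_of_adj hux huy huw.symm (Q \ {w})
      exact ⟨u, Or.inr (Or.inr ⟨hu, huv⟩), w', hw', mergeMap_of_ne hux huy, hmap, hadj.symm⟩
    · exact ⟨u, Or.inr (Or.inr ⟨hu, huv⟩), w, Or.inr (Or.inr ⟨hw, hwv⟩), mergeMap_of_ne hux huy,
        mergeMap_of_ne hwx hwy, huw⟩
  · rintro ⟨u, hu⟩ ⟨w, hw⟩ e
    have hxy : (G.induce Q').Reachable ⟨x, Or.inl rfl⟩ ⟨y, Or.inr (Or.inl rfl)⟩ :=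
      SimpleGraph.Adj.reachable (SimpleGraph.comap_adj.2 h.adj_left_right)
    rcases eq_or_of_mergeMap_eq (hnv u hu) (hnv w hw) e with rfl | ⟨rfl | rfl, rfl | rfl⟩
    exacts [.rfl, .rfl, hxy, hxy.symm, .rfl]

theorem Merges.attaches_split (h : Merges G v x y) (hux : u ≠ x) (huy : u ≠ y)
    (hu : Attaches G Q u) : Attaches G (insert x (insert y (Q \ {v}))) u := by
  obtain ⟨q, hq, hqu⟩ := hu
  by_cases hqv : q = v
  · subst hqv
    obtain ⟨q', hq', -, hadj⟩ := h.exists_adj_of_adj hux huy hqu (Q \ {q})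
    exact ⟨q', hq', hadj⟩
  · exact ⟨q, Or.inr (Or.inr ⟨hq, hqv⟩), hqu⟩

theorem Merges.attaches_image (h : Merges G v x y) (hux : u ≠ x) (huy : u ≠ y)
    (hu : u ∉ mergeMap v x y '' Q) (hQ : Attaches G Q u) : Attaches G (mergeMap v x y '' Q) u := by
  obtain ⟨q, hq, hqu⟩ := hQ
  have hmem : mergeMap v x y q ∈ mergeMap v x y '' Q := ⟨q, hq, rfl⟩
  have hadj := h.adj_mergeMap hqu
  rw [mergeMap_of_ne hux huy] at hadj
  exact ⟨_, hmem, hadj.resolve_left fun e => hu (e ▸ hmem)⟩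

theorem Merges.exists_indSolid_splits_of_mem_right [Finite V] (h : Merges G v x y)
    (hm : MinSpread G C Q) (hv : v ∈ Q) (hx : x ∉ C ∪ Q) (hy : y ∉ C ∪ Q) :
    ∃ T ∈ splits x y ((C ∪ Q) \ {v}), IndSolid G T := by
  have hxQ : x ∉ Q := fun hx' => hx (Or.inr hx')
  have hyQ : y ∉ Q := fun hy' => hy (Or.inr hy')
  have hne : ∀ u ∈ C, u ≠ x ∧ u ≠ y := fun u hu =>
    ⟨fun e => hx (Or.inl (e ▸ hu)), fun e => hy (Or.inl (e ▸ hu))⟩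
  have hdisj : Disjoint C (insert x (insert y (Q \ {v}))) := by
    rw [Set.disjoint_left]
    rintro u hu (e | e | hu')
    exacts [(hne u hu).1 e, (hne u hu).2 e, Set.disjoint_left.1 hm.disj hu hu'.1]
  have hspread : Spread G C (insert x (insert y (Q \ {v}))) :=
    hm.spread.of_forall_attaches fun u hu huQ =>
      ⟨hu, h.attaches_split (hne u hu).1 (hne u hu).2 huQ⟩
  obtain ⟨Q', hsub, hm'⟩ := hspread.exists_min hm.cyc hdisj (h.conn_split hm.conn hv hxQ hyQ)
  have hsubQ : mergeMap v x y '' Q' ⊆ Q :=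
    ((mapsTo_mergeMap hv hxQ hyQ).mono_left hsub).image_subset
  have himg : mergeMap v x y '' Q' = Q :=
    hm.min _ hsubQ (hm'.conn.image fun _ _ _ _ => h.adj_mergeMap) <|
      hm'.spread.of_forall_attaches fun u hu huQ' => ⟨hu, h.attaches_image (hne u hu).1 (hne u hu).2
        (fun hu' => Set.disjoint_left.1 hm.disj hu (hsubQ hu')) huQ'⟩
  have hvQ' : v ∉ Q' := fun hv' => by
    rcases hsub hv' with e | e | hv'
    exacts [h.ne_left e, h.ne_right e, hv'.2 rfl]
  have hvC : v ∉ C := fun hv' => Set.disjoint_left.1 hm.disj hv' hv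
  have hxy := left_mem_or_right_mem_of_mem_image_mergeMap hvQ' (himg ▸ hv)
  refine ⟨_, mem_splits (fun hx' => hx hx'.1) (fun hy' => hy hy'.1) (hxy.imp Or.inr Or.inr)
    fun u hux huy => ⟨?_, ?_⟩, hm'.indSolid⟩
  · rintro (hu | hu)
    · exact ⟨Or.inl hu, fun e => hvC (e ▸ hu)⟩
    · have huQ := ((hsub hu).resolve_left hux).resolve_left huy
      exact ⟨Or.inr huQ.1, huQ.2⟩
  · rintro ⟨hu | hu, huv⟩
    exacts [Or.inl hu, Or.inr (mem_of_mem_image_mergeMap (himg.symm ▸ hu) huv)]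

/-- A `MinSpread` pair in the graph with `x` and `y` merged to `v`, where `v` lies on the cycle,
with neighbours `a` and `b` there, and is clean. -/
structure MergeOnCycle {V : Type*} (G : SimpleGraph V) (v x y : V) (C Q : Set V) (a b : V) : Prop
    extends MinSpread G C Q where
  merges : Merges G v x y
  cleanAt : CleanAt G C Q v
  indCycleAt : IndCycleAt G v a b (C \ {v})
  left_notMem : x ∉ C ∪ Q
  right_notMem : y ∉ C ∪ Q

namespace MergeOnCycle

theorem symm (h : MergeOnCycle G v x y C Q a b) : MergeOnCycle G v y x C Q a b :=
  ⟨h.toMinSpread, h.merges.symm, h.cleanAt, h.indCycleAt, h.right_notMem, h.left_notMem⟩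

theorem reverse (h : MergeOnCycle G v x y C Q a b) : MergeOnCycle G v x y C Q b a :=
  ⟨h.toMinSpread, h.merges, h.cleanAt, h.indCycleAt.symm, h.left_notMem, h.right_notMem⟩

theorem ne_left (h : MergeOnCycle G v x y C Q a b) (hu : u ∈ C ∪ Q) : u ≠ x :=
  fun e => h.left_notMem (e ▸ hu)

theorem adj_iff (h : MergeOnCycle G v x y C Q a b) (hu : u ∈ C ∪ Q) :
    G.Adj v u ↔ G.Adj x u ∨ G.Adj y u :=
  h.merges.adj_iff u (h.ne_left hu) (h.symm.ne_left hu)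

theorem eq_of_adj (h : MergeOnCycle G v x y C Q a b) (hc : c ∈ Q) (hvc : G.Adj v c) (hq : q ∈ Q)
    (hxq : G.Adj x q) : q = c :=
  h.cleanAt.unique q hq c hc ((h.adj_iff (Or.inr hq)).2 (Or.inl hxq)) hvc

theorem not_adj_of_mem (h : MergeOnCycle G v x y C Q a b) (hc : c ∈ Q) (hvc : G.Adj v c)
    (hxc : ¬G.Adj x c) (hq : q ∈ Q) : ¬G.Adj x q := fun hxq =>
  hxc (h.eq_of_adj hc hvc hq hxq ▸ hxq)

theorem eq_or_eq_of_adj (h : MergeOnCycle G v x y C Q a b) (hu : u ∈ C \ {v})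
    (hxu : G.Adj x u) : u = a ∨ u = b :=
  h.indCycleAt.adj u hu ((h.adj_iff (Or.inl hu.1)).2 (Or.inl hxu))

theorem indCycle_insert_left (h : MergeOnCycle G v x y C Q a b) (hxa : G.Adj x a)
    (hxb : G.Adj x b) : IndCycle G (insert x (C \ {v})) :=
  IndCycleAt.indCycle ⟨h.indCycleAt.path, h.indCycleAt.ne, fun hx => h.left_notMem (Or.inl hx.1),
    hxa, hxb, fun _ => h.eq_or_eq_of_adj⟩

theorem disjoint_insert (h : MergeOnCycle G v x y C Q a b) :
    Disjoint (insert x (C \ {v})) (insert y Q) := by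
  rw [Set.disjoint_left]
  rintro u (rfl | hu) (e | hu')
  · exact h.merges.adj_left_right.ne e
  · exact h.left_notMem (Or.inr hu')
  · exact h.symm.ne_left (Or.inl hu.1) e
  · exact Set.disjoint_left.1 h.disj hu.1 hu'

theorem spread_insert (h : MergeOnCycle G v x y C Q a b) :
    Spread G (insert x (C \ {v})) (insert y Q) := by
  rcases h.spread.sdiff_singleton_or v with hsp | ⟨-, w, hw, hwv, hvw, hwQ⟩
  · exact hsp.mono (Set.subset_insert _ _) (Set.subset_insert _ _)
  · exact ⟨x, Or.inl rfl, w, Or.inr ⟨hw, hwv⟩, (h.ne_left (Or.inl hw)).symm,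
      fun hxw => hvw ((h.adj_iff (Or.inl hw)).2 (Or.inl hxw)),
      ⟨y, Or.inl rfl, h.merges.adj_left_right.symm⟩, hwQ.mono (Set.subset_insert _ _)⟩

theorem adj_of_attaches (h : MergeOnCycle G v x y C Q a b) (hc : c ∈ Q) (hvc : G.Adj v c)
    (hxc : ¬G.Adj x c) (hsub : Q' \ {y} ⊆ Q) (hne : Q' \ {y} ≠ Q) (hy : y ∈ Q') (hconn : Conn G Q')
    (hu : u ∈ insert x (C \ {v})) (huQ' : Attaches G Q' u) : G.Adj y u := by
  obtain ⟨q, hq, hqu⟩ := huQ'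
  by_cases hqy : q = y
  · rwa [← hqy]
  have hunique : ∀ t ∈ Q', G.Adj y t → t = c := fun t ht hyt =>
    h.symm.eq_of_adj hc hvc (hsub ⟨ht, hyt.ne'⟩) hyt
  obtain ⟨t, ht, hyt⟩ := hconn.exists_adj hy hq (Ne.symm hqy)
  obtain rfl := hunique t ht hyt
  have hconn' : Conn G (Q' \ {y}) :=
    hconn.sdiff_of_forall_adj_eq ht hyt.ne' fun s hs hsy => hunique s hs hsy.symm
  rcases hu with rfl | hu
  · exact absurd hqu.symm (h.not_adj_of_mem hc hvc hxc (hsub ⟨hq, hqy⟩))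
  · exact absurd (h.cleanAt.att _ hsub hne hconn' ⟨t, ⟨ht, hyt.ne'⟩, hvc.symm⟩ u hu.1
      ⟨q, ⟨hq, hqy⟩, hqu⟩) hu.2

theorem sdiff_singleton_eq (h : MergeOnCycle G v x y C Q a b) (hxa : G.Adj x a)
    (hxb : G.Adj x b) (hyab : ¬(G.Adj y a ∧ G.Adj y b)) (hc : c ∈ Q) (hvc : G.Adj v c)
    (hxc : ¬G.Adj x c) (hsub : Q' ⊆ insert y Q) (hy : y ∈ Q') (hconn : Conn G Q')
    (hspread : Spread G (insert x (C \ {v})) Q') : Q' \ {y} = Q := by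
  by_contra hne
  have hyadj : ∀ u ∈ insert x (C \ {v}), Attaches G Q' u → G.Adj y u := fun u hu =>
    h.adj_of_attaches hc hvc hxc (fun t ht => (hsub ht.1).resolve_left ht.2) hne hy hconn hu
  obtain ⟨u, hu, w, hw, huw, hadj, huQ', hwQ'⟩ := hspread
  have hyu := hyadj u hu huQ'
  have hyw := hyadj w hw hwQ'
  rcases hu with rfl | hu <;> rcases hw with rfl | hw
  · exact huw rfl
  · rcases h.symm.eq_or_eq_of_adj hw hyw with rfl | rfl
    exacts [hadj hxa, hadj hxb]
  · rcases h.symm.eq_or_eq_of_adj hu hyu with rfl | rfl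
    exacts [hadj hxa.symm, hadj hxb.symm]
  · rcases h.symm.eq_or_eq_of_adj hu hyu with rfl | rfl <;>
      rcases h.symm.eq_or_eq_of_adj hw hyw with rfl | rfl
    exacts [huw rfl, hyab ⟨hyu, hyw⟩, hyab ⟨hyw, hyu⟩, huw rfl]

theorem eq_of_subset (h : MergeOnCycle G v x y C Q a b) (hc : c ∈ Q) (hvc : G.Adj v c)
    (hxc : ¬G.Adj x c) (hsub : Q' ⊆ Q) (hconn : Conn G Q')
    (hspread : Spread G (insert x (C \ {v})) Q') : Q' = Q := by
  refine h.min Q' hsub hconn (hspread.of_forall_attaches ?_)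
  rintro u (rfl | hu) huQ'
  · obtain ⟨q, hq, hqu⟩ := huQ'
    exact absurd hqu.symm (h.not_adj_of_mem hc hvc hxc (hsub hq))
  · exact ⟨hu.1, huQ'⟩

/-- Here `x` takes the place of `v` on the cycle. -/
theorem exists_indSolid_splits_of_adj_both [Finite V] (h : MergeOnCycle G v x y C Q a b)
    (hxa : G.Adj x a) (hxb : G.Adj x b) (hyab : ¬(G.Adj y a ∧ G.Adj y b)) (hc : c ∈ Q)
    (hvc : G.Adj v c) (hxc : ¬G.Adj x c) : ∃ T ∈ splits x y ((C ∪ Q) \ {v}), IndSolid G T := by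
  have hyc : G.Adj y c := ((h.adj_iff (Or.inr hc)).1 hvc).resolve_left hxc
  obtain ⟨Q', hsub, hm'⟩ := h.spread_insert.exists_min (h.indCycle_insert_left hxa hxb)
    h.disjoint_insert (h.conn.insert_adj hc hyc)
  have hQ' : ∀ u, u ≠ y → (u ∈ Q' ↔ u ∈ Q) := by
    intro u huy
    by_cases hy : y ∈ Q'
    · rw [← h.sdiff_singleton_eq hxa hxb hyab hc hvc hxc hsub hy hm'.conn hm'.spread]
      simp [huy]
    · rw [h.eq_of_subset hc hvc hxc
        (fun t ht => (hsub ht).resolve_left fun e => hy (e ▸ ht)) hm'.conn hm'.spread]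
  have hvQ : ∀ u ∈ Q, u ≠ v := fun u hu e =>
    Set.disjoint_left.1 h.disj h.cleanAt.mem (e ▸ hu)
  refine ⟨_, mem_splits (fun hx => h.left_notMem hx.1) (fun hy => h.right_notMem hy.1)
    (Or.inl (Or.inl (Or.inl rfl))) fun u hux huy => ?_, hm'.indSolid⟩
  have := hvQ u
  simp only [Set.mem_union, Set.mem_insert_iff, Set.mem_sdiff, Set.mem_singleton_iff, hQ' u huy]
  tauto

theorem indCycle_insert_insert (h : MergeOnCycle G v x y C Q a b) (hxa : G.Adj x a)
    (hyb : G.Adj y b) (hxb : ¬G.Adj x b) (hya : ¬G.Adj y a) :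
    IndCycle G (insert y (insert x (C \ {v}))) := by
  have hxP : x ∉ C \ {v} := fun hx => h.left_notMem (Or.inl hx.1)
  have hyP : y ∉ C \ {v} := fun hy => h.right_notMem (Or.inl hy.1)
  have p : IndPath G x b (insert x (C \ {v})) :=
    .cons hxa hxP (fun u hu hxu => (h.eq_or_eq_of_adj hu hxu).resolve_right fun e =>
      hxb (e ▸ hxu)) h.indCycleAt.path
  refine IndCycleAt.indCycle ⟨p, (h.ne_left (Or.inl h.indCycleAt.path.right_mem.1)).symm, ?_,
    h.merges.adj_left_right.symm, hyb, ?_⟩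
  · rintro (e | hy)
    exacts [h.merges.adj_left_right.ne e.symm, hyP hy]
  · rintro u (rfl | hu) hyu
    · exact Or.inl rfl
    · exact Or.inr ((h.symm.eq_or_eq_of_adj hu hyu).resolve_left fun e => hya (e ▸ hyu))

theorem spread_insert_insert (h : MergeOnCycle G v x y C Q a b) :
    Spread G (insert y (insert x (C \ {v}))) Q := by
  rcases h.spread.sdiff_singleton_or v with hsp | ⟨⟨q, hq, hqv⟩, w, hw, hwv, hvw, hwQ⟩
  · exact hsp.mono (fun _ hu => Or.inr (Or.inr hu)) subset_rfl
  have hwC : w ∈ insert y (insert x (C \ {v})) := Or.inr (Or.inr ⟨hw, hwv⟩)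
  rw [h.adj_iff (Or.inl hw), not_or] at hvw
  rcases (h.adj_iff (Or.inr hq)).1 hqv.symm with hxq | hyq
  · exact ⟨x, Or.inr (Or.inl rfl), w, hwC, (h.ne_left (Or.inl hw)).symm, hvw.1,
      ⟨q, hq, hxq.symm⟩, hwQ⟩
  · exact ⟨y, Or.inl rfl, w, hwC, (h.symm.ne_left (Or.inl hw)).symm, hvw.2,
      ⟨q, hq, hyq.symm⟩, hwQ⟩

theorem eq_of_spread_insert_insert (h : MergeOnCycle G v x y C Q a b) (hsub : Q' ⊆ Q)
    (hconn : Conn G Q') (hspread : Spread G (insert y (insert x (C \ {v}))) Q') : Q' = Q := by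
  by_contra hne
  by_cases hvQ' : Attaches G Q' v
  · have hatt : ∀ u ∈ insert y (insert x (C \ {v})), Attaches G Q' u → u = x ∨ u = y := by
      rintro u (rfl | rfl | hu) huQ'
      · exact Or.inr rfl
      · exact Or.inl rfl
      · exact absurd (h.cleanAt.att Q' hsub hne hconn hvQ' u hu.1 huQ') hu.2
    have hxy := h.merges.adj_left_right
    obtain ⟨u, hu, w, hw, huw, hadj, huQ', hwQ'⟩ := hspread
    rcases hatt u hu huQ' with rfl | rfl <;> rcases hatt w hw hwQ' with rfl | rfl
    exacts [huw rfl, hadj hxy, hadj hxy.symm, huw rfl]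
  · refine hne (h.min Q' hsub hconn (hspread.of_forall_attaches fun u hu huQ' => ⟨?_, huQ'⟩))
    have hv : ∀ q ∈ Q', ¬G.Adj v q := fun q hq hvq => hvQ' ⟨q, hq, hvq.symm⟩
    obtain ⟨q, hq, hqu⟩ := huQ'
    rcases hu with rfl | rfl | hu
    · exact absurd ((h.adj_iff (Or.inr (hsub hq))).2 (Or.inr hqu.symm)) (hv q hq)
    · exact absurd ((h.adj_iff (Or.inr (hsub hq))).2 (Or.inl hqu.symm)) (hv q hq)
    · exact hu.1

/-- Here the edge `xy` takes the place of `v` on the cycle. -/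
theorem exists_indSolid_splits_of_adj_of_adj (h : MergeOnCycle G v x y C Q a b) (hxa : G.Adj x a)
    (hyb : G.Adj y b) (hxb : ¬G.Adj x b) (hya : ¬G.Adj y a) :
    ∃ T ∈ splits x y ((C ∪ Q) \ {v}), IndSolid G T := by
  have hdisj : Disjoint (insert y (insert x (C \ {v}))) Q := by
    rw [Set.disjoint_left]
    rintro u (rfl | rfl | hu) hu'
    exacts [h.right_notMem (Or.inr hu'), h.left_notMem (Or.inr hu'),
      Set.disjoint_left.1 h.disj hu.1 hu']
  have hm' : MinSpread G (insert y (insert x (C \ {v}))) Q :=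
    ⟨h.indCycle_insert_insert hxa hyb hxb hya, hdisj, h.conn, h.spread_insert_insert,
      fun _ => h.eq_of_spread_insert_insert⟩
  have hvQ : ∀ u ∈ Q, u ≠ v := fun u hu e =>
    Set.disjoint_left.1 h.disj h.cleanAt.mem (e ▸ hu)
  refine ⟨_, mem_splits (fun hx => h.left_notMem hx.1) (fun hy => h.right_notMem hy.1)
    (Or.inr (Or.inl (Or.inl rfl))) fun u hux huy => ?_, hm'.indSolid⟩
  have := hvQ u
  simp only [Set.mem_union, Set.mem_insert_iff, Set.mem_sdiff, Set.mem_singleton_iff]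
  tauto

theorem mem_right_of_not_adj (h : MergeOnCycle G v x y C Q a b) (hxa : G.Adj x a)
    (hxb : G.Adj x b) (hc : c ∈ C ∪ Q) (hvc : G.Adj v c) (hxc : ¬G.Adj x c) : c ∈ Q := by
  refine hc.resolve_left fun hcC => ?_
  rcases h.indCycleAt.adj c ⟨hcC, hvc.ne'⟩ hvc with rfl | rfl
  exacts [hxc hxa, hxc hxb]

theorem exists_indSolid_splits [Finite V] (h : MergeOnCycle G v x y C Q a b) (hp : p ∈ C ∪ Q)
    (hvp : G.Adj v p) (hxp : ¬G.Adj x p) (hq : q ∈ C ∪ Q) (hvq : G.Adj v q) (hyq : ¬G.Adj y q) :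
    ∃ T ∈ splits x y ((C ∪ Q) \ {v}), IndSolid G T := by
  have ha := (h.adj_iff (Or.inl h.indCycleAt.path.left_mem.1)).1 h.indCycleAt.left
  have hb := (h.adj_iff (Or.inl h.indCycleAt.path.right_mem.1)).1 h.indCycleAt.right
  by_cases hx : G.Adj x a ∧ G.Adj x b
  · have hpQ := h.mem_right_of_not_adj hx.1 hx.2 hp hvp hxp
    refine h.exists_indSolid_splits_of_adj_both hx.1 hx.2 (fun hy => ?_) hpQ hvp hxp
    have hqQ := h.symm.mem_right_of_not_adj hy.1 hy.2 hq hvq hyq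
    obtain rfl := h.cleanAt.unique p hpQ q hqQ hvp hvq
    exact ((h.adj_iff hp).1 hvp).elim hxp hyq
  by_cases hy : G.Adj y a ∧ G.Adj y b
  · have hqQ := h.symm.mem_right_of_not_adj hy.1 hy.2 hq hvq hyq
    rw [splits_comm]
    exact h.symm.exists_indSolid_splits_of_adj_both hy.1 hy.2 hx hqQ hvq hyq
  by_cases hxa : G.Adj x a
  · exact h.exists_indSolid_splits_of_adj_of_adj hxa (by tauto) (by tauto) (by tauto)
  · exact h.reverse.exists_indSolid_splits_of_adj_of_adj (by tauto) (by tauto) hxa (by tauto)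

end MergeOnCycle

theorem Merges.exists_indSolid_splits [Finite V] (h : Merges G v x y) (hS : IndSolid G S)
    (hv : v ∈ S) (hx : x ∉ S) (hy : y ∉ S) : ∃ T ∈ splits x y (S \ {v}), IndSolid G T := by
  by_cases hdomx : ∀ b ∈ S, G.Adj v b → G.Adj x b
  · exact ⟨_, Or.inl rfl, h.indSolid_insert_left hS hv hx hy hdomx⟩
  by_cases hdomy : ∀ b ∈ S, G.Adj v b → G.Adj y b
  · exact ⟨_, Or.inr (Or.inl rfl), h.symm.indSolid_insert_left hS hv hy hx hdomy⟩
  push Not at hdomx hdomy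
  obtain ⟨p, hp, hvp, hxp⟩ := hdomx
  obtain ⟨q, hq, hvq, hyq⟩ := hdomy
  rcases (isSolidGraph_induce_iff.2 hS).exists_minSpread hv with
    hK | ⟨C, Q, rfl, hm, hvQ | hclean⟩
  · exact ⟨_, Or.inr (Or.inr rfl), h.indSolid_of_indK4 hK hv hx hy hp hvp hxp hq hvq hyq⟩
  · exact h.exists_indSolid_splits_of_mem_right hm hvQ hx hy
  · obtain ⟨a, b, hab⟩ := hm.cyc.indCycleAt hclean.mem
    exact MergeOnCycle.exists_indSolid_splits ⟨hm, h, hclean, hab, hx, hy⟩ hp hvp hxp hq hvq hyq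

end Merges

section Fibre

variable {V : Type*} {G : SimpleGraph V} {a b c d u v w x y : V} {A C P Q R S T : Set V}

theorem IndPath.exists_adj_adj_left (p : IndPath G a b S) (q : IndPath G a b T) (hab : a ≠ b)
    (hadj : ¬G.Adj a b) (hST : ∀ u ∈ S, u ∈ T → u = a ∨ u = b) :
    ∃ u ∈ S ∪ T, ∃ w ∈ S ∪ T, u ≠ w ∧ G.Adj a u ∧ G.Adj a w := by
  obtain ⟨u, p', hu, -⟩ := p.trim_left hab
  obtain ⟨w, q', hw, -⟩ := q.trim_left hab
  refine ⟨u, Or.inl p'.left_mem.1, w, Or.inr q'.left_mem.1, ?_, hu, hw⟩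
  rintro rfl
  rcases hST u p'.left_mem.1 q'.left_mem.1 with rfl | rfl
  exacts [hu.ne rfl, hadj hu]

theorem IndPath.not_union_subset_path (p : IndPath G a b S) (q : IndPath G a b T) (hab : a ≠ b)
    (hadj : ¬G.Adj a b) (hST : ∀ u ∈ S, u ∈ T → u = a ∨ u = b) (r : IndPath G c d R) :
    ¬S ∪ T ⊆ R := by
  refine fun hR => r.not_two_le_degree_on hR ⟨a, Or.inl p.left_mem⟩ fun t ht => ?_
  by_cases hta : t = a
  · subst hta
    exact p.exists_adj_adj_left q hab hadj hST
  by_cases htb : t = b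
  · subst htb
    exact p.reverse.exists_adj_adj_left q.reverse hab.symm (fun h => hadj h.symm)
      fun u hu hu' => (hST u hu hu').symm
  rcases ht with ht | ht
  · obtain ⟨u, hu, w, hw, h⟩ := p.exists_two_neighbors ht hta htb
    exact ⟨u, Or.inl hu, w, Or.inl hw, h⟩
  · obtain ⟨u, hu, w, hw, h⟩ := q.exists_two_neighbors ht hta htb
    exact ⟨u, Or.inr hu, w, Or.inr hw, h⟩

theorem Spread.not_union_subset_path (h : Spread G A Q) (hA : Conn G A) (hQ : Conn G Q)
    (hdisj : Disjoint A Q) (p : IndPath G a b P) : ¬A ∪ Q ⊆ P := by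
  obtain ⟨u, hu, w, hw, huw, hadj, ⟨q, hq, hqu⟩, q', hq', hqw⟩ := h
  obtain ⟨S, hS, r⟩ := hA.exists_indPath hu hw
  have hQ' : Conn G (insert u (insert w Q)) :=
    (hQ.insert_adj hq' hqw.symm).insert_adj (Or.inr hq) hqu.symm
  obtain ⟨T, hT, r'⟩ := hQ'.exists_indPath (Or.inl rfl) (Or.inr (Or.inl rfl))
  refine fun hP => r.not_union_subset_path r' huw hadj (fun t ht ht' => ?_) p
    (Set.union_subset (hS.trans (Set.subset_union_left.trans hP)) fun t ht => ?_)
  · rcases hT ht' with h | h | h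
    exacts [Or.inl h, Or.inr h, absurd h (Set.disjoint_left.1 hdisj (hS ht))]
  · rcases hT ht with rfl | rfl | h
    exacts [hP (Or.inl hu), hP (Or.inl hw), hP (Or.inr h)]

theorem MinSpread.not_sdiff_singleton_subset_path (h : MinSpread G C Q) (hv : v ∈ C)
    (p : IndPath G a b P) : ¬(C ∪ Q) \ {v} ⊆ P := by
  intro hP
  have hvQ : v ∉ Q := Set.disjoint_left.1 h.disj hv
  have hCP : C \ {v} ⊆ P := fun t ht => hP ⟨Or.inl ht.1, ht.2⟩
  have hQP : Q ⊆ P := fun t ht => hP ⟨Or.inr ht, fun e => hvQ (e ▸ ht)⟩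
  obtain ⟨c, d, hcyc⟩ := h.cyc.indCycleAt hv
  rcases h.spread.sdiff_singleton_or v with hsp | ⟨-, w, hw, hwv, hvw, q, hq, hqw⟩
  · exact hsp.not_union_subset_path hcyc.path.conn h.conn (h.disj.mono_left Set.sdiff_subset) p
      (Set.union_subset hCP hQP)
  · obtain ⟨s, hs, t, ht, hst, hws, hwt⟩ := hcyc.path.exists_two_neighbors ⟨hw, hwv⟩
      (fun e => hvw (e ▸ hcyc.left)) fun e => hvw (e ▸ hcyc.right)
    exact p.no_three_neighbors (hCP ⟨hw, hwv⟩) (hCP hs) (hCP ht) (hQP hq) hst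
      (h.disj.ne_of_mem hs.1 hq) (h.disj.ne_of_mem ht.1 hq) hws hwt hqw.symm

theorem IndK4.not_sdiff_singleton_subset_path (h : IndK4 G S) (hv : v ∈ S)
    (p : IndPath G a b P) : ¬S \ {v} ⊆ P := by
  intro hP
  have hcard : (S \ {v}).ncard = 3 := by
    rw [Set.ncard_sdiff_singleton_of_mem hv, h.2]
  obtain ⟨s, t, u, hst, hsu, htu, hset⟩ := Set.ncard_eq_three.1 hcard
  have hS : ∀ z ∈ ({s, t, u} : Set V), z ∈ S := fun z hz => (hset.symm.subset hz).1
  have hcyc : IndCycle G {s, t, u} := indCycle_triangle (h.1 (hS s (by simp)) (hS t (by simp)) hst)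
    (h.1 (hS s (by simp)) (hS u (by simp)) hsu) (h.1 (hS t (by simp)) (hS u (by simp)) htu)
  exact hcyc.not_subset_path p (hset ▸ hP)

theorem not_indSolid_insert (p : IndPath G a b P) : ¬IndSolid G (insert v P) := by
  intro h
  have hv := Set.mem_insert v P
  have hP : insert v P \ {v} ⊆ P := Set.sdiff_singleton_subset_iff.2 subset_rfl
  rcases (isSolidGraph_induce_iff.2 h).exists_minSpread hv with hK | ⟨C, Q, hs, hm, -⟩
  · exact hK.not_sdiff_singleton_subset_path hv p hP
  · rw [hs] at hP
    by_cases hvC : v ∈ C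
    · exact hm.not_sdiff_singleton_subset_path hvC p hP
    · exact hm.cyc.not_subset_path p fun t ht => hP ⟨Or.inl ht, fun e => hvC (e ▸ ht)⟩

theorem IndCycle.indCycleAt_of_insert (h : IndCycle G (insert x A)) (hx : x ∉ A) :
    ∃ a b, IndCycleAt G x a b A := by
  obtain ⟨a, b, hcyc⟩ := h.indCycleAt (Set.mem_insert x A)
  rw [Set.insert_sdiff_self_of_notMem hx] at hcyc
  exact ⟨a, b, hcyc⟩

theorem IndCycle.exists_indPath_of_insert_insert (h : IndCycle G (insert x (insert y A)))
    (hxy : G.Adj x y) (hx : x ∉ A) (hy : y ∉ A) :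
    ∃ a b, IndPath G a b A ∧ G.Adj y a ∧ G.Adj x b ∧ (∀ u ∈ A, G.Adj y u → u = a) ∧
      ∀ u ∈ A, G.Adj x u → u = b := by
  have hxA : x ∉ insert y A := not_or.2 ⟨hxy.ne, hx⟩
  obtain ⟨b, hcyc⟩ : ∃ b, IndCycleAt G x y b (insert y A) := by
    obtain ⟨c, d, hcyc⟩ := h.indCycleAt_of_insert hxA
    rcases hcyc.adj y (Or.inl rfl) hxy with rfl | rfl
    exacts [⟨_, hcyc⟩, ⟨_, hcyc.symm⟩]
  obtain ⟨a, p, hya, ha⟩ := hcyc.path.trim_left hcyc.ne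
  rw [Set.insert_sdiff_self_of_notMem hy] at p
  exact ⟨a, b, p, hya, hcyc.right, fun u hu => ha u (Or.inr hu), fun u hu hxu =>
    (hcyc.adj u (Or.inr hu) hxu).resolve_left fun e => hy (e ▸ hu)⟩

theorem not_indCycle_insert_of_forall_adj_eq (h : ∀ u ∈ A, G.Adj x u → u = a) :
    ¬IndCycle G (insert x A) := by
  intro hC
  obtain ⟨u, hu, w, hw, huw, hxu, hxw⟩ := hC.exists_two_neighbors (Set.mem_insert x A)
  exact huw ((h u (hu.resolve_left hxu.ne') hxu).trans (h w (hw.resolve_left hxw.ne') hxw).symm)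

theorem Merges.adj_iff_of_mem (h : Merges G v x y) (hx : x ∉ A) (hy : y ∉ A) (hu : u ∈ A) :
    G.Adj v u ↔ G.Adj x u ∨ G.Adj y u :=
  h.adj_iff u (fun e => hx (e ▸ hu)) fun e => hy (e ▸ hu)

theorem not_indSolid_insert_of_indCycle_mem_splits (hxy : G.Adj x y) (hx : x ∉ A) (hy : y ∉ A)
    (hT : T ∈ splits x y A) (hC : IndCycle G T) : ¬IndSolid G (insert v A) := by
  rcases hT with rfl | rfl | rfl
  · obtain ⟨a, b, hcyc⟩ := hC.indCycleAt_of_insert hx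
    exact not_indSolid_insert hcyc.path
  · obtain ⟨a, b, hcyc⟩ := hC.indCycleAt_of_insert hy
    exact not_indSolid_insert hcyc.path
  · obtain ⟨a, b, p, -⟩ := hC.exists_indPath_of_insert_insert hxy hx hy
    exact not_indSolid_insert p

theorem Merges.indCycle_or_eq_singleton (h : Merges G v x y) (hv : v ∉ A) (hx : x ∉ A)
    (hy : y ∉ A) (hC : IndCycle G (insert x (insert y A))) :
    IndCycle G (insert v A) ∨ ∃ p, A = {p} ∧ G.Adj x p ∧ G.Adj y p := by
  obtain ⟨a, b, p, hya, hxb, ha, hb⟩ :=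
    hC.exists_indPath_of_insert_insert h.adj_left_right hx hy
  by_cases hab : a = b
  · subst hab
    exact Or.inr ⟨a, p.eq_singleton, hxb, hya⟩
  · have hadj : ∀ u ∈ A, G.Adj v u ↔ G.Adj x u ∨ G.Adj y u := fun u => h.adj_iff_of_mem hx hy
    exact Or.inl (IndCycleAt.indCycle ⟨p, hab, hv, (hadj a p.left_mem).2 (Or.inr hya),
      (hadj b p.right_mem).2 (Or.inl hxb),
      fun u hu hvu => ((hadj u hu).1 hvu).symm.imp (ha u hu) (hb u hu)⟩)

theorem Merges.indCycle_of_forall_adj (h : Merges G v x y) (hv : v ∉ A) (hx : x ∉ A) (hy : y ∉ A)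
    (hcyc : IndCycleAt G x a b A) (hsub : ∀ u ∈ A, G.Adj y u → u = a ∨ u = b) :
    IndCycle G (insert v A) := by
  have hadj : ∀ u ∈ A, G.Adj v u ↔ G.Adj x u ∨ G.Adj y u := fun u => h.adj_iff_of_mem hx hy
  exact IndCycleAt.indCycle ⟨hcyc.path, hcyc.ne, hv,
    (hadj a hcyc.path.left_mem).2 (Or.inl hcyc.left),
    (hadj b hcyc.path.right_mem).2 (Or.inl hcyc.right), fun u hu hvu =>
    ((hadj u hu).1 hvu).elim (hcyc.adj u hu) (hsub u hu)⟩

theorem Merges.indCycle_or_indSolid (h : Merges G v x y) (hv : v ∉ A) (hx : x ∉ A) (hy : y ∉ A)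
    (hC : IndCycle G (insert x A)) :
    IndCycle G (insert v A) ∨ IndSolid G (insert x (insert y A)) := by
  obtain ⟨a, b, hcyc⟩ := hC.indCycleAt_of_insert hx
  by_cases hsub : ∀ u ∈ A, G.Adj y u → u = a ∨ u = b
  · exact Or.inl (h.indCycle_of_forall_adj hv hx hy hcyc hsub)
  · push Not at hsub
    obtain ⟨u, hu, hyu, hua, hub⟩ := hsub
    have hspread : Spread G (insert x A) {y} :=
      ⟨x, Or.inl rfl, u, Or.inr hu, fun e => hx (e ▸ hu),
        fun hxu => (hcyc.adj u hu hxu).elim hua hub, ⟨y, rfl, h.adj_left_right.symm⟩, y, rfl, hyu⟩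
    have hsolid :=
      (minSpread_singleton hC (not_or.2 ⟨h.adj_left_right.ne', hy⟩) hspread).indSolid
    rw [Set.union_singleton, Set.insert_comm] at hsolid
    exact Or.inr hsolid

theorem IndCycleAt.adj_of_indCycle_insert (hcyc : IndCycleAt G x a b A)
    (hC : IndCycle G (insert y A)) (hy : y ∉ A) (hu : u ∈ A) (hyu : G.Adj y u) :
    u = a ∨ u = b := by
  by_contra hab
  push Not at hab
  obtain ⟨s, hs, t, ht, hst, hus, hut⟩ := hcyc.path.exists_two_neighbors hu hab.1 hab.2
  exact hC.no_three_neighbors (Or.inr hu) (Or.inr hs) (Or.inr ht) (Or.inl rfl) hst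
    (fun e => hy (e ▸ hs)) (fun e => hy (e ▸ ht)) hus hut hyu.symm

theorem IndCycle.indSolid_insert_insert (hC : IndCycle G (insert x A))
    (hC' : IndCycle G (insert y A)) (hxy : G.Adj x y) (hx : x ∉ A) (hy : y ∉ A) :
    IndSolid G (insert x (insert y A)) := by
  obtain ⟨a, b, hcyc⟩ := hC.indCycleAt_of_insert hx
  obtain ⟨c, d, hcyc'⟩ := hC'.indCycleAt_of_insert hy
  have hc := hcyc'.path.left_mem
  have hd := hcyc'.path.right_mem
  rw [Set.insert_comm]
  have hadj : G.Adj x c ∧ G.Adj x d := by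
    have hc' := hcyc.adj_of_indCycle_insert hC' hy hc hcyc'.left
    have hd' := hcyc.adj_of_indCycle_insert hC' hy hd hcyc'.right
    rcases hc' with rfl | rfl <;> rcases hd' with rfl | rfl
    exacts [absurd rfl hcyc'.ne, ⟨hcyc.left, hcyc.right⟩, ⟨hcyc.right, hcyc.left⟩,
      absurd rfl hcyc'.ne]
  exact Or.inl ⟨insert x A, y, hC, not_or.2 ⟨hxy.ne', hy⟩, rfl, x, Or.inl rfl, c, Or.inr hc, d,
    Or.inr hd, hadj.1.ne, hadj.2.ne, hcyc'.ne, hxy.symm, hcyc'.left, hcyc'.right⟩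

theorem Merges.indCycle_insert (h : Merges G v x y) (hv : v ∉ A) (hx : x ∉ A) (hy : y ∉ A)
    (hC : IndCycle G (insert x A)) (hC' : IndCycle G (insert y A)) :
    IndCycle G (insert v A) := by
  obtain ⟨a, b, hcyc⟩ := hC.indCycleAt_of_insert hx
  exact h.indCycle_of_forall_adj hv hx hy hcyc fun u => hcyc.adj_of_indCycle_insert hC' hy

theorem ncard_indCycle_splits_le_one (hxy : G.Adj x y) (hx : x ∉ A) (hy : y ∉ A)
    (hC : IndCycle G (insert x (insert y A))) :
    {T ∈ splits x y A | IndCycle G T}.ncard ≤ 1 := by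
  obtain ⟨a, b, -, -, -, ha, hb⟩ := hC.exists_indPath_of_insert_insert hxy hx hy
  refine (Set.ncard_le_ncard (t := {insert x (insert y A)}) ?_).trans (Set.ncard_singleton _).le
  rintro T ⟨rfl | rfl | rfl, hT⟩
  exacts [absurd hT (not_indCycle_insert_of_forall_adj_eq hb),
    absurd hT (not_indCycle_insert_of_forall_adj_eq ha), rfl]

theorem Merges.ncard_indCycle_splits_le (h : Merges G v x y) (hv : v ∉ A) (hx : x ∉ A)
    (hy : y ∉ A) :
    {T ∈ splits x y A | IndCycle G T}.ncard ≤ {T ∈ splits x y A | IndSolid G T}.ncard ∨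
      {T ∈ splits x y A | IndCycle G T}.ncard ≤
          {T ∈ splits x y A | IndSolid G T}.ncard + 1 ∧
        (IndCycle G (insert v A) ∨ ∃ p, A = {p} ∧ G.Adj x p ∧ G.Adj y p) := by
  have hxy := h.adj_left_right
  have hfin : (splits x y A).Finite := ((Set.finite_singleton _).insert _).insert _
  have hone : ∀ B, {T ∈ splits x y A | IndCycle G T} ⊆ {B} →
      {T ∈ splits x y A | IndCycle G T}.ncard ≤ 1 := fun B hB =>
    (Set.ncard_le_ncard hB (Set.finite_singleton B)).trans (Set.ncard_singleton B).le
  have hpos : IndSolid G (insert x (insert y A)) →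
      1 ≤ {T ∈ splits x y A | IndSolid G T}.ncard := fun hS =>
    (Set.ncard_pos (hfin.subset fun _ hT => hT.1)).2 ⟨_, Or.inr (Or.inr rfl), hS⟩
  by_cases hxyC : IndCycle G (insert x (insert y A))
  · have hc := ncard_indCycle_splits_le_one hxy hx hy hxyC
    exact Or.inr ⟨by omega, h.indCycle_or_eq_singleton hv hx hy hxyC⟩
  by_cases hxC : IndCycle G (insert x A) <;> by_cases hyC : IndCycle G (insert y A)
  · have hc : {T ∈ splits x y A | IndCycle G T}.ncard ≤ 2 := by
      refine (Set.ncard_le_ncard (t := {insert x A, insert y A}) ?_).trans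
        ((Set.ncard_insert_le _ _).trans (by rw [Set.ncard_singleton]))
      rintro T ⟨rfl | rfl | rfl, hTC⟩
      exacts [Or.inl rfl, Or.inr rfl, absurd hTC hxyC]
    have hs := hpos (hxC.indSolid_insert_insert hyC hxy hx hy)
    exact Or.inr ⟨by omega, Or.inl (h.indCycle_insert hv hx hy hxC hyC)⟩
  · have hc := hone (insert x A) fun T ⟨hT, hTC⟩ => by
      rcases hT with rfl | rfl | rfl
      exacts [rfl, absurd hTC hyC, absurd hTC hxyC]
    rcases h.indCycle_or_indSolid hv hx hy hxC with hvC | hS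
    exacts [Or.inr ⟨by omega, Or.inl hvC⟩, Or.inl (hc.trans (hpos hS))]
  · have hc := hone (insert y A) fun T ⟨hT, hTC⟩ => by
      rcases hT with rfl | rfl | rfl
      exacts [absurd hTC hxC, rfl, absurd hTC hxyC]
    rcases h.symm.indCycle_or_indSolid hv hy hx hyC with hvC | hS
    exacts [Or.inr ⟨by omega, Or.inl hvC⟩, Or.inl (hc.trans (hpos (Set.insert_comm x y A ▸ hS)))]
  · refine Or.inl ?_
    rw [Set.sep_eq_empty_iff_mem_false.2, Set.ncard_empty]
    · exact Nat.zero_le _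
    rintro T (rfl | rfl | rfl)
    exacts [hxC, hyC, hxyC]

end Fibre

section Contraction

variable {V : Type*} {G : SimpleGraph V} {u w x y : V} {T : Set V} {Z : Set (ContractVert x y)}

theorem contractMap_left : contractMap x y x = none := dif_neg fun h => h.1 rfl

theorem contractMap_right : contractMap x y y = none := dif_neg fun h => h.2 rfl

theorem contractMap_of_ne (h : w ≠ x ∧ w ≠ y) : contractMap x y w = some ⟨w, h⟩ := dif_pos h

theorem contractMap_eq_none_iff : contractMap x y w = none ↔ w = x ∨ w = y := by
  constructor
  · contrapose!
    intro h
    rw [contractMap_of_ne h]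
    exact nofun
  · rintro (rfl | rfl)
    exacts [contractMap_left, contractMap_right]

theorem contractMap_eq_some_iff {h : w ≠ x ∧ w ≠ y} :
    contractMap x y u = some ⟨w, h⟩ ↔ u = w := by
  refine ⟨fun hu => ?_, fun hu => hu ▸ contractMap_of_ne h⟩
  by_cases hu' : u ≠ x ∧ u ≠ y
  · rw [contractMap_of_ne hu'] at hu
    exact congrArg Subtype.val (Option.some_injective _ hu)
  · rw [contractMap_eq_none_iff.2 (by tauto)] at hu
    cases hu

theorem contractMap_eq_iff : contractMap x y u = contractMap x y w ↔
    u = w ∨ (u = x ∨ u = y) ∧ (w = x ∨ w = y) := by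
  by_cases hu : u = x ∨ u = y
  · rw [contractMap_eq_none_iff.2 hu, eq_comm, contractMap_eq_none_iff]
    exact ⟨fun hw => Or.inr ⟨hu, hw⟩, fun h => h.elim (fun e => e ▸ hu) And.right⟩
  · rw [contractMap_of_ne (not_or.1 hu), eq_comm, contractMap_eq_some_iff, eq_comm]
    exact ⟨Or.inl, fun h => h.resolve_right fun h => hu h.1⟩

theorem contractMap_surjective : Function.Surjective (contractMap x y) := by
  rintro (_ | ⟨a, ha⟩)
  exacts [⟨x, contractMap_left⟩, ⟨a, contractMap_of_ne ha⟩]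

theorem contractMap_eq_or_adj (h : G.Adj u w) : contractMap x y u = contractMap x y w ∨
    (contract G x y).Adj (contractMap x y u) (contractMap x y w) := by
  by_cases hu : u = x ∨ u = y <;> by_cases hw : w = x ∨ w = y
  · exact Or.inl (contractMap_eq_iff.2 (Or.inr ⟨hu, hw⟩))
  all_goals right
  · rw [contractMap_eq_none_iff.2 hu, contractMap_of_ne (not_or.1 hw)]
    rcases hu with rfl | rfl
    exacts [Or.inl h, Or.inr h]
  · rw [contractMap_eq_none_iff.2 hw, contractMap_of_ne (not_or.1 hu)]
    rcases hw with rfl | rfl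
    exacts [Or.inl h.symm, Or.inr h.symm]
  · rw [contractMap_of_ne (not_or.1 hu), contractMap_of_ne (not_or.1 hw)]
    exact h

theorem exists_adj_of_contract_adj {a b : ContractVert x y} (h : (contract G x y).Adj a b) :
    ∃ u w, contractMap x y u = a ∧ contractMap x y w = b ∧ G.Adj u w := by
  rcases a with _ | ⟨a, ha⟩ <;> rcases b with _ | ⟨b, hb⟩
  · exact h.elim
  · rcases h with h | h
    exacts [⟨x, b, contractMap_left, contractMap_of_ne hb, h⟩,
      ⟨y, b, contractMap_right, contractMap_of_ne hb, h⟩]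
  · rcases h with h | h
    exacts [⟨a, x, contractMap_of_ne ha, contractMap_left, h.symm⟩,
      ⟨a, y, contractMap_of_ne ha, contractMap_right, h.symm⟩]
  · exact ⟨a, b, contractMap_of_ne ha, contractMap_of_ne hb, h⟩

/-- The old vertices in a set of vertices of `G / xy`. -/
def oldVerts {V : Type*} {x y : V} (Z : Set (ContractVert x y)) : Set V :=
  {w | ∃ h : w ≠ x ∧ w ≠ y, some ⟨w, h⟩ ∈ Z}

theorem left_notMem_oldVerts : x ∉ oldVerts Z := fun h => h.1.1 rfl

theorem right_notMem_oldVerts : y ∉ oldVerts Z := fun h => h.1.2 rfl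

theorem image_contractMap_eq_iff :
    contractMap x y '' T = Z ↔
      (∀ w, w ≠ x → w ≠ y → (w ∈ T ↔ w ∈ oldVerts Z)) ∧ ((x ∈ T ∨ y ∈ T) ↔ none ∈ Z) := by
  have hsome : ∀ w (h : w ≠ x ∧ w ≠ y), some ⟨w, h⟩ ∈ contractMap x y '' T ↔ w ∈ T := by
    simp only [Set.mem_image, contractMap_eq_some_iff, exists_eq_right, implies_true]
  have hnone : none ∈ contractMap x y '' T ↔ x ∈ T ∨ y ∈ T := by
    simp only [Set.mem_image, contractMap_eq_none_iff, and_or_left, exists_or, exists_eq_right]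
  constructor
  · rintro rfl
    refine ⟨fun w hwx hwy => ?_, hnone.symm⟩
    rw [← hsome w ⟨hwx, hwy⟩]
    exact ⟨fun h => ⟨⟨hwx, hwy⟩, h⟩, fun ⟨_, h⟩ => h⟩
  · rintro ⟨hold, hnew⟩
    ext (_ | ⟨w, hw⟩)
    · rw [hnone, hnew]
    · rw [hsome w hw, hold w hw.1 hw.2]
      exact ⟨fun ⟨_, h⟩ => h, fun h => ⟨hw, h⟩⟩

theorem image_contractMap_of_none_mem (hZ : none ∈ Z) :
    contractMap x y '' T = Z ↔ T ∈ splits x y (oldVerts Z) := by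
  rw [image_contractMap_eq_iff]
  constructor
  · rintro ⟨hold, hnew⟩
    exact mem_splits left_notMem_oldVerts right_notMem_oldVerts (hnew.2 hZ) hold
  · rintro (rfl | rfl | rfl)
    · exact ⟨fun w hwx _ => or_iff_right hwx, iff_of_true (Or.inl (Or.inl rfl)) hZ⟩
    · exact ⟨fun w _ hwy => or_iff_right hwy, iff_of_true (Or.inr (Or.inl rfl)) hZ⟩
    · exact ⟨fun w hwx hwy => (or_iff_right hwx).trans (or_iff_right hwy),
        iff_of_true (Or.inl (Or.inl rfl)) hZ⟩

theorem image_contractMap_of_none_notMem (hZ : none ∉ Z) :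
    contractMap x y '' T = Z ↔ T = oldVerts Z := by
  have hx := left_notMem_oldVerts (Z := Z)
  have hy := right_notMem_oldVerts (Z := Z)
  rw [image_contractMap_eq_iff]
  constructor
  · rintro ⟨hold, hnew⟩
    obtain ⟨hxT, hyT⟩ := not_or.1 fun h => hZ (hnew.1 h)
    ext w
    by_cases hwx : w = x
    · exact iff_of_false (fun h => hxT (hwx ▸ h)) fun h => hx (hwx ▸ h)
    by_cases hwy : w = y
    · exact iff_of_false (fun h => hyT (hwy ▸ h)) fun h => hy (hwy ▸ h)
    · exact hold w hwx hwy
  · rintro rfl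
    exact ⟨fun _ _ _ => Iff.rfl, iff_of_false (not_or.2 ⟨hx, hy⟩) hZ⟩

end Contraction

section JointGraph

variable {V W : Type*} {G : SimpleGraph V} {H : SimpleGraph W} {x y : V} {A C S : Set V}
  {Z : Set (ContractVert x y)}

theorem IndCycle.nonempty (h : IndCycle G C) : C.Nonempty := by
  obtain ⟨v, -, -, -, rfl, -⟩ := h
  exact ⟨v, Or.inl rfl⟩

theorem exists_image_image_eq [Nonempty V] (f : G ↪g H) (S : Set V) :
    ∃ g : W → V, Set.InjOn g (f '' S) ∧
      (∀ u ∈ f '' S, ∀ w ∈ f '' S, H.Adj u w ↔ G.Adj (g u) (g w)) ∧ g '' (f '' S) = S := by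
  have hinv := Function.leftInverse_invFun f.injective
  refine ⟨Function.invFun f, ?_, ?_, hinv.image_image S⟩
  · rintro _ ⟨a, -, rfl⟩ _ ⟨b, -, rfl⟩ hab
    rw [hinv a, hinv b] at hab
    rw [hab]
  · rintro _ ⟨a, -, rfl⟩ _ ⟨b, -, rfl⟩
    rw [hinv a, hinv b, f.map_adj_iff]

theorem indSolid_image_iff (f : G ↪g H) : IndSolid H (f '' S) ↔ IndSolid G S := by
  refine ⟨fun h => ?_, fun h => h.image f.injective.injOn fun _ _ _ _ => f.map_adj_iff.symm⟩
  have : Nonempty V := h.nonempty.of_image.to_type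
  obtain ⟨g, hg, hadj, hS⟩ := exists_image_image_eq f S
  exact hS ▸ h.image hg hadj

theorem indCycle_image_iff (f : G ↪g H) : IndCycle H (f '' S) ↔ IndCycle G S := by
  refine ⟨fun h => ?_, fun h => h.image f.injective.injOn fun _ _ _ _ => f.map_adj_iff.symm⟩
  have : Nonempty V := h.nonempty.of_image.to_type
  obtain ⟨g, hg, hadj, hS⟩ := exists_image_image_eq f S
  exact hS ▸ h.image hg hadj

theorem mem_solids : S ∈ solids G ↔ IndSolid G S := isSolidGraph_induce_iff

theorem mem_inducedCycles : S ∈ inducedCycles G ↔ IndCycle G S := isCycleGraph_induce_iff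

/-- The graph that contains both `G` and `G / xy`, the contracted vertex being `none`. -/
def jointGraph {V : Type*} (G : SimpleGraph V) (x y : V) : SimpleGraph (Option V) where
  Adj
    | some a, some b => G.Adj a b
    | some a, none => (a ≠ x ∧ a ≠ y) ∧ (G.Adj x a ∨ G.Adj y a)
    | none, some b => (b ≠ x ∧ b ≠ y) ∧ (G.Adj x b ∨ G.Adj y b)
    | none, none => False
  symm := ⟨by
    rintro (_ | a) (_ | b) h
    · exact h
    · exact h
    · exact h
    · exact G.adj_symm h⟩
  loopless := ⟨by
    rintro (_ | a) h
    · exact h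
    · exact G.irrefl h⟩

/-- The embedding of `G` into the joint graph. -/
def someEmbedding {V : Type*} (G : SimpleGraph V) (x y : V) : G ↪g jointGraph G x y where
  toEmbedding := .some
  map_rel_iff' := Iff.rfl

/-- The embedding of `G / xy` into the joint graph. -/
def contractEmbedding {V : Type*} (G : SimpleGraph V) (x y : V) :
    contract G x y ↪g jointGraph G x y where
  toEmbedding := (Function.Embedding.subtype _).optionMap
  map_rel_iff' := by
    rintro (_ | ⟨a, ha⟩) (_ | ⟨b, hb⟩)
    exacts [Iff.rfl, and_iff_right hb, and_iff_right ha, Iff.rfl]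

theorem jointGraph_merges (h : G.Adj x y) :
    Merges (jointGraph G x y) none (some x) (some y) where
  adj_left_right := h
  ne_left := nofun
  ne_right := nofun
  adj_iff := by
    rintro (_ | b) hx hy
    · exact ⟨False.elim, fun h => h.elim (fun h => h.1.1 rfl) fun h => h.1.2 rfl⟩
    · exact and_iff_right ⟨fun e => hx (congrArg some e), fun e => hy (congrArg some e)⟩

theorem splits_image {f : V → W} : splits (f x) (f y) (f '' A) = (f '' ·) '' splits x y A := by
  simp only [splits, Set.image_insert_eq, Set.image_singleton]

theorem image_contractEmbedding_of_none_mem (hZ : none ∈ Z) :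
    contractEmbedding G x y '' Z = insert none (some '' oldVerts Z) := by
  ext (_ | w)
  · exact iff_of_true ⟨none, hZ, rfl⟩ (Or.inl rfl)
  · constructor
    · rintro ⟨_ | ⟨t, ht⟩, htZ, htw⟩
      · cases htw
      · exact Or.inr ⟨t, ⟨ht, htZ⟩, htw⟩
    · rintro (h | ⟨t, ⟨ht, htZ⟩, htw⟩)
      · cases h
      · exact ⟨_, htZ, htw⟩

theorem image_contractEmbedding_of_none_notMem (hZ : none ∉ Z) :
    contractEmbedding G x y '' Z = some '' oldVerts Z := by
  ext w
  constructor
  · rintro ⟨_ | ⟨t, ht⟩, htZ, rfl⟩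
    · exact absurd htZ hZ
    · exact ⟨t, ⟨ht, htZ⟩, rfl⟩
  · rintro ⟨t, ⟨ht, htZ⟩, rfl⟩
    exact ⟨_, htZ, rfl⟩

theorem mem_solids_contract_of_none_mem (hZ : none ∈ Z) :
    Z ∈ solids (contract G x y) ↔
      IndSolid (jointGraph G x y) (insert none (some '' oldVerts Z)) := by
  rw [mem_solids, ← indSolid_image_iff (contractEmbedding G x y),
    image_contractEmbedding_of_none_mem hZ]

theorem mem_inducedCycles_contract_of_none_mem (hZ : none ∈ Z) :
    Z ∈ inducedCycles (contract G x y) ↔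
      IndCycle (jointGraph G x y) (insert none (some '' oldVerts Z)) := by
  rw [mem_inducedCycles, ← indCycle_image_iff (contractEmbedding G x y),
    image_contractEmbedding_of_none_mem hZ]

theorem mem_solids_contract_of_none_notMem (hZ : none ∉ Z) :
    Z ∈ solids (contract G x y) ↔ oldVerts Z ∈ solids G := by
  rw [mem_solids, mem_solids, ← indSolid_image_iff (contractEmbedding G x y),
    image_contractEmbedding_of_none_notMem hZ]
  exact indSolid_image_iff (someEmbedding G x y)

theorem mem_inducedCycles_contract_of_none_notMem (hZ : none ∉ Z) :
    Z ∈ inducedCycles (contract G x y) ↔ oldVerts Z ∈ inducedCycles G := by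
  rw [mem_inducedCycles, mem_inducedCycles, ← indCycle_image_iff (contractEmbedding G x y),
    image_contractEmbedding_of_none_notMem hZ]
  exact indCycle_image_iff (someEmbedding G x y)

theorem exists_solid_image_contractMap_eq [Finite V] (hxy : G.Adj x y)
    (hZ : Z ∈ solids (contract G x y)) : ∃ T ∈ solids G, contractMap x y '' T = Z := by
  by_cases hn : none ∈ Z
  · rw [mem_solids_contract_of_none_mem hn] at hZ
    obtain ⟨T', hT', hS⟩ := (jointGraph_merges hxy).exists_indSolid_splits hZ (Or.inl rfl)
      (by simp [left_notMem_oldVerts]) (by simp [right_notMem_oldVerts])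
    rw [Set.insert_sdiff_self_of_notMem (by simp), splits_image] at hT'
    obtain ⟨T, hT, rfl⟩ := hT'
    exact ⟨T, mem_solids.2 ((indSolid_image_iff (someEmbedding G x y)).1 hS),
      (image_contractMap_of_none_mem hn).2 hT⟩
  · exact ⟨_, (mem_solids_contract_of_none_notMem hn).1 hZ,
      (image_contractMap_of_none_notMem hn).2 rfl⟩

end JointGraph

section Count

theorem ncard_eq_sum_ncard_fiber {α β : Type*} [Finite α] [Fintype β] (f : α → β) (D : Set α) :
    D.ncard = ∑ z, {a ∈ D | f a = z}.ncard := by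
  classical
  have := Fintype.ofFinite α
  rw [Set.ncard_eq_toFinset_card', Finset.card_eq_sum_card_fiberwise (f := f) (t := Finset.univ)
    fun _ _ => Finset.mem_coe.2 (Finset.mem_univ _)]
  refine Finset.sum_congr rfl fun z _ => ?_
  rw [Set.ncard_eq_toFinset_card']
  congr 1
  ext a
  simp

open Classical in
theorem ncard_eq_sum_ite {β : Type*} [Fintype β] (D : Set β) :
    D.ncard = ∑ z, if z ∈ D then 1 else 0 := by
  rw [Set.ncard_eq_toFinset_card', Finset.sum_boole, Nat.cast_id, Set.filter_mem_univ_eq_toFinset]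

open Classical in
theorem ncard_add_ncard_le {α β : Type*} [Finite α] [Finite β] (f : α → β) {C S : Set α}
    {C' S' T' : Set β}
    (h : ∀ z, {a ∈ C | f a = z}.ncard + (if z ∈ S' then 1 else 0) ≤
      {a ∈ S | f a = z}.ncard + (if z ∈ C' then 1 else 0) + (if z ∈ T' then 1 else 0)) :
    C.ncard + S'.ncard ≤ S.ncard + C'.ncard + T'.ncard := by
  have := Fintype.ofFinite β
  rw [ncard_eq_sum_ncard_fiber f C, ncard_eq_sum_ncard_fiber f S, ncard_eq_sum_ite S',
    ncard_eq_sum_ite C', ncard_eq_sum_ite T']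
  simp only [← Finset.sum_add_distrib]
  exact Finset.sum_le_sum fun z _ => h z

variable {V : Type*} {G : SimpleGraph V} {x y : V} {T : Set V} {Z : Set (ContractVert x y)}

theorem image_some_sep_splits {p : Set V → Prop} {q : Set (Option V) → Prop}
    (hpq : ∀ T, q (some '' T) ↔ p T) (hZ : none ∈ Z) :
    {T ∈ splits (some x) (some y) (some '' oldVerts Z) | q T} =
      (some '' ·) '' {T | p T ∧ contractMap x y '' T = Z} := by
  rw [splits_image]
  simp only [image_contractMap_of_none_mem hZ]
  ext T'
  constructor
  · rintro ⟨⟨T, hT, rfl⟩, hq⟩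
    exact ⟨T, ⟨(hpq T).1 hq, hT⟩, rfl⟩
  · rintro ⟨T, ⟨hp, hT⟩, rfl⟩
    exact ⟨⟨T, hT, rfl⟩, (hpq T).2 hp⟩

theorem ncard_indCycle_splits (hZ : none ∈ Z) :
    {T ∈ splits (some x) (some y) (some '' oldVerts Z) | IndCycle (jointGraph G x y) T}.ncard =
      {T ∈ inducedCycles G | contractMap x y '' T = Z}.ncard := by
  rw [image_some_sep_splits (p := (· ∈ inducedCycles G)) (fun T =>
    (indCycle_image_iff (someEmbedding G x y)).trans mem_inducedCycles.symm) hZ]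
  exact Set.ncard_image_of_injective _ (Set.image_injective.2 (Option.some_injective V))

theorem ncard_indSolid_splits (hZ : none ∈ Z) :
    {T ∈ splits (some x) (some y) (some '' oldVerts Z) | IndSolid (jointGraph G x y) T}.ncard =
      {T ∈ solids G | contractMap x y '' T = Z}.ncard := by
  rw [image_some_sep_splits (p := (· ∈ solids G)) (fun T =>
    (indSolid_image_iff (someEmbedding G x y)).trans mem_solids.symm) hZ]
  exact Set.ncard_image_of_injective _ (Set.image_injective.2 (Option.some_injective V))

/-- The edges of `G / xy` that arise from triangles containing `xy`, as sets of vertices. -/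
def triangleEdges {V : Type*} (G : SimpleGraph V) (x y : V) : Set (Set (ContractVert x y)) :=
  (fun p => {none, contractMap x y p}) '' G.commonNeighbors x y

theorem mem_triangleEdges {p : V} (hZ : none ∈ Z) (hp : oldVerts Z = {p}) (hxp : G.Adj x p)
    (hyp : G.Adj y p) : Z ∈ triangleEdges G x y := by
  have hxZ : insert x (oldVerts Z) ∈ splits x y (oldVerts Z) := Or.inl rfl
  have hZ' := (image_contractMap_of_none_mem hZ).2 hxZ
  rw [hp, Set.image_pair, contractMap_left] at hZ'
  exact ⟨p, ⟨hxp, hyp⟩, hZ'⟩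

theorem notMem_solids_contract_of_mem_inducedCycles (hxy : G.Adj x y) (hZ : none ∈ Z)
    (hT : T ∈ inducedCycles G) (hTZ : contractMap x y '' T = Z) :
    Z ∉ solids (contract G x y) := by
  rw [mem_solids_contract_of_none_mem hZ]
  refine not_indSolid_insert_of_indCycle_mem_splits (jointGraph_merges hxy).adj_left_right
    (by simp [left_notMem_oldVerts]) (by simp [right_notMem_oldVerts]) (T := some '' T) ?_
    ((indCycle_image_iff (someEmbedding G x y)).2 (mem_inducedCycles.1 hT))
  rw [splits_image]
  exact ⟨T, (image_contractMap_of_none_mem hZ).1 hTZ, rfl⟩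

theorem ncard_inducedCycles_fiber_le (hxy : G.Adj x y) (hZ : none ∈ Z) :
    {T ∈ inducedCycles G | contractMap x y '' T = Z}.ncard ≤
        {T ∈ solids G | contractMap x y '' T = Z}.ncard ∨
      {T ∈ inducedCycles G | contractMap x y '' T = Z}.ncard ≤
          {T ∈ solids G | contractMap x y '' T = Z}.ncard + 1 ∧
        (Z ∈ inducedCycles (contract G x y) ∨ Z ∈ triangleEdges G x y) := by
  have h := (jointGraph_merges hxy).ncard_indCycle_splits_le (A := some '' oldVerts Z)
    (by simp) (by simp [left_notMem_oldVerts]) (by simp [right_notMem_oldVerts])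
  rw [ncard_indCycle_splits hZ, ncard_indSolid_splits hZ,
    ← mem_inducedCycles_contract_of_none_mem hZ] at h
  refine h.imp_right (And.imp_right (Or.imp_right ?_))
  rintro ⟨p', hp, hxp, hyp⟩
  obtain ⟨p, -, rfl⟩ : p' ∈ some '' oldVerts Z := hp ▸ Set.mem_singleton p'
  rw [← Set.image_singleton] at hp
  exact mem_triangleEdges hZ (Set.image_injective.2 (Option.some_injective V) hp) hxp hyp

open Classical in
theorem ncard_inducedCycles_fiber_le_of_none_notMem (hZ : none ∉ Z) :
    {T ∈ inducedCycles G | contractMap x y '' T = Z}.ncard ≤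
      if Z ∈ inducedCycles (contract G x y) then 1 else 0 := by
  simp only [image_contractMap_of_none_notMem hZ]
  split_ifs with h
  · exact (Set.ncard_le_ncard fun T hT => hT.2).trans (Set.ncard_singleton (oldVerts Z)).le
  · rw [mem_inducedCycles_contract_of_none_notMem hZ] at h
    rw [Set.sep_eq_empty_iff_mem_false.2, Set.ncard_empty]
    rintro T hT rfl
    exact h hT

open Classical in
theorem ite_mem_solids_contract_le [Finite V] (hxy : G.Adj x y) (Z : Set (ContractVert x y)) :
    (if Z ∈ solids (contract G x y) then 1 else 0) ≤
      {T ∈ solids G | contractMap x y '' T = Z}.ncard := by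
  split_ifs with h
  · exact (Set.ncard_pos (Set.toFinite _)).2 (exists_solid_image_contractMap_eq hxy h)
  · exact Nat.zero_le _

open Classical in
theorem ncard_fiber_add_le [Finite V] (hxy : G.Adj x y) (Z : Set (ContractVert x y)) :
    {T ∈ inducedCycles G | contractMap x y '' T = Z}.ncard +
      (if Z ∈ solids (contract G x y) then 1 else 0) ≤
    {T ∈ solids G | contractMap x y '' T = Z}.ncard +
      (if Z ∈ inducedCycles (contract G x y) then 1 else 0) +
      (if Z ∈ triangleEdges G x y then 1 else 0) := by
  have hsolid := ite_mem_solids_contract_le hxy Z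
  by_cases hZ : none ∈ Z
  · rcases Set.eq_empty_or_nonempty {T ∈ inducedCycles G | contractMap x y '' T = Z} with
      hC | ⟨T, hT, hTZ⟩
    · rw [hC, Set.ncard_empty]
      omega
    · rw [if_neg (notMem_solids_contract_of_mem_inducedCycles hxy hZ hT hTZ)]
      rcases ncard_inducedCycles_fiber_le hxy hZ with hle | ⟨hle, hC | hT⟩
      · omega
      · rw [if_pos hC]
        omega
      · rw [if_pos hT]
        omega
  · have hcycle := ncard_inducedCycles_fiber_le_of_none_notMem (G := G) hZ
    omega

/-- The edges of `G` that have no edge of `G / xy` of their own: `xy` itself and, as the two other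
edges of a triangle through `xy` are identified, one of them for each such triangle. -/
def lostEdges {V : Type*} (G : SimpleGraph V) (x y : V) : Set (Sym2 V) :=
  insert s(x, y) ((fun p => s(y, p)) '' G.commonNeighbors x y)

theorem lostEdges_subset_edgeSet (hxy : G.Adj x y) : lostEdges G x y ⊆ G.edgeSet := by
  rintro e (rfl | ⟨p, hp, rfl⟩)
  exacts [hxy, hp.2]

theorem mk_left_notMem_lostEdges {p : V} (hp : p ∈ G.commonNeighbors x y) (hxy : G.Adj x y) :
    s(x, p) ∉ lostEdges G x y := by
  rintro (h | ⟨q, hq, h⟩)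
  · exact hp.2.ne (Sym2.congr_right.1 h).symm
  · rcases Sym2.eq_iff.1 h with ⟨hyx, -⟩ | ⟨-, rfl⟩
    exacts [hxy.ne' hyx, hq.1.ne rfl]

theorem ncard_lostEdges [Finite V] (hxy : G.Adj x y) :
    (lostEdges G x y).ncard = (G.commonNeighbors x y).ncard + 1 := by
  rw [lostEdges, Set.ncard_insert_of_notMem, Set.ncard_image_of_injective]
  · exact fun p q h => Sym2.congr_right.1 h
  · rintro ⟨p, hp, h⟩
    rcases Sym2.eq_iff.1 h with ⟨hyx, -⟩ | ⟨-, rfl⟩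
    exacts [hxy.ne' hyx, hp.1.ne rfl]

theorem edgeSet_contract_subset (hxy : G.Adj x y) :
    (contract G x y).edgeSet ⊆
      Sym2.map (contractMap x y) '' (G.edgeSet \ lostEdges G x y) := by
  rintro ⟨a, b⟩ (hab : (contract G x y).Adj a b)
  obtain ⟨u, w, rfl, rfl, huw⟩ := exists_adj_of_contract_adj hab
  by_cases hlost : s(u, w) ∈ lostEdges G x y
  · rcases hlost with h | ⟨p, hp, h⟩
    · refine absurd (contractMap_eq_iff.2 (Or.inr ?_)) hab.ne
      rcases Sym2.eq_iff.1 h with ⟨hu, hw⟩ | ⟨hu, hw⟩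
      exacts [⟨Or.inl hu, Or.inr hw⟩, ⟨Or.inr hu, Or.inl hw⟩]
    · refine ⟨s(x, p), ⟨hp.1, mk_left_notMem_lostEdges hp hxy⟩, ?_⟩
      refine Eq.trans ?_ (congrArg (Sym2.map (contractMap x y)) h)
      simp only [Sym2.map_mk, contractMap_left, contractMap_right]
  · exact ⟨s(u, w), ⟨huw, hlost⟩, rfl⟩

theorem ncard_edgeSet_contract_le [Finite V] (hxy : G.Adj x y) :
    (contract G x y).edgeSet.ncard + 1 + (triangleEdges G x y).ncard ≤ G.edgeSet.ncard := by
  have hcontract := (Set.ncard_le_ncard (edgeSet_contract_subset hxy)).trans Set.ncard_image_le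
  have htriangle : (triangleEdges G x y).ncard ≤ (G.commonNeighbors x y).ncard :=
    Set.ncard_image_le
  have hlost := ncard_lostEdges hxy
  have hdiff := Set.ncard_sdiff_add_ncard_of_subset (lostEdges_subset_edgeSet hxy)
  omega

theorem card_contractVert [Finite V] (hxy : x ≠ y) :
    Nat.card (ContractVert x y) + 1 = Nat.card V := by
  have hcard : Nat.card (ContractVert x y) = ({x, y}ᶜ : Set V).ncard + 1 := by
    rw [Finite.card_option, ← Nat.card_coe_set_eq]
    exact congrArg (· + 1) (Nat.card_congr (Equiv.subtypeEquivRight fun w => not_or.symm))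
  have hadd := Set.ncard_add_ncard_compl ({x, y} : Set V)
  rw [Set.ncard_pair hxy] at hadd
  omega

theorem beth3_contract_le [Finite V] (hxy : G.Adj x y) : beth3 (contract G x y) ≤ beth3 G := by
  have hsolids := ncard_add_ncard_le (contractMap x y '' ·) (ncard_fiber_add_le hxy)
  have hedges := ncard_edgeSet_contract_le hxy
  have hverts := card_contractVert hxy.ne
  unfold beth3
  omega

theorem exists_injOn_solids_contract [Finite V] (hxy : G.Adj x y) :
    ∃ Ψ : Set (ContractVert x y) → Set V,
      Set.MapsTo Ψ (solids (contract G x y)) (solids G) ∧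
      Set.InjOn Ψ (solids (contract G x y)) ∧
      ∀ S ∈ solids (contract G x y), contractMap x y '' (Ψ S) = S := by
  choose! Ψ hmem himage using fun S (hS : S ∈ solids (contract G x y)) =>
    exists_solid_image_contractMap_eq hxy hS
  exact ⟨Ψ, hmem, fun S hS T hT e => by rw [← himage S hS, e, himage T hT], himage⟩

end Count

/-- Pairwise adjacent disjoint connected branch sets of a complete minor on `t` vertices. -/
structure IsModel {V : Type*} (G : SimpleGraph V) {t : ℕ} (B : Fin t → Set V) : Prop where
  nonempty : ∀ i, (B i).Nonempty
  eq_of_mem : ∀ i j u, u ∈ B i → u ∈ B j → i = j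
  conn : ∀ i, Conn G (B i)
  adj : ∀ i j, i ≠ j → ∃ u ∈ B i, ∃ w ∈ B j, G.Adj u w

section Minor

universe u

variable {V W : Type*} {G : SimpleGraph V} {H : SimpleGraph W} {x y : V} {t : ℕ}

theorem IsModel.of_contract {B : Fin t → Set (ContractVert x y)} (hxy : G.Adj x y)
    (h : IsModel (contract G x y) B) : IsModel G fun i => contractMap x y ⁻¹' B i := by
  refine ⟨fun i => (h.nonempty i).preimage contractMap_surjective,
    fun i j u => h.eq_of_mem i j _, fun i => ?_, fun i j hij => ?_⟩
  · refine (h.conn i).of_fibers (fun u hu => hu) (fun a ha b hb hab => ?_) fun u w e => ?_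
    · obtain ⟨u, w, rfl, rfl, huw⟩ := exists_adj_of_contract_adj hab
      exact ⟨u, ha, w, hb, rfl, rfl, huw⟩
    · have : (u : V) = w ∨ G.Adj u w := by
        rcases contractMap_eq_iff.1 e with h' | ⟨hu | hu, hw | hw⟩
        · exact Or.inl h'
        · exact Or.inl (hu.trans hw.symm)
        · rw [hu, hw]; exact Or.inr hxy
        · rw [hu, hw]; exact Or.inr hxy.symm
        · exact Or.inl (hu.trans hw.symm)
      rcases this with h' | hadj
      · exact Subtype.ext h' ▸ .refl u
      · exact SimpleGraph.Adj.reachable (SimpleGraph.comap_adj.2 hadj)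
  · obtain ⟨a, ha, b, hb, hab⟩ := h.adj i j hij
    obtain ⟨u, w, rfl, rfl, huw⟩ := exists_adj_of_contract_adj hab
    exact ⟨u, ha, w, hb, huw⟩

theorem IsModel.contract {B : Fin t → Set V} (h : IsModel G B)
    (hxy : ∀ i j, x ∈ B i → y ∈ B j → i = j) :
    IsModel (GraphChar.contract G x y) fun i => contractMap x y '' B i := by
  have hdis : ∀ i j, ∀ u ∈ B i, ∀ w ∈ B j, contractMap x y u = contractMap x y w → i = j := by
    intro i j u hu w hw e
    rcases contractMap_eq_iff.1 e with rfl | ⟨rfl | rfl, rfl | rfl⟩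
    exacts [h.eq_of_mem i j _ hu hw, h.eq_of_mem i j _ hu hw, hxy i j hu hw, (hxy j i hw hu).symm,
      h.eq_of_mem i j _ hu hw]
  refine ⟨fun i => (h.nonempty i).image _, ?_, fun i => (h.conn i).image fun u _ w _ huw =>
    contractMap_eq_or_adj huw, fun i j hij => ?_⟩
  · rintro i j _ ⟨u, hu, rfl⟩ ⟨w, hw, e⟩
    exact hdis i j u hu w hw e.symm
  · obtain ⟨u, hu, w, hw, huw⟩ := h.adj i j hij
    exact ⟨_, ⟨u, hu, rfl⟩, _, ⟨w, hw, rfl⟩, (contractMap_eq_or_adj huw).resolve_left fun e =>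
      hij (hdis i j u hu w hw e)⟩

theorem ContractsTo.exists_model {V : Type u} {G : SimpleGraph V}
    (h : ContractsTo (⊤ : SimpleGraph (Fin t)) G) : ∃ B : Fin t → Set V, IsModel G B := by
  induction h with
  | iso φ =>
    refine ⟨fun i => {φ.symm i}, fun i => Set.singleton_nonempty _, ?_, fun i => conn_singleton _,
      fun i j hij => ⟨_, rfl, _, rfl, φ.symm.map_adj_iff.2 hij⟩⟩
    rintro i j u rfl e
    exact φ.symm.injective e
  | step hxy _ ih =>
    obtain ⟨B, hB⟩ := ih
    exact ⟨_, hB.of_contract hxy⟩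

theorem IsMinor.exists_model (h : IsMinor (⊤ : SimpleGraph (Fin t)) G) :
    ∃ B : Fin t → Set V, IsModel G B := by
  obtain ⟨G', h⟩ := h
  obtain ⟨B, hB⟩ := h.exists_model
  refine ⟨fun i => Subtype.val '' B i, fun i => (hB.nonempty i).image _, ?_, fun i =>
    (hB.conn i).image fun u _ w _ huw => Or.inr (G'.adj_sub huw), fun i j hij => ?_⟩
  · rintro i j _ ⟨u, hu, rfl⟩ ⟨w, hw, e⟩
    exact hB.eq_of_mem i j u hu (Subtype.val_injective e ▸ hw)
  · obtain ⟨u, hu, w, hw, huw⟩ := hB.adj i j hij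
    exact ⟨_, ⟨u, hu, rfl⟩, _, ⟨w, hw, rfl⟩, G'.adj_sub huw⟩

theorem IsModel.le_card [Finite V] {B : Fin t → Set V} (h : IsModel G B) : t ≤ Nat.card V := by
  choose f hf using h.nonempty
  have hinj : Function.Injective f := fun i j e => h.eq_of_mem i j _ (hf i) (e ▸ hf j)
  simpa using Nat.card_le_card_of_injective f hinj

theorem bddAbove_setOf_isMinor_top [Finite V] (G : SimpleGraph V) :
    BddAbove {t : ℕ | IsMinor (⊤ : SimpleGraph (Fin t)) G} := by
  refine ⟨Nat.card V, fun t ht => ?_⟩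
  obtain ⟨B, hB⟩ := IsMinor.exists_model ht
  exact hB.le_card

theorem isMinor_top_zero (G : SimpleGraph V) : IsMinor (⊤ : SimpleGraph (Fin 0)) G := by
  have : IsEmpty (⊥ : G.Subgraph).verts := inferInstanceAs (IsEmpty (∅ : Set V))
  exact ⟨⊥, .iso ⟨Equiv.equivOfIsEmpty _ _, fun {v} => isEmptyElim v⟩⟩

theorem isMinor_top_one [Nonempty V] (G : SimpleGraph V) :
    IsMinor (⊤ : SimpleGraph (Fin 1)) G := by
  obtain ⟨v⟩ := ‹Nonempty V›
  have : Unique (G.singletonSubgraph v).verts := ⟨⟨⟨v, rfl⟩⟩, fun w => Subtype.ext w.2⟩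
  refine ⟨G.singletonSubgraph v, .iso ⟨Equiv.ofUnique _ _, fun {a b} => ?_⟩⟩
  simp only [Subsingleton.elim a b, SimpleGraph.irrefl]

theorem isMinor_top_hadwigerNumber [Finite V] (G : SimpleGraph V) :
    IsMinor (⊤ : SimpleGraph (Fin (hadwigerNumber G))) G :=
  Nat.sSup_mem (s := {t : ℕ | IsMinor (⊤ : SimpleGraph (Fin t)) G}) ⟨0, isMinor_top_zero G⟩
    (bddAbove_setOf_isMinor_top G)

theorem one_le_hadwigerNumber [Finite V] [Nonempty V] (G : SimpleGraph V) :
    1 ≤ hadwigerNumber G :=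
  le_csSup (bddAbove_setOf_isMinor_top G) (isMinor_top_one G)

theorem beth3_congr (φ : G ≃g H) : beth3 G = beth3 H := by
  have ncard_eq {A : Set (Set V)} {B : Set (Set W)} (h : ∀ S, S ∈ A ↔ φ '' S ∈ B) :
      A.ncard = B.ncard := by
    have hbij := (Equiv.Set.congr φ.toEquiv).bijective
    rw [← Set.ncard_preimage_of_injective_subset_range hbij.injective
      (hbij.surjective.range_eq ▸ Set.subset_univ B)]
    exact congrArg Set.ncard (Set.ext h)
  have hsolids : (solids G).ncard = (solids H).ncard :=
    ncard_eq fun S => by rw [mem_solids, mem_solids, ← indSolid_image_iff φ.toEmbedding]; rfl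
  have hcycles : (inducedCycles G).ncard = (inducedCycles H).ncard :=
    ncard_eq fun S => by
      rw [mem_inducedCycles, mem_inducedCycles, ← indCycle_image_iff φ.toEmbedding]; rfl
  have hedges : G.edgeSet.ncard = H.edgeSet.ncard := Nat.card_congr φ.mapEdgeSet
  rw [beth3, beth3, hsolids, hcycles, hedges, Nat.card_congr φ.toEquiv]

theorem IsModel.nonempty_iso {B : Fin t → Set V} (h : IsModel G B) (ht : 1 ≤ t)
    (hG : G.Preconnected) (hB : ∀ x y, G.Adj x y → ∃ i j, x ∈ B i ∧ y ∈ B j ∧ i ≠ j) :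
    Nonempty ((⊤ : SimpleGraph (Fin t)) ≃g G) := by
  have hsing : ∀ i, ∀ u ∈ B i, ∀ w ∈ B i, u = w := by
    intro i u hu w hw
    by_contra hne
    obtain ⟨c, hc, huc⟩ := (h.conn i).exists_adj hu hw hne
    obtain ⟨j, k, hj, hk, hjk⟩ := hB u c huc
    exact hjk ((h.eq_of_mem j i u hj hu).trans (h.eq_of_mem i k c hc hk))
  have hcov : ∀ v, ∃ i, v ∈ B i := by
    intro v
    obtain ⟨b, hb⟩ := h.nonempty ⟨0, ht⟩
    obtain ⟨_ | ⟨hadj, -⟩⟩ := hG v b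
    · exact ⟨_, hb⟩
    · obtain ⟨i, -, hi, -⟩ := hB v _ hadj
      exact ⟨i, hi⟩
  choose f hf using h.nonempty
  have hbij : Function.Bijective f := by
    refine ⟨fun i j e => h.eq_of_mem i j _ (hf i) (e ▸ hf j), fun v => ?_⟩
    obtain ⟨i, hi⟩ := hcov v
    exact ⟨i, hsing i _ (hf i) v hi⟩
  refine ⟨⟨Equiv.ofBijective f hbij, fun {i j} => ⟨fun hij => ?_, fun hij => ?_⟩⟩⟩
  · rintro rfl
    exact G.irrefl hij
  · obtain ⟨u, hu, w, hw, huw⟩ := h.adj i j hij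
    change G.Adj (f i) (f j)
    rwa [hsing i _ (hf i) u hu, hsing j _ (hf j) w hw]

theorem preconnected_contract (h : G.Preconnected) : (contract G x y).Preconnected := by
  intro a b
  obtain ⟨u, rfl⟩ := contractMap_surjective a
  obtain ⟨w, rfl⟩ := contractMap_surjective b
  refine reachable_map_of_adj (h u w) fun u w huw => ?_
  rcases contractMap_eq_or_adj huw with e | hadj
  · rw [e]
  · exact hadj.reachable

theorem IsModel.beth3_le {V : Type u} [Finite V] {G : SimpleGraph V} {B : Fin t → Set V}
    (h : IsModel G B) (ht : 1 ≤ t) (hG : G.Preconnected) :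
    beth3 (⊤ : SimpleGraph (Fin t)) ≤ beth3 G := by
  induction hn : Nat.card V generalizing V with
  | zero =>
    have := h.le_card
    omega
  | succ n ih =>
    by_cases hB : ∀ x y, G.Adj x y → ∃ i j, x ∈ B i ∧ y ∈ B j ∧ i ≠ j
    · obtain ⟨φ⟩ := h.nonempty_iso ht hG hB
      exact (beth3_congr φ).le
    · push Not at hB
      obtain ⟨x, y, hxy, hij⟩ := hB
      have hcard := card_contractVert hxy.ne
      exact (ih (h.contract hij) (preconnected_contract hG) (by omega)).trans
        (beth3_contract_le hxy)

theorem ncard_setOf_ncard_eq [Finite V] (k : ℕ) :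
    {s : Set V | s.ncard = k}.ncard = (Nat.card V).choose k := by
  have := Fintype.ofFinite V
  have himg : {s : Set V | s.ncard = k} =
      (fun F : Finset V => (F : Set V)) '' ((Finset.univ : Finset V).powersetCard k : Set _) := by
    ext s
    constructor
    · intro hs
      refine ⟨s.toFinite.toFinset, ?_, s.toFinite.coe_toFinset⟩
      rw [Finset.mem_coe, Finset.mem_powersetCard_univ, ← Set.ncard_eq_toFinset_card s]
      exact hs
    · rintro ⟨F, hF, rfl⟩
      exact (Set.ncard_coe_finset F).trans (Finset.mem_powersetCard_univ.1 hF)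
  rw [himg, Set.ncard_image_of_injective _ Finset.coe_injective, Set.ncard_coe_finset,
    Finset.card_powersetCard, Finset.card_univ, Nat.card_eq_fintype_card]

theorem mem_solids_top_of_ncard_eq_four {s : Set V} (hs : s.ncard = 4) :
    s ∈ solids (⊤ : SimpleGraph V) := by
  have hfin : s.Finite := Set.finite_of_ncard_ne_zero (by simp [hs])
  obtain ⟨d, T, hd, rfl, hT⟩ := (Set.ncard_eq_succ hfin).1 hs
  obtain ⟨a, b, c, hab, hac, hbc, rfl⟩ := Set.ncard_eq_three.1 hT
  simp only [Set.mem_insert_iff, Set.mem_singleton_iff, not_or] at hd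
  exact mem_solids.2 (Or.inl ⟨{a, b, c}, d, indCycle_triangle hab hac hbc, by simpa using hd, rfl,
    a, by simp, b, by simp, c, by simp, hab, hac, hbc, hd.1, hd.2.1, hd.2.2⟩)

theorem ncard_eq_three_of_mem_inducedCycles_top {C : Set V}
    (hC : C ∈ inducedCycles (⊤ : SimpleGraph V)) : C.ncard = 3 := by
  obtain ⟨v, a, b, S, rfl, h⟩ := mem_inducedCycles.1 hC
  exact Set.ncard_eq_three.2
    ⟨v, a, b, h.left.ne, h.right.ne, h.ne, by rw [h.path.eq_pair h.ne]⟩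

theorem le_beth3_top (V : Type*) [Finite V] :
    ((Nat.card V).choose 4 : ℤ) - (Nat.card V).choose 3 + (Nat.card V).choose 2 - Nat.card V ≤
      beth3 (⊤ : SimpleGraph V) := by
  have hsolids : (Nat.card V).choose 4 ≤ (solids (⊤ : SimpleGraph V)).ncard := by
    rw [← ncard_setOf_ncard_eq 4]
    exact Set.ncard_le_ncard fun s hs => mem_solids_top_of_ncard_eq_four hs
  have hcycles : (inducedCycles (⊤ : SimpleGraph V)).ncard ≤ (Nat.card V).choose 3 := by
    rw [← ncard_setOf_ncard_eq 3]
    exact Set.ncard_le_ncard fun C hC => ncard_eq_three_of_mem_inducedCycles_top hC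
  have hedges : (⊤ : SimpleGraph V).edgeSet.ncard = (Nat.card V).choose 2 := by
    rw [SimpleGraph.edgeSet_top]
    exact Sym2.ncard_diagSet_compl V
  rw [beth3, hedges]
  omega

end Minor

end GraphChar

theorem theorem4p2p1 {V : Type*} [Finite V] (G : SimpleGraph V) :
    (∀ x y : V, G.Adj x y →
      (∃ Ψ : Set (GraphChar.ContractVert x y) → Set V,
        Set.MapsTo Ψ (GraphChar.solids (GraphChar.contract G x y)) (GraphChar.solids G) ∧
        Set.InjOn Ψ (GraphChar.solids (GraphChar.contract G x y)) ∧
        ∀ S ∈ GraphChar.solids (GraphChar.contract G x y),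
          GraphChar.contractMap x y '' (Ψ S) = S) ∧
      GraphChar.beth3 (GraphChar.contract G x y) ≤ GraphChar.beth3 G) ∧
    (G.Connected →
      GraphChar.beth3 (⊤ : SimpleGraph (Fin (GraphChar.hadwigerNumber G))) ≤
          GraphChar.beth3 G ∧
      ((GraphChar.hadwigerNumber G).choose 4 : ℤ) - (GraphChar.hadwigerNumber G).choose 3
          + (GraphChar.hadwigerNumber G).choose 2 - (GraphChar.hadwigerNumber G) ≤
        GraphChar.beth3 G) := by
  refine ⟨fun x y hxy => ⟨GraphChar.exists_injOn_solids_contract hxy,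
    GraphChar.beth3_contract_le hxy⟩, fun hG => ?_⟩
  have := hG.nonempty
  obtain ⟨B, hB⟩ := (GraphChar.isMinor_top_hadwigerNumber G).exists_model
  have hle := hB.beth3_le (GraphChar.one_le_hadwigerNumber G) hG.preconnected
  have hbinom := GraphChar.le_beth3_top (Fin (GraphChar.hadwigerNumber G))
  rw [Nat.card_fin] at hbinom
  exact ⟨hle, hbinom.trans hle⟩
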